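/- **Setting.** Let $d\ge 0$, $q\ge 1$. For $\theta\in\mathbb R^d$ let $X=X_\theta$ be a random vector in $\mathbb R^q$ (its law may depend on $\theta$), $F:\mathbb R^d\times\mathbb R^q\to\mathbb R$ measurable, and $f(\theta)=\mathbb E[F(\theta,X_\theta)]$. Assume: 1. $f$ is differentiable on $\mathbb R^d$, bounded below, and $\nabla f$ is Lipschitz continuous. 2. $F(\theta,\cdot)$ is $C^1$ at every point of the set $\mathcal X_\theta$ of values of $X_\theta$, and $\operatorname{Var}F(\theta,X_\theta)$ is finite and bounded in $\theta$. 3. There is a continuous bijection $\mu_\theta:\mathcal X_\theta\to\mathcal U$ with continuous inverse, where $(0,1)^q\subseteq\mathcal U\subseteq[0,1]^q$; $\mu_\theta$ and $\mu_\theta^{-1}$ are $C^1$ almost everywhere, $\mu_\theta(X_\theta)$ is uniform on the unit cube, and $(\theta,u)\mapsto\mu_\theta^{-1}(u)$ is measurable. **Specifications.** Let $\delta,\varrho>0$ be arbitrary. Assume that one of the following five cases holds and set $(\lambda_k)_{k\ge0}$ and $\gamma$ accordingly; all constants $C$ are independent of $\theta$. * (i) $\|\nabla\mu_\theta^{-1}(u)\|\le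 C$ for all $u\in(0,1)^q$ and all $\theta$, and $\|\nabla_xF(\theta,x)\|\le C$ for all $\theta$ and $x\in\mathcal X_\theta$: $\lambda_k=k^{(1+\delta)q/(q+2)}$, $\gamma=\frac{2q}{q+2}$. In cases (ii)–(v) the components of $X_\theta$ are mutually independent and $\mu_\theta$ applies to each component its cumulative distribution function. Call the components *sub-exponential* with $\kappa\in(0,\infty)^q$ if $\mathbb P(|X_{\theta,j}|\ge y)\le Ce^{-\kappa_jy}$, and *sub-Gaussian* with $\xi\in(0,\infty)^q$ if $\mathbb P(|X_{\theta,j}|\ge y)\le Ce^{-(y/\xi_j)^2}$, for all $j$, $\theta$, $y\ge0$. Call $F$ *polynomial* with $a\in\mathbb N^q$ (respectively *exponential* with $b\in[0,\infty)^q$) if, with $G(x)=1+\sum_j|x_j|^{a_j}$ (respectively $G(x)=e^{\sum_jb_j|x_j|}$), $|F(\theta,x)|\le C_\theta G(x)$ and $\|\nabla_xF(\theta,x)\|\le C\,G(x)$ for all $\theta$ and $x\in\mathcal X_\theta$, where $C_\theta$ may depend on $\theta$. * (ii) sub-exponential components, polynomial $F$; or (iv) sub-Gaussian components, polynomial $F$;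 or (v) sub-Gaussian components, exponential $F$: $\lambda_k=k^{(1+\delta)q/(q+1)}$, $\gamma=\frac{(4+\varrho)q}{2(q+1)}$. * (iii) sub-exponential components, exponential $F$, with $b_{\max}=\max_jb_j$, $\kappa_{\min}=\min_j\kappa_j$, $0<2b_{\max}<\kappa_{\min}$: $\lambda_k=k^{\frac{(1+\delta)q\kappa_{\min}}{(q+1)\kappa_{\min}-2b_{\max}}}$, $\gamma=\frac{2q\kappa_{\min}}{(q+1)\kappa_{\min}-2b_{\max}}$. **Algorithm (SASTRO-DF).** Inputs: $\theta_0\in\mathbb R^d$; $\Delta_0,\Delta_{\max},\tilde\eta,\sigma_{\min},\kappa_{as}>0$; $\eta\in(0,1)$; $0<\underline\gamma<1<\overline\gamma$; an integer $\overline n\ge2$. *Evaluation at a point $\theta$ at iteration $k$.* For $l\ge1$ split $(0,1]^q$ into the $\ell=l^q$ congruent half-open cubes of side $1/l$, draw $\overline n$ independent uniform points $u$ in each, and put $n=\overline n\,l^q$. Let $\tilde f(\theta,n)$ be the average over the $\ell$ strata of the sample means of $F(\theta,\mu_\theta^{-1}(u))$, and let $\hat\sigma^2(\theta,n)$ be the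 average over the strata of the unbiased sample variances. The sample size $N$ is the smallest $n\in\{\overline n\,l^q:l\ge1\}$ with $n\ge\lambda_k$ and $\sqrt{\max(\sigma_{\min}^2,\hat\sigma^2(\theta,n))/n}\le\kappa_{as}\Delta_k^\gamma/\sqrt{\lambda_k}$ (the right side is $+\infty$ if $\lambda_k=0$), and the estimate is $\tilde f(\theta,N)$. All uniform draws, over iterations, points, values of $l$, strata and replications, are independent. *Iteration $k\ge0$.* Evaluate at $\theta_k$ and $\theta_k\pm\Delta_ke_j$, $j=1,\dots,d$. Let $M_k$ be the diagonal quadratic model in the span of $1$, $x_j-\theta_{k,j}$, $\frac12(x_j-\theta_{k,j})^2$ that interpolates these $2d+1$ estimates. Let $\theta_k^s$ minimize $M_k$ over the closed ball of centre $\theta_k$ and radius $\Delta_k$ (with a measurable selection of the minimizer as a function of the centre, the radius and the model), evaluate at $\theta_k^s$, and let $\rho_k=\dfrac{\tilde f(\theta_k,N_k)-\tilde f(\theta_k^s,N_k^s)}{M_k(\theta_k)-M_k(\theta_k^s)}$. The iteration is *successful* if $\rho_k\ge\eta$ and $\Delta_k\le\tilde\eta\|\nabla M_k(\theta_k)\|$;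 then $\theta_{k+1}=\theta_k^s$, $\Delta_{k+1}=\min(\overline\gamma\Delta_k,\Delta_{\max})$. Otherwise $\theta_{k+1}=\theta_k$, $\Delta_{k+1}=\underline\gamma\Delta_k$. **Theorem (almost-sure convergence of SASTRO-DF).** Assume that almost surely the Hessians $\mathsf B_k=\nabla^2M_k$ are bounded: $\|\mathsf B_k\|\le\kappa_H<\infty$ for all $k\ge0$ (the bound $\kappa_H$ may be random). Then almost surely $$\|\nabla f(\theta_k)\|\to0,\qquad\sum_{k\ \text{successful}}\Delta_k^2<\infty,\qquad\Delta_k\to0\qquad(k\to\infty).$$ -/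

import Mathlib

open MeasureTheory ProbabilityTheory Filter Topology

noncomputable section

namespace Sastro

/-- The decision space `ℝ^d` with its Euclidean norm. -/
abbrev Dec (d : ℕ) := EuclideanSpace ℝ (Fin d)

/-! ### The stochastic optimization problem and the sampling map -/

/-- The data of the problem: the law of `X = X_θ` (it may depend on the decision vector `θ`), the
sets `𝒳_θ` and `𝒰` of values of `X_θ` and of the uniform vector, the map `μ_θ : 𝒳_θ → 𝒰`, its
inverse `ν_θ = μ_θ⁻¹ : 𝒰 → 𝒳_θ`, and the noisy objective `F(θ, x)`. -/
structure Problem (d q : ℕ) where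
  law : Dec d → Measure (Fin q → ℝ)
  supp : Dec d → Set (Fin q → ℝ)
  unitSupp : Set (Fin q → ℝ)
  mu : Dec d → (Fin q → ℝ) → (Fin q → ℝ)
  muInv : Dec d → (Fin q → ℝ) → (Fin q → ℝ)
  F : Dec d → (Fin q → ℝ) → ℝ

/-- The open unit cube `(0,1)^q`. -/
def openCube (q : ℕ) : Set (Fin q → ℝ) := Set.univ.pi fun _ => Set.Ioo 0 1

/-- The closed unit cube `[0,1]^q`. -/
def closedCube (q : ℕ) : Set (Fin q → ℝ) := Set.univ.pi fun _ => Set.Icc 0 1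

/-- The uniform distribution on `(0,1]^q`. -/
def unifCube (q : ℕ) : Measure (Fin q → ℝ) :=
  volume.restrict (Set.univ.pi fun _ => Set.Ioc 0 1)

variable {d q : ℕ}

/-- The objective function `f(θ) = E[F(θ, X_θ)]`. -/
def Problem.f (P : Problem d q) (θ : Dec d) : ℝ := ∫ x, P.F θ x ∂(P.law θ)

/-- `f` is differentiable, bounded below and its gradient is Lipschitz continuous. -/
structure Problem.SmoothObjective (P : Problem d q) : Prop where
  differentiable : Differentiable ℝ P.f
  bddBelow : BddBelow (Set.range P.f)
  lipschitz : ∃ L : NNReal, LipschitzWith L (gradient P.f)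

/-- `F(θ, ·)` is continuously differentiable on the values of `X_θ`, and `F(θ, X_θ)` has a variance
bounded in `θ`. -/
structure Problem.RegularNoise (P : Problem d q) : Prop where
  measurable : Measurable fun p : Dec d × (Fin q → ℝ) => P.F p.1 p.2
  contDiffAt : ∀ θ, ∀ x ∈ P.supp θ, ContDiffAt ℝ 1 (P.F θ) x
  memLp : ∀ θ, MemLp (P.F θ) 2 (P.law θ)
  variance_le : ∃ V : ℝ, ∀ θ, variance (P.F θ) (P.law θ) ≤ V

/-- `μ_θ : 𝒳_θ → 𝒰` is a homeomorphism with inverse `ν_θ`, both are continuously differentiable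
almost everywhere, and `μ_θ` transports the law of `X_θ` to the uniform law. The set `𝒰` is the
unit cube, open, closed, or half open in any way. -/
structure Problem.SamplingMap (P : Problem d q) : Prop where
  isProbability : ∀ θ, IsProbabilityMeasure (P.law θ)
  openCube_subset : openCube q ⊆ P.unitSupp
  subset_closedCube : P.unitSupp ⊆ closedCube q
  law_compl_supp : ∀ θ, P.law θ (P.supp θ)ᶜ = 0
  bijOn : ∀ θ, Set.BijOn (P.mu θ) (P.supp θ) P.unitSupp
  invOn : ∀ θ, Set.InvOn (P.muInv θ) (P.mu θ) (P.supp θ) P.unitSupp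
  continuousOn_mu : ∀ θ, ContinuousOn (P.mu θ) (P.supp θ)
  continuousOn_muInv : ∀ θ, ContinuousOn (P.muInv θ) P.unitSupp
  contDiff_mu : ∀ θ, ∀ᵐ x ∂(P.law θ), ContDiffAt ℝ 1 (P.mu θ) x
  contDiff_muInv : ∀ θ, ∀ᵐ u ∂(unifCube q), ContDiffAt ℝ 1 (P.muInv θ) u
  map_law : ∀ θ, (P.law θ).map (P.mu θ) = unifCube q
  measurable_muInv : Measurable fun p : Dec d × (Fin q → ℝ) => P.muInv p.1 p.2

/-! ### The five specifications of the pair `(F, μ)` -/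

/-- `μ_θ⁻¹` is differentiable on the open cube with a bounded derivative, uniformly in `θ`. -/
def Problem.BoundedInverseGradient (P : Problem d q) : Prop :=
  ∃ C : ℝ, ∀ θ, ∀ u ∈ openCube q,
    DifferentiableAt ℝ (P.muInv θ) u ∧ ‖fderiv ℝ (P.muInv θ) u‖ ≤ C

/-- The derivative of `F(θ, ·)` is bounded on the values of `X_θ`, uniformly in `θ`. -/
def Problem.BoundedNoiseGradient (P : Problem d q) : Prop :=
  ∃ C : ℝ, ∀ θ, ∀ x ∈ P.supp θ, ‖fderiv ℝ (P.F θ) x‖ ≤ C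

/-- The components of `X_θ` are mutually independent, and `μ_θ` is the Rosenblatt transformation,
which then applies to each component its own cumulative distribution function. -/
def Problem.IndependentComponents (P : Problem d q) : Prop :=
  ∀ θ, iIndepFun (fun (j : Fin q) (x : Fin q → ℝ) => x j) (P.law θ) ∧
    ∀ x ∈ P.supp θ, ∀ j, P.mu θ x j = (P.law θ).real {y | y j ≤ x j}

/-- The `j`-th component is sub-exponential with parameter `κ j`, for every `j`. -/
def Problem.SubExponential (P : Problem d q) (κ : Fin q → ℝ) : Prop :=
  ∀ j, 0 < κ j ∧ ∃ C : ℝ, ∀ θ, ∀ y : ℝ, 0 ≤ y →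
    (P.law θ).real {x | y ≤ |x j|} ≤ C * Real.exp (-(κ j * y))

/-- The `j`-th component is sub-Gaussian with parameter `ξ j`, for every `j`. -/
def Problem.SubGaussian (P : Problem d q) (ξ : Fin q → ℝ) : Prop :=
  ∀ j, 0 < ξ j ∧ ∃ C : ℝ, ∀ θ, ∀ y : ℝ, 0 ≤ y →
    (P.law θ).real {x | y ≤ |x j|} ≤ C * Real.exp (-(y / ξ j) ^ 2)

/-- `F` is polynomial in `X` with parameter `a`: it grows at most like `∑ |x_j|^(a_j)`, and so does
its derivative in `x`, the latter uniformly in `θ`. -/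
def Problem.PolynomialGrowth (P : Problem d q) (a : Fin q → ℕ) : Prop :=
  (∀ θ, ∃ C : ℝ, ∀ x ∈ P.supp θ, |P.F θ x| ≤ C * (1 + ∑ j, |x j| ^ a j)) ∧
  ∃ C : ℝ, ∀ θ, ∀ x ∈ P.supp θ, ‖fderiv ℝ (P.F θ) x‖ ≤ C * (1 + ∑ j, |x j| ^ a j)

/-- `F` is exponential in `X` with parameter `b`: it grows at most like `exp (∑ b_j |x_j|)`, and so
does its derivative in `x`, the latter uniformly in `θ`. -/
def Problem.ExponentialGrowth (P : Problem d q) (b : Fin q → ℝ) : Prop :=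
  (∀ j, 0 ≤ b j) ∧
  (∀ θ, ∃ C : ℝ, ∀ x ∈ P.supp θ, |P.F θ x| ≤ C * Real.exp (∑ j, b j * |x j|)) ∧
  ∃ C : ℝ, ∀ θ, ∀ x ∈ P.supp θ, ‖fderiv ℝ (P.F θ) x‖ ≤ C * Real.exp (∑ j, b j * |x j|)

/-- `P.Regime e γ` says that `(F, μ)` is in one of the five specifications, and that the sampling
rule is run with the deflation sequence `λ_k = k ^ e` and the radius exponent `γ` prescribed for
that specification. -/
inductive Problem.Regime (P : Problem d q) : ℝ → ℝ → Prop
  | bounded (δ : ℝ) (hδ : 0 < δ)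
      (hmu : P.BoundedInverseGradient) (hF : P.BoundedNoiseGradient) :
      P.Regime ((1 + δ) * q / (q + 2)) (2 * q / (q + 2))
  | subExpPoly (δ ϱ : ℝ) (hδ : 0 < δ) (hϱ : 0 < ϱ) (κ : Fin q → ℝ) (a : Fin q → ℕ)
      (hind : P.IndependentComponents) (hmu : P.SubExponential κ) (hF : P.PolynomialGrowth a) :
      P.Regime ((1 + δ) * q / (q + 1)) ((4 + ϱ) * q / (2 * (q + 1)))
  | subExpExp (δ : ℝ) (hδ : 0 < δ) (κ b : Fin q → ℝ)
      (hind : P.IndependentComponents) (hmu : P.SubExponential κ) (hF : P.ExponentialGrowth b)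
      (hb : 0 < ⨆ j, b j) (hκ : 2 * (⨆ j, b j) < ⨅ j, κ j) :
      P.Regime ((1 + δ) * q * (⨅ j, κ j) / ((q + 1) * (⨅ j, κ j) - 2 * ⨆ j, b j))
        (2 * q * (⨅ j, κ j) / ((q + 1) * (⨅ j, κ j) - 2 * ⨆ j, b j))
  | subGaussPoly (δ ϱ : ℝ) (hδ : 0 < δ) (hϱ : 0 < ϱ) (ξ : Fin q → ℝ) (a : Fin q → ℕ)
      (hind : P.IndependentComponents) (hmu : P.SubGaussian ξ) (hF : P.PolynomialGrowth a) :
      P.Regime ((1 + δ) * q / (q + 1)) ((4 + ϱ) * q / (2 * (q + 1)))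
  | subGaussExp (δ ϱ : ℝ) (hδ : 0 < δ) (hϱ : 0 < ϱ) (ξ b : Fin q → ℝ)
      (hind : P.IndependentComponents) (hmu : P.SubGaussian ξ) (hF : P.ExponentialGrowth b) :
      P.Regime ((1 + δ) * q / (q + 1)) ((4 + ϱ) * q / (2 * (q + 1)))

/-! ### The stratified estimator and the adaptive sample size

One evaluation at a point `θ` uses uniform draws `v l s m`: number of splits `l` per dimension (so
`l ^ q` strata), stratum `s`, replication `m`. -/

/-- The draws that are available to one evaluation. -/
abbrev Draws (q : ℕ) := ℕ → (Fin q → ℕ) → ℕ → (Fin q → ℝ)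

/-- The `m`-th observation `F(θ, μ_θ⁻¹(u))` in the stratum `∏_j (s_j/l, (s_j+1)/l]`, at the point
`u = (s + v)/l` of that stratum. -/
def Problem.obs (P : Problem d q) (v : Draws q) (θ : Dec d) (l : ℕ) (s : Fin q → Fin l) (m : ℕ) :
    ℝ :=
  P.F θ (P.muInv θ fun j => ((s j : ℝ) + v l (fun i => (s i : ℕ)) m j) / l)

/-- The sample mean in the stratum `s` with `nbar` observations. -/
def Problem.stratumMean (P : Problem d q) (nbar : ℕ) (v : Draws q) (θ : Dec d) (l : ℕ)
    (s : Fin q → Fin l) : ℝ :=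
  (∑ m ∈ Finset.range nbar, P.obs v θ l s m) / nbar

/-- The (unbiased) sample variance in the stratum `s` with `nbar` observations. -/
def Problem.stratumVar (P : Problem d q) (nbar : ℕ) (v : Draws q) (θ : Dec d) (l : ℕ)
    (s : Fin q → Fin l) : ℝ :=
  (∑ m ∈ Finset.range nbar, (P.obs v θ l s m - P.stratumMean nbar v θ l s) ^ 2) /
    ((nbar : ℝ) - 1)

/-- The stratified sampling estimator of `f(θ)` with `n = nbar * l ^ q` observations. -/
def Problem.estimate (P : Problem d q) (nbar : ℕ) (v : Draws q) (θ : Dec d) (l : ℕ) : ℝ :=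
  (∑ s : Fin q → Fin l, P.stratumMean nbar v θ l s) / (l : ℝ) ^ q

/-- The estimated variance, bounded below through `σ_min²`, of the stratified estimator. -/
def Problem.varEstimate (P : Problem d q) (nbar : ℕ) (σmin : ℝ) (v : Draws q) (θ : Dec d) (l : ℕ) :
    ℝ :=
  max (σmin ^ 2) ((∑ s : Fin q → Fin l, P.stratumVar nbar v θ l s) / (l : ℝ) ^ q) /
    ((nbar : ℝ) * (l : ℝ) ^ q)

/-- The parameters of the algorithm. -/
structure Params (d : ℕ) where
  θ₀ : Dec d
  Δ₀ : ℝ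
  Δmax : ℝ
  η : ℝ
  ηtilde : ℝ
  γup : ℝ
  γdown : ℝ
  σmin : ℝ
  κas : ℝ
  nbar : ℕ
  Δ₀_pos : 0 < Δ₀
  Δmax_pos : 0 < Δmax
  η_pos : 0 < η
  η_lt_one : η < 1
  ηtilde_pos : 0 < ηtilde
  one_lt_γup : 1 < γup
  γdown_pos : 0 < γdown
  γdown_lt_one : γdown < 1
  σmin_pos : 0 < σmin
  κas_pos : 0 < κas
  two_le_nbar : 2 ≤ nbar

/-- `Acceptable … l` is the adaptive sampling rule for the sample size `n = nbar * l ^ q`: `n ≥ λ_k`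
and `√Var ≤ κ_as Δ^γ / √λ_k`, written without division so that it has the right meaning at
`λ_0 = 0`. -/
def Problem.Acceptable (P : Problem d q) (A : Params d) (e γ : ℝ) (k : ℕ) (Δ : ℝ) (v : Draws q)
    (θ : Dec d) (l : ℕ) : Prop :=
  1 ≤ l ∧ (k : ℝ) ^ e ≤ (A.nbar : ℝ) * (l : ℝ) ^ q ∧
    √((k : ℝ) ^ e) * √(P.varEstimate A.nbar A.σmin v θ l) ≤ A.κas * Δ ^ γ

/-- The number of splits per dimension at the adaptive sample size `N = nbar * l ^ q`, the smallest
sample size that the sampling rule accepts. -/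
def Problem.splits (P : Problem d q) (A : Params d) (e γ : ℝ) (k : ℕ) (Δ : ℝ) (v : Draws q)
    (θ : Dec d) : ℕ :=
  sInf {l | P.Acceptable A e γ k Δ v θ l}

/-- The estimate `f̃(θ, N)` at the adaptive sample size. -/
def Problem.adaptiveEstimate (P : Problem d q) (A : Params d) (e γ : ℝ) (k : ℕ) (Δ : ℝ)
    (v : Draws q) (θ : Dec d) : ℝ :=
  P.estimate A.nbar v θ (P.splits A e γ k Δ v θ)

/-! ### Diagonal quadratic interpolation models -/

/-- The `2d + 1` indices: the centre, then two families of `d` indices. They label the design points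
`θ`, `θ + Δ e_j`, `θ - Δ e_j` as well as the basis functions `1`, `x_j - θ_j`, `(x_j - θ_j)² / 2`. -/
abbrev DQIndex (d : ℕ) := Unit ⊕ Fin d ⊕ Fin d

/-- The design points. -/
def design (θ : Dec d) (Δ : ℝ) : DQIndex d → Dec d
  | .inl _ => θ
  | .inr (.inl j) => θ + Δ • EuclideanSpace.single j 1
  | .inr (.inr j) => θ - Δ • EuclideanSpace.single j 1

/-- The basis functions. -/
def dqBasis (θ : Dec d) : DQIndex d → Dec d → ℝ
  | .inl _ => fun _ => 1
  | .inr (.inl j) => fun x => x j - θ j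
  | .inr (.inr j) => fun x => (x j - θ j) ^ 2 / 2

/-- The interpolation matrix. It is invertible for `Δ ≠ 0`. -/
def dqMatrix (θ : Dec d) (Δ : ℝ) : Matrix (DQIndex d) (DQIndex d) ℝ :=
  Matrix.of fun i r => dqBasis θ r (design θ Δ i)

/-- The coefficients `β` of the model, the solution of `dqMatrix θ Δ *ᵥ β = y`. -/
def dqCoeff (θ : Dec d) (Δ : ℝ) (y : DQIndex d → ℝ) : DQIndex d → ℝ :=
  (dqMatrix θ Δ)⁻¹.mulVec y

/-- The model `M(x) = ∑ β_r φ_r(x)` centred at `θ`. -/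
def dqModel (θ : Dec d) (β : DQIndex d → ℝ) (x : Dec d) : ℝ :=
  ∑ r, β r * dqBasis θ r x

/-- A solver of the trust-region subproblem: at iteration `k`, from the centre, the radius and the
coefficients of the model, it returns a minimizer of the model over the trust region. -/
structure Solver (d : ℕ) where
  argmin : ℕ → Dec d → ℝ → (DQIndex d → ℝ) → Dec d
  measurable : ∀ k, Measurable fun p : Dec d × ℝ × (DQIndex d → ℝ) => argmin k p.1 p.2.1 p.2.2
  mem : ∀ k θ Δ β, 0 < Δ → argmin k θ Δ β ∈ Metric.closedBall θ Δ
  isMinOn : ∀ k θ Δ β, 0 < Δ →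
    IsMinOn (dqModel θ β) (Metric.closedBall θ Δ) (argmin k θ Δ β)

/-! ### The algorithm -/

/-- The label of one uniform draw: iteration, evaluation point (`none` is the candidate), number of
splits per dimension, stratum, replication. -/
structure DrawIndex (d q : ℕ) where
  iter : ℕ
  point : Option (DQIndex d)
  splits : ℕ
  stratum : Fin q → ℕ
  rep : ℕ

/-- A problem together with a choice of all the inputs of the algorithm. -/
structure Algorithm (d q : ℕ) where
  P : Problem d q
  A : Params d
  e : ℝ
  γ : ℝ
  S : Solver d

namespace Algorithm

variable (R : Algorithm d q) (v : DrawIndex d q → Fin q → ℝ)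

/-- The coefficients of the model built at iteration `k` with centre `θ` and radius `Δ`, from the
estimates at the design points. -/
def coeffAt (k : ℕ) (θ : Dec d) (Δ : ℝ) : DQIndex d → ℝ :=
  dqCoeff θ Δ fun i =>
    R.P.adaptiveEstimate R.A R.e R.γ k Δ (fun l s m => v ⟨k, some i, l, s, m⟩) (design θ Δ i)

/-- The candidate at iteration `k`. -/
def candidateAt (k : ℕ) (θ : Dec d) (Δ : ℝ) : Dec d :=
  R.S.argmin k θ Δ (R.coeffAt v k θ Δ)

/-- The acceptance ratio at iteration `k`. -/
def ratioAt (k : ℕ) (θ : Dec d) (Δ : ℝ) : ℝ :=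
  (R.P.adaptiveEstimate R.A R.e R.γ k Δ (fun l s m => v ⟨k, some (.inl ()), l, s, m⟩) θ -
    R.P.adaptiveEstimate R.A R.e R.γ k Δ (fun l s m => v ⟨k, none, l, s, m⟩)
      (R.candidateAt v k θ Δ)) /
  (dqModel θ (R.coeffAt v k θ Δ) θ -
    dqModel θ (R.coeffAt v k θ Δ) (R.candidateAt v k θ Δ))

/-- Iteration `k` from the centre `θ` and radius `Δ` is successful. -/
def SuccessAt (k : ℕ) (θ : Dec d) (Δ : ℝ) : Prop :=
  R.A.η ≤ R.ratioAt v k θ Δ ∧ Δ ≤ R.A.ηtilde * ‖gradient (dqModel θ (R.coeffAt v k θ Δ)) θ‖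

open Classical in
/-- The pair `(θ_k, Δ_k)` of iterate and trust-region radius. -/
def state : ℕ → Dec d × ℝ
  | 0 => (R.A.θ₀, R.A.Δ₀)
  | k + 1 =>
    if R.SuccessAt v k (state k).1 (state k).2 then
      (R.candidateAt v k (state k).1 (state k).2, min (R.A.γup * (state k).2) R.A.Δmax)
    else ((state k).1, R.A.γdown * (state k).2)

/-- The iterate `θ_k`. -/
def iterate (k : ℕ) : Dec d := (R.state v k).1

/-- The trust-region radius `Δ_k`. -/
def radius (k : ℕ) : ℝ := (R.state v k).2

/-- The model `M_k`. -/
def model (k : ℕ) : Dec d → ℝ :=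
  dqModel (R.iterate v k) (R.coeffAt v k (R.iterate v k) (R.radius v k))

/-- The Hessian `B_k` of the model `M_k` (at the centre; it is constant). -/
def modelHessian (k : ℕ) : Dec d →L[ℝ] Dec d :=
  fderiv ℝ (gradient (R.model v k)) (R.iterate v k)

/-- The set of successful iterations. -/
def successful : Set ℕ := {k | R.SuccessAt v k (R.iterate v k) (R.radius v k)}

end Algorithm

end Sastro

end

/-!
The convergence splits into a probabilistic part, which shows that the estimation errors are of
smaller order than the squared trust-region radius, and a deterministic part along one sample path.

*Error of one evaluation.* Let `g(u) = F(θ, μ_θ⁻¹(u))` be the response as a function of the uniform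
vector. The variance of the stratified estimator with `l ^ q` strata is `l ^ (-q)`, up to a constant,
times the average variance of `g` within the strata (`Problem.withinVar`), which decays like
`l ^ (-α)`. If `g` is Lipschitz, then `α = 2`. Otherwise `F` grows at most like `exp (b ∑ |x_j|)`
against tails `exp (-κ y)`, and `α = 1 - 2 b / κ`
(`Problem.exists_withinVar_le_of_exponential`): continuity forces `μ_θ⁻¹` to act on each coordinate
by a monotone quantile function, the increments of `F` are bounded coordinate by coordinate by
increments of `sinh (b x_j)`, and a monotone function of one variable with a power singularity at
the endpoints has small squared oscillation within the strata
(`sum_integral_sub_refPoint_sq_le`). For polynomial growth or Gaussian tails the ratio `b / κ` is as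
small as desired, and `Problem.Regime.exists_withinVar_le` matches the exponents.

The sampling rule accepts no `l` below a deterministic threshold `l₀`, and rejects an `l ≥ l₀` only
if the sample variance exceeds `σ_min ^ 2`. Since the variance within the strata tends to zero, this
has probability at most one half at late iterations. Draws for different `l` are independent, so the
adaptive choice of `l` costs only a geometric series
(`Problem.measure_adaptiveEstimate_error_le`), and Chebyshev's inequality at `l₀` bounds the
probability of an error above `c Δ ^ 2` by a summable sequence in the iteration number, uniformly in
the point and the radius. The evaluation points are random but independent of the draws used at
them, so Fubini and Borel–Cantelli give `Algorithm.ae_eventually_abs_evalError_le`.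

*Sample path.* By the Cauchy decrease a successful iteration lowers the model, hence `f`, by a
multiple of `Δ_k ^ 2`. As `f` is bounded below and unsuccessful iterations shrink the radius
geometrically, `∑ Δ_k ^ 2` is finite. Conversely an iteration with a small radius at a point with a
large gradient is successful. So from a late iterate with `‖∇f‖ ≥ ε` the radii grow geometrically
until the gradient falls below `ε / 2`; the distance travelled meanwhile is at most a multiple of the
last radius, which is too short for a Lipschitz gradient to change by `ε / 2`
(`trustRegion_convergence`).
-/

noncomputable section

namespace Sastro

variable {d q : ℕ}

/-! ### Trust-region dynamics along one sample path -/

theorem summable_of_succ_le_mul_add {a b : ℕ → ℝ} {r : ℝ} (ha : ∀ k, 0 ≤ a k) (hb : ∀ k, 0 ≤ b k)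
    (hr : r < 1) (hab : ∀ k, a (k + 1) ≤ r * a k + b k) (hs : Summable b) : Summable a := by
  refine summable_of_sum_range_le (c := (a 0 + ∑' k, b k) / (1 - r)) ha fun n => ?_
  have h1 : ∑ i ∈ Finset.range (n + 1), a i ≤ a 0 + (r * ∑ i ∈ Finset.range n, a i + ∑' k, b k) := by
    rw [Finset.sum_range_succ', add_comm, Finset.mul_sum]
    have h2 : ∑ i ∈ Finset.range n, b i ≤ ∑' k, b k := hs.sum_le_tsum _ fun i _ => hb i
    have h3 := Finset.sum_le_sum fun i (_ : i ∈ Finset.range n) => hab i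
    rw [Finset.sum_add_distrib] at h3
    linarith
  rw [Finset.sum_range_succ] at h1
  rw [le_div_iff₀ (by linarith)]
  linarith [ha n]

/-- A quantity that decreases by at least `c * a k` at every late step of `S` and is constant
otherwise pays for the sum of `a` over `S`. -/
theorem summable_indicator_of_decrease {φ a : ℕ → ℝ} {S : Set ℕ} {c m : ℝ} (hc : 0 < c)
    (ha : ∀ k, 0 ≤ a k) (hm : ∀ k, m ≤ φ k) (hS : ∀ᶠ k in atTop, k ∈ S → φ (k + 1) ≤ φ k - c * a k)
    (hS' : ∀ k, k ∉ S → φ (k + 1) = φ k) : Summable (S.indicator a) := by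
  obtain ⟨K, hK⟩ := eventually_atTop.1 hS
  rw [← summable_nat_add_iff K]
  refine summable_of_sum_range_le (c := (φ K - m) / c)
    (fun k => Set.indicator_nonneg (fun k _ => ha k) _) fun n => ?_
  have h : ∀ n, c * ∑ i ∈ Finset.range n, S.indicator a (i + K) ≤ φ K - φ (n + K) := by
    intro n
    induction n with
    | zero => simp
    | succ n ih =>
      rw [Finset.sum_range_succ, mul_add]
      have e : n + 1 + K = n + K + 1 := by ring
      by_cases hn : n + K ∈ S
      · have := hK (n + K) (by omega) hn
        rw [Set.indicator_of_mem hn, e]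
        linarith
      · rw [Set.indicator_of_notMem hn, e, hS' _ hn]
        linarith
  rw [le_div_iff₀ hc]
  linarith [h n, hm (n + K)]

/-- Convergence of a trust-region iteration: `S` is the set of successful iterations, `c` the
candidates, `φ` the objective and `G` its gradient. The two analytic inputs are that late
successful iterations decrease the objective by a multiple of the squared radius, and that
iterations with a small radius at points with a large gradient are successful. -/
theorem trustRegion_convergence {E E' : Type*} [NormedAddCommGroup E] [NormedAddCommGroup E']
    {G : E → E'} {L : NNReal} (hG : LipschitzWith L G) {φ : E → ℝ} (hφ : BddBelow (Set.range φ))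
    {θ c : ℕ → E} {Δ : ℕ → ℝ} {S : Set ℕ} {γd γu Δmax c₁ : ℝ}
    (hγd : 0 < γd) (hγd1 : γd < 1) (hγu : 1 < γu) (hmax : 0 < Δmax)
    (hΔ : ∀ k, 0 < Δ k) (hcand : ∀ k, ‖c k - θ k‖ ≤ Δ k)
    (hθS : ∀ k ∈ S, θ (k + 1) = c k) (hθN : ∀ k, k ∉ S → θ (k + 1) = θ k)
    (hΔS : ∀ k ∈ S, Δ (k + 1) = min (γu * Δ k) Δmax) (hΔN : ∀ k, k ∉ S → Δ (k + 1) = γd * Δ k)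
    (hc₁ : 0 < c₁) (hdec : ∀ᶠ k in atTop, k ∈ S → φ (c k) ≤ φ (θ k) - c₁ * Δ k ^ 2)
    (hsucc : ∀ ε > 0, ∃ r > 0, ∀ᶠ k in atTop, ε ≤ ‖G (θ k)‖ → Δ k ≤ r → k ∈ S) :
    Tendsto (fun k => ‖G (θ k)‖) atTop (𝓝 0) ∧ Summable (S.indicator fun k => Δ k ^ 2) ∧
      Tendsto Δ atTop (𝓝 0) := by
  obtain ⟨m, hm⟩ := hφ
  have hsum : Summable (S.indicator fun k => Δ k ^ 2) := by
    refine summable_indicator_of_decrease (φ := fun k => φ (θ k)) hc₁ (fun k => sq_nonneg _)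
      (fun k => hm ⟨_, rfl⟩) ?_ fun k hk => by rw [hθN k hk]
    filter_upwards [hdec] with k hk hkS
    rw [hθS k hkS]
    exact hk hkS
  have hsumΔ : Summable fun k => Δ k ^ 2 := by
    refine summable_of_succ_le_mul_add (r := γd ^ 2)
      (b := fun k => γu ^ 2 * S.indicator (fun k => Δ k ^ 2) k) (fun k => sq_nonneg _)
      (fun k => mul_nonneg (sq_nonneg _) (Set.indicator_nonneg (fun k _ => sq_nonneg _) _))
      (by nlinarith) (fun k => ?_) (hsum.mul_left _)
    by_cases hk : k ∈ S
    · rw [Set.indicator_of_mem hk]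
      have h1 : Δ (k + 1) ≤ γu * Δ k := by rw [hΔS k hk]; exact min_le_left _ _
      have h2 : Δ (k + 1) ^ 2 ≤ (γu * Δ k) ^ 2 := pow_le_pow_left₀ (hΔ _).le h1 2
      have h3 : 0 ≤ γd ^ 2 * Δ k ^ 2 := by positivity
      nlinarith
    · rw [Set.indicator_of_notMem hk, hΔN k hk, mul_pow, mul_zero, add_zero]
  have hΔ0 : Tendsto Δ atTop (𝓝 0) := by
    have := (hsumΔ.tendsto_atTop_zero).sqrt
    simpa [Real.sqrt_sq (hΔ _).le] using this
  refine ⟨?_, hsum, hΔ0⟩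
  rw [Metric.tendsto_atTop]
  intro ε hε
  obtain ⟨r, hr, hev⟩ := hsucc (ε / 2) (by positivity)
  -- radii below `ρ` force success at large gradients, stay below `Δmax / γu`, and a geometric
  -- sum of them ending at `ρ` moves the gradient by less than `ε / 2`
  set ρ : ℝ := min r (min (Δmax / γu) (ε / 2 * (γu - 1) / (L + 1))) with hρ
  have hγ' : 0 < γu - 1 := by linarith
  have hLp : (0 : ℝ) < L + 1 := by positivity
  have hρ0 : 0 < ρ := lt_min hr (lt_min (by positivity) (by positivity))
  obtain ⟨K₁, hK₁⟩ := eventually_atTop.1 hev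
  obtain ⟨K₂, hK₂⟩ := eventually_atTop.1 (hΔ0.eventually (gt_mem_nhds hρ0))
  refine ⟨max K₁ K₂, fun k hk => ?_⟩
  rw [Real.dist_eq, sub_zero, abs_of_nonneg (norm_nonneg _)]
  by_contra! hcon
  have hk1 : K₁ ≤ k := le_trans (le_max_left _ _) hk
  have hk2 : K₂ ≤ k := le_trans (le_max_right _ _) hk
  have hgrow : ∀ j ≥ k, ε / 2 ≤ ‖G (θ j)‖ → j ∈ S ∧ Δ (j + 1) = γu * Δ j := by
    intro j hj hg
    have hlt := hK₂ j (by omega)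
    have hjS := hK₁ j (by omega) hg (hlt.le.trans (min_le_left _ _))
    refine ⟨hjS, ?_⟩
    rw [hΔS j hjS, min_eq_left]
    have : Δ j ≤ Δmax / γu := hlt.le.trans ((min_le_right _ _).trans (min_le_left _ _))
    rw [le_div_iff₀ (by linarith)] at this
    linarith
  -- while the gradient stays large the distance travelled is controlled by the next radius
  have hstep : ∀ n, (∀ i < n, ε / 2 ≤ ‖G (θ (k + i))‖) →
      ‖θ (k + n) - θ k‖ * (γu - 1) ≤ Δ (k + n) - Δ k ∧ Δ (k + n) = γu ^ n * Δ k := by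
    intro n
    induction n with
    | zero => intro _; simp
    | succ n ih =>
      intro hn
      obtain ⟨h1, h2⟩ := ih fun i hi => hn i (by omega)
      obtain ⟨hS1, hS2⟩ := hgrow (k + n) (by omega) (hn n (by omega))
      have h3 : ‖θ (k + n + 1) - θ (k + n)‖ ≤ Δ (k + n) := by
        rw [hθS _ hS1]; exact hcand _
      have h4 : ‖θ (k + n + 1) - θ k‖ ≤ ‖θ (k + n + 1) - θ (k + n)‖ + ‖θ (k + n) - θ k‖ :=
        norm_sub_le_norm_sub_add_norm_sub _ _ _
      refine ⟨?_, ?_⟩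
      · rw [← add_assoc, hS2]
        nlinarith
      · rw [← add_assoc, hS2, h2]
        ring
  -- the gradient cannot stay large, because the radii would grow
  have hex : ∃ n, ‖G (θ (k + n))‖ < ε / 2 := by
    by_contra! hall
    have h1 : Tendsto (fun n => γu ^ n * Δ k) atTop atTop :=
      (tendsto_pow_atTop_atTop_of_one_lt hγu).atTop_mul_const (hΔ k)
    obtain ⟨n, hn⟩ := (h1.eventually_ge_atTop ρ).exists
    have h2 := (hstep n fun i _ => hall i).2
    have h3 := hK₂ (k + n) (by omega)
    linarith
  classical
  set n := Nat.find hex with hn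
  have hnlt : ‖G (θ (k + n))‖ < ε / 2 := Nat.find_spec hex
  have h1 := (hstep n fun i hi => not_lt.1 (Nat.find_min hex hi)).1
  have h2 := hK₂ (k + n) (by omega)
  have h3 : ‖G (θ k)‖ ≤ ‖G (θ (k + n))‖ + L * ‖θ (k + n) - θ k‖ := by
    have := hG.norm_sub_le (θ (k + n)) (θ k)
    have := norm_sub_norm_le (G (θ k)) (G (θ (k + n)))
    rw [norm_sub_rev] at this
    linarith
  have h4 : ρ ≤ ε / 2 * (γu - 1) / (L + 1) := (min_le_right _ _).trans (min_le_right _ _)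
  rw [le_div_iff₀ hLp] at h4
  have h5 : ‖θ (k + n) - θ k‖ * (γu - 1) ≤ ρ := by linarith [hΔ k]
  have h6 : ‖θ (k + n) - θ k‖ * (γu - 1) * (L + 1) ≤ ε / 2 * (γu - 1) := by nlinarith
  have h8 : ‖θ (k + n) - θ k‖ * (L + 1) ≤ ε / 2 := by
    by_contra! hc
    nlinarith
  nlinarith [norm_nonneg (θ (k + n) - θ k)]

/-! ### Diagonal quadratic models -/

theorem dqModel_apply (θ : Dec d) (β : DQIndex d → ℝ) (x : Dec d) :
    dqModel θ β x = β (.inl ()) + ∑ j, β (.inr (.inl j)) * (x j - θ j) +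
      ∑ j, β (.inr (.inr j)) * ((x j - θ j) ^ 2 / 2) := by
  simp [dqModel, dqBasis, Fintype.sum_sum_type, add_assoc]

theorem dqModel_self (θ : Dec d) (β : DQIndex d → ℝ) : dqModel θ β θ = β (.inl ()) := by
  simp [dqModel_apply]

theorem hasGradientAt_dqModel (θ : Dec d) (β : DQIndex d → ℝ) (x : Dec d) :
    HasGradientAt (dqModel θ β)
      (WithLp.toLp 2 fun j => β (.inr (.inl j)) + β (.inr (.inr j)) * (x j - θ j)) x := by
  rw [hasGradientAt_iff_hasFDerivAt]
  have hp : ∀ j, HasFDerivAt (fun x : Dec d => x j - θ j)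
      (EuclideanSpace.proj j : Dec d →L[ℝ] ℝ) x := fun j =>
    ((EuclideanSpace.proj j : Dec d →L[ℝ] ℝ).hasFDerivAt).sub_const _
  have h1 := HasFDerivAt.fun_sum (u := Finset.univ) fun j _ =>
    (hp j).const_mul (β (.inr (.inl j)))
  have h2 := HasFDerivAt.fun_sum (u := Finset.univ) fun j _ =>
    (((hp j).pow 2).mul_const (1 / 2)).const_mul (β (.inr (.inr j)))
  have h3 := (h1.const_add (β (.inl ()))).add h2
  refine (h3.congr_of_eventuallyEq (Eventually.of_forall fun y => ?_)).congr_fderiv ?_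
  · simp [dqModel_apply, div_eq_mul_inv]
  · ext w
    simp only [InnerProductSpace.toDual_apply_apply, PiLp.inner_apply, RCLike.inner_apply, conj_trivial]
    simp only [_root_.add_apply, _root_.sum_apply, _root_.smul_apply, smul_eq_mul]
    rw [← Finset.sum_add_distrib]
    refine Finset.sum_congr rfl fun j _ => ?_
    simp
    ring

theorem gradient_dqModel (θ : Dec d) (β : DQIndex d → ℝ) (x : Dec d) :
    gradient (dqModel θ β) x =
      WithLp.toLp 2 fun j => β (.inr (.inl j)) + β (.inr (.inr j)) * (x j - θ j) :=
  (hasGradientAt_dqModel θ β x).gradient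

/-- The Hessian of a diagonal quadratic model bounds its curvature coefficients. -/
theorem abs_coeff_le_norm_hessian (θ : Dec d) (β : DQIndex d → ℝ) (j : Fin d) :
    |β (.inr (.inr j))| ≤ ‖fderiv ℝ (gradient (dqModel θ β)) θ‖ := by
  have hfun : gradient (dqModel θ β) = fun x =>
      WithLp.toLp 2 fun j => β (.inr (.inl j)) + β (.inr (.inr j)) * (x j - θ j) :=
    funext fun x => gradient_dqModel θ β x
  have hd : DifferentiableAt ℝ (gradient (dqModel θ β)) θ := by
    rw [hfun, differentiableAt_euclidean]
    intro i
    simp only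
    fun_prop
  have h1 : fderiv ℝ (gradient (dqModel θ β)) θ (EuclideanSpace.single j 1) j =
      β (.inr (.inr j)) := by
    have h2 := ((EuclideanSpace.proj j : Dec d →L[ℝ] ℝ).hasFDerivAt.comp θ hd.hasFDerivAt)
    have hp : HasFDerivAt (fun x : Dec d => β (.inr (.inl j)) + β (.inr (.inr j)) * (x j - θ j))
        (β (.inr (.inr j)) • (EuclideanSpace.proj j : Dec d →L[ℝ] ℝ)) θ :=
      (((EuclideanSpace.proj j : Dec d →L[ℝ] ℝ).hasFDerivAt.sub_const _).const_mul _).const_add _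
    have h3 : ((EuclideanSpace.proj j : Dec d →L[ℝ] ℝ) ∘ gradient (dqModel θ β)) =
        fun x : Dec d => β (.inr (.inl j)) + β (.inr (.inr j)) * (x j - θ j) := by
      rw [hfun]; rfl
    rw [h3] at h2
    have h4 := congrArg (fun T : Dec d →L[ℝ] ℝ => T (EuclideanSpace.single j 1)) (h2.unique hp)
    simpa using h4
  calc |β (.inr (.inr j))| = ‖fderiv ℝ (gradient (dqModel θ β)) θ (EuclideanSpace.single j 1) j‖ := by
        rw [h1, Real.norm_eq_abs]
    _ ≤ ‖fderiv ℝ (gradient (dqModel θ β)) θ (EuclideanSpace.single j 1)‖ :=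
        PiLp.norm_apply_le _ _
    _ ≤ _ := by
        have := (fderiv ℝ (gradient (dqModel θ β)) θ).le_opNorm (EuclideanSpace.single j 1)
        simpa using this

/-- The coefficients of the interpolation model are its central finite differences. -/
theorem dqCoeff_eq (θ : Dec d) {Δ : ℝ} (hΔ : Δ ≠ 0) (y : DQIndex d → ℝ) :
    dqCoeff θ Δ y = fun
      | .inl _ => y (.inl ())
      | .inr (.inl j) => (y (.inr (.inl j)) - y (.inr (.inr j))) / (2 * Δ)
      | .inr (.inr j) => (y (.inr (.inl j)) + y (.inr (.inr j)) - 2 * y (.inl ())) / Δ ^ 2 := by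
  set b : (DQIndex d → ℝ) → DQIndex d → ℝ := fun y => fun
      | .inl _ => y (.inl ())
      | .inr (.inl j) => (y (.inr (.inl j)) - y (.inr (.inr j))) / (2 * Δ)
      | .inr (.inr j) => (y (.inr (.inl j)) + y (.inr (.inr j)) - 2 * y (.inl ())) / Δ ^ 2 with hb
  have hM : ∀ y, (dqMatrix θ Δ).mulVec (b y) = y := by
    intro y
    ext i
    have : (dqMatrix θ Δ).mulVec (b y) i = dqModel θ (b y) (design θ Δ i) := by
      simp [dqMatrix, Matrix.mulVec, dotProduct, dqModel, mul_comm]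
    rw [this, dqModel_apply]
    match i with
    | .inl _ => simp [design, hb]
    | .inr (.inl j) =>
      simp [design, hb, ite_pow, mul_ite, ite_div]
      field_simp
      ring
    | .inr (.inr j) =>
      simp [design, hb, ite_pow, mul_ite, ite_div]
      field_simp
      ring
  have hunit : IsUnit (dqMatrix θ Δ) :=
    Matrix.mulVec_surjective_iff_isUnit.1 fun y => ⟨b y, hM y⟩
  change (dqMatrix θ Δ)⁻¹.mulVec y = b y
  conv_lhs => rw [← hM y]
  rw [Matrix.mulVec_mulVec, Matrix.nonsing_inv_mul _ ((Matrix.isUnit_iff_isUnit_det _).1 hunit),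
    Matrix.one_mulVec]

theorem norm_le_sum_abs (x : Dec d) : ‖x‖ ≤ ∑ j, |x j| := by
  rw [EuclideanSpace.norm_eq]
  refine Real.sqrt_le_iff.2 ⟨Finset.sum_nonneg fun _ _ => abs_nonneg _, ?_⟩
  simpa using Finset.sum_sq_le_sq_sum_of_nonneg (s := Finset.univ) (f := fun j => |x j|)
    fun j _ => abs_nonneg _

/-- The first-order Taylor remainder of a function with a Lipschitz gradient. -/
theorem abs_taylor_remainder_le {f : Dec d → ℝ} {L : NNReal} (hf : Differentiable ℝ f)
    (hL : LipschitzWith L (gradient f)) (θ p : Dec d) :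
    |f (θ + p) - f θ - inner ℝ (gradient f θ) p| ≤ L * ‖p‖ ^ 2 := by
  have h := (convex_closedBall θ ‖p‖).norm_image_sub_le_of_norm_hasFDerivWithin_le'
    (f := f) (f' := fun x => InnerProductSpace.toDual ℝ (Dec d) (gradient f x))
    (φ := InnerProductSpace.toDual ℝ (Dec d) (gradient f θ)) (C := L * ‖p‖)
    (fun x _ => ((hf x).hasGradientAt.hasFDerivAt).hasFDerivWithinAt)
    (fun x hx => ?_) (x := θ) (y := θ + p) (by simp) (by simp)
  · simpa [sq, mul_assoc] using h
  · rw [← map_sub, LinearIsometryEquiv.norm_map]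
    refine (hL.norm_sub_le x θ).trans ?_
    gcongr
    simpa [dist_eq_norm] using hx

/-- If the interpolated values are within `c * Δ ^ 2` of `f`, then the gradient of the model is
within a multiple of `Δ` of the gradient of `f`. -/
theorem norm_modelGradient_sub_le {f : Dec d → ℝ} {L : NNReal} (hf : Differentiable ℝ f)
    (hL : LipschitzWith L (gradient f)) (θ : Dec d) {Δ c : ℝ} (hΔ : 0 < Δ) {y : DQIndex d → ℝ}
    (hy : ∀ i, |y i - f (design θ Δ i)| ≤ c * Δ ^ 2) :
    ‖gradient (dqModel θ (dqCoeff θ Δ y)) θ - gradient f θ‖ ≤ d * (L + c) * Δ := by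
  refine (norm_le_sum_abs _).trans ?_
  have : ∀ j ∈ Finset.univ, |(gradient (dqModel θ (dqCoeff θ Δ y)) θ - gradient f θ) j| ≤
      (L + c) * Δ := by
    intro j _
    rw [gradient_dqModel, dqCoeff_eq θ hΔ.ne']
    have h1 := hy (.inr (.inl j))
    have h2 := hy (.inr (.inr j))
    simp only [design] at h1 h2
    have t1 := abs_taylor_remainder_le hf hL θ (Δ • EuclideanSpace.single j 1)
    have t2 := abs_taylor_remainder_le hf hL θ (-(Δ • EuclideanSpace.single j 1))
    rw [← sub_eq_add_neg] at t2
    simp only [norm_neg, norm_smul, Real.norm_eq_abs, abs_of_pos hΔ, PiLp.norm_single,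
      inner_neg_right, inner_smul_right, EuclideanSpace.inner_single_right, conj_trivial,
      norm_one, mul_one, one_mul] at t1 t2
    simp only [PiLp.sub_apply, sub_self, mul_zero, add_zero]
    have e : (y (.inr (.inl j)) - y (.inr (.inr j))) / (2 * Δ) - gradient f θ j =
        ((y (.inr (.inl j)) - y (.inr (.inr j))) - 2 * (Δ * gradient f θ j)) / (2 * Δ) := by
      field_simp
    rw [e, abs_div, abs_of_pos (by positivity : 0 < 2 * Δ), div_le_iff₀ (by positivity)]
    rw [abs_le] at *
    constructor <;> nlinarith [h1.1, h1.2, h2.1, h2.2, t1.1, t1.2, t2.1, t2.2]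
  refine (Finset.sum_le_sum this).trans ?_
  simp [mul_assoc]

/-- The Cauchy decrease: minimizing the model over the trust region is at least as good as
minimizing it along the steepest descent direction. -/
theorem cauchy_decrease {θ : Dec d} {β : DQIndex d → ℝ} {Δ κ : ℝ} (hΔ : 0 < Δ) (hκ : 0 < κ)
    (hβ : ∀ j, |β (.inr (.inr j))| ≤ κ) {x : Dec d}
    (hx : IsMinOn (dqModel θ β) (Metric.closedBall θ Δ) x) :
    ‖gradient (dqModel θ β) θ‖ / 2 * min (‖gradient (dqModel θ β) θ‖ / κ) Δ ≤
      dqModel θ β θ - dqModel θ β x := by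
  set g := gradient (dqModel θ β) θ with hg
  have hgj : ∀ j, g j = β (.inr (.inl j)) := by intro j; simp [hg, gradient_dqModel]
  have hmin : ∀ z ∈ Metric.closedBall θ Δ, dqModel θ β x ≤ dqModel θ β z := hx
  rcases eq_or_ne g 0 with h0 | h0
  · rw [h0]
    simpa using hmin θ (Metric.mem_closedBall_self hΔ.le)
  have hgn : 0 < ‖g‖ := norm_pos_iff.2 h0
  set t := min (‖g‖ / κ) Δ with ht
  have ht0 : 0 < t := lt_min (by positivity) hΔ
  have hsq : ‖g‖ ^ 2 = ∑ j, g j ^ 2 := by simp [EuclideanSpace.norm_sq_eq]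
  have h1 := hmin (θ - (t / ‖g‖) • g) (by
    rw [Metric.mem_closedBall, dist_eq_norm, sub_sub_cancel_left, norm_neg, norm_smul,
      Real.norm_of_nonneg (by positivity), div_mul_cancel₀ _ hgn.ne']
    exact min_le_right _ _)
  have h2 : dqModel θ β (θ - (t / ‖g‖) • g) ≤ dqModel θ β θ - t * ‖g‖ + κ * t ^ 2 / 2 := by
    rw [dqModel_self, dqModel_apply]
    have e1 : ∑ j, β (.inr (.inl j)) * ((θ - (t / ‖g‖) • g) j - θ j) = - (t * ‖g‖) := by
      have : ∀ j, β (.inr (.inl j)) * ((θ - (t / ‖g‖) • g) j - θ j) =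
          -(t / ‖g‖) * g j ^ 2 := by
        intro j
        rw [← hgj]
        simp
        ring
      rw [Finset.sum_congr rfl fun j _ => this j, ← Finset.mul_sum, ← hsq]
      field_simp
    have e2 : ∑ j, β (.inr (.inr j)) * (((θ - (t / ‖g‖) • g) j - θ j) ^ 2 / 2) ≤
        κ * t ^ 2 / 2 := by
      have : ∀ j ∈ Finset.univ, β (.inr (.inr j)) * (((θ - (t / ‖g‖) • g) j - θ j) ^ 2 / 2) ≤
          κ * (t / ‖g‖) ^ 2 / 2 * g j ^ 2 := by
        intro j _
        have h3 := (le_abs_self _).trans (hβ j)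
        have h4 : ((θ - (t / ‖g‖) • g) j - θ j) = -((t / ‖g‖) * g j) := by simp
        rw [h4]
        have := mul_le_mul_of_nonneg_right h3 (by positivity : 0 ≤ (-((t / ‖g‖) * g j)) ^ 2 / 2)
        refine this.trans (le_of_eq ?_)
        ring
      refine (Finset.sum_le_sum this).trans (le_of_eq ?_)
      rw [← Finset.mul_sum, ← hsq]
      field_simp
    linarith
  have h3 : κ * t ≤ ‖g‖ := by
    have : t ≤ ‖g‖ / κ := min_le_left _ _
    rw [le_div_iff₀ hκ] at this
    linarith
  nlinarith

/-- On the trust region the model is within a multiple of `Δ ^ 2` of `f`. -/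
theorem abs_model_sub_le {f : Dec d → ℝ} {L : NNReal} (hf : Differentiable ℝ f)
    (hL : LipschitzWith L (gradient f)) (θ : Dec d) {Δ c κ : ℝ} (hΔ : 0 < Δ) {y : DQIndex d → ℝ}
    (hy : ∀ i, |y i - f (design θ Δ i)| ≤ c * Δ ^ 2)
    (hβ : ∀ j, |dqCoeff θ Δ y (.inr (.inr j))| ≤ κ) (hκ : 0 ≤ κ) {x : Dec d}
    (hx : x ∈ Metric.closedBall θ Δ) :
    |dqModel θ (dqCoeff θ Δ y) x - f x| ≤ (c + d * (L + c) + κ / 2 + L) * Δ ^ 2 := by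
  set β := dqCoeff θ Δ y with hβdef
  set g := gradient (dqModel θ β) θ with hg
  have hgj : ∀ j, g j = β (.inr (.inl j)) := by intro j; simp [hg, gradient_dqModel]
  have hpn : ‖x - θ‖ ≤ Δ := by simpa [dist_eq_norm] using hx
  have h1 : dqModel θ β x = β (.inl ()) + inner ℝ g (x - θ) +
      ∑ j, β (.inr (.inr j)) * ((x j - θ j) ^ 2 / 2) := by
    rw [dqModel_apply]
    simp [PiLp.inner_apply, hgj, mul_comm]
  have h2 : |∑ j, β (.inr (.inr j)) * ((x j - θ j) ^ 2 / 2)| ≤ κ / 2 * Δ ^ 2 := by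
    refine (Finset.abs_sum_le_sum_abs _ _).trans ?_
    have : ∀ j ∈ Finset.univ, |β (.inr (.inr j)) * ((x j - θ j) ^ 2 / 2)| ≤
        κ / 2 * (x j - θ j) ^ 2 := by
      intro j _
      rw [abs_mul, abs_of_nonneg (by positivity : 0 ≤ (x j - θ j) ^ 2 / 2)]
      have := mul_le_mul_of_nonneg_right (hβ j) (by positivity : 0 ≤ (x j - θ j) ^ 2 / 2)
      linarith
    refine (Finset.sum_le_sum this).trans ?_
    rw [← Finset.mul_sum]
    have hsq : ∑ j, (x j - θ j) ^ 2 = ‖x - θ‖ ^ 2 := by simp [EuclideanSpace.norm_sq_eq]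
    rw [hsq]
    gcongr
  have h3 : |inner ℝ g (x - θ) - inner ℝ (gradient f θ) (x - θ)| ≤ d * (L + c) * Δ ^ 2 := by
    rw [← inner_sub_left]
    refine (abs_real_inner_le_norm _ _).trans ?_
    have := norm_modelGradient_sub_le hf hL θ hΔ hy
    calc _ ≤ d * (L + c) * Δ * Δ := by
          refine mul_le_mul this hpn (norm_nonneg _) ((norm_nonneg _).trans this)
      _ = _ := by ring
  have h4 := abs_taylor_remainder_le hf hL θ (x - θ)
  rw [add_sub_cancel] at h4
  have h5 : (L : ℝ) * ‖x - θ‖ ^ 2 ≤ L * Δ ^ 2 := by gcongr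
  have h6 := hy (.inl ())
  have h7 : β (.inl ()) = y (.inl ()) := by rw [hβdef, dqCoeff_eq θ hΔ.ne']
  simp only [design] at h6
  rw [h1, h7]
  rw [abs_le] at *
  constructor <;> nlinarith [h2.1, h2.2, h3.1, h3.2, h4.1, h4.2, h6.1, h6.2]

/-! ### Stratification of the unit cube -/

/-- The uniform distribution on `(0,1]`. -/
abbrev unifInterval : Measure ℝ := volume.restrict (Set.Ioc 0 1)

/-- The point of the stratum `s` with relative position `v` in the cube `(0,1]^q`. -/
def stratumPoint (l : ℕ) (s : Fin q → Fin l) (v : Fin q → ℝ) : Fin q → ℝ :=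
  fun j => ((s j : ℝ) + v j) / l

theorem measurable_stratumPoint (l : ℕ) (s : Fin q → Fin l) : Measurable (stratumPoint l s) := by
  unfold stratumPoint; fun_prop

theorem unifCube_eq_pi :
    unifCube q = Measure.pi fun _ => unifInterval := by
  rw [unifCube, volume_pi, Measure.restrict_pi_pi]

instance : IsProbabilityMeasure unifInterval :=
  ⟨by simp [unifInterval]⟩

instance : IsProbabilityMeasure (unifCube q) := by
  rw [unifCube_eq_pi]; infer_instance

/-- Cutting `(0,1]` into `l` intervals of equal length and rescaling each of them to `(0,1]`
multiplies the total measure of a set by `l`. -/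
theorem sum_volume_stratum {l : ℕ} (hl : 0 < l) {A : Set ℝ} (hA : MeasurableSet A) :
    ∑ r : Fin l, unifInterval ((fun v => ((r : ℝ) + v) / l) ⁻¹' A) =
      l * unifInterval A := by
  have hl' : (0 : ℝ) < l := by exact_mod_cast hl
  have h1 : ∀ r : ℕ, unifInterval
      ((fun v => ((r : ℝ) + v) / l) ⁻¹' A) =
      l * volume (A ∩ Set.Ioc ((r : ℝ) / l) ((r + 1 : ℝ) / l)) := by
    intro r
    have hm : Measurable fun v : ℝ => ((r : ℝ) + v) / l := by fun_prop
    rw [Measure.restrict_apply (hm hA)]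
    have e : (fun v => ((r : ℝ) + v) / l) ⁻¹' A ∩ Set.Ioc 0 1 =
        (fun v => (r : ℝ) + v) ⁻¹' ((fun x => x * (l : ℝ)⁻¹) ⁻¹'
          (A ∩ Set.Ioc ((r : ℝ) / l) ((r + 1 : ℝ) / l))) := by
      ext v
      simp only [Set.mem_inter_iff, Set.mem_preimage, Set.mem_Ioc, ← div_eq_mul_inv]
      rw [div_lt_div_iff_of_pos_right hl', div_le_div_iff_of_pos_right hl']
      simp
    rw [e, measure_preimage_add, Real.volume_preimage_mul_right (inv_ne_zero hl'.ne')]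
    simp [abs_of_pos hl']
  have h2 : ∀ m : ℕ, ∑ r ∈ Finset.range m, volume (A ∩ Set.Ioc ((r : ℝ) / l) ((r + 1 : ℝ) / l)) =
      volume (A ∩ Set.Ioc 0 ((m : ℝ) / l)) := by
    intro m
    induction m with
    | zero => simp
    | succ m ih =>
      rw [Finset.sum_range_succ, ih, ← measure_union]
      · rw [← Set.inter_union_distrib_left, Set.Ioc_union_Ioc_eq_Ioc (by positivity)
          (by gcongr; linarith)]
        push_cast
        rfl
      · refine Set.disjoint_left.2 fun x hx hx' => ?_
        exact absurd hx.2.2 (not_le.2 hx'.2.1)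
      · exact hA.inter measurableSet_Ioc
  rw [Finset.sum_congr rfl fun (r : Fin l) _ => h1 (r : ℕ), ← Finset.mul_sum,
    Fin.sum_univ_eq_sum_range fun r : ℕ => volume (A ∩ Set.Ioc ((r : ℝ) / l) ((r + 1 : ℝ) / l)), h2,
    div_self hl'.ne', Measure.restrict_apply hA]

/-- The uniform law on the cube is the equal mixture of the uniform laws on the strata. -/
theorem unifCube_eq_mixture {l : ℕ} (hl : 0 < l) :
    unifCube q = ((l : ENNReal) ^ q)⁻¹ •
      ∑ s : Fin q → Fin l, (unifCube q).map (stratumPoint l s) := by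
  conv_lhs => rw [unifCube_eq_pi]
  refine Measure.pi_eq fun B hB => ?_
  rw [Measure.smul_apply, Measure.finsetSum_apply]
  have h1 : ∀ s : Fin q → Fin l, (unifCube q).map (stratumPoint l s) (Set.univ.pi B) =
      ∏ j, unifInterval
        ((fun v => ((s j : ℝ) + v) / l) ⁻¹' B j) := by
    intro s
    rw [Measure.map_apply (measurable_stratumPoint l s)
      (MeasurableSet.univ_pi hB), unifCube_eq_pi, ← Measure.pi_pi]
    rfl
  rw [Finset.sum_congr rfl fun s _ => h1 s]
  have h2 := (Finset.prod_univ_sum (fun _ : Fin q => (Finset.univ : Finset (Fin l)))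
    fun j r => unifInterval ((fun v => ((r : ℝ) + v) / l) ⁻¹' B j))
  rw [Fintype.piFinset_univ] at h2
  rw [← h2, Finset.prod_congr rfl fun j _ => sum_volume_stratum hl (hB j), Finset.prod_mul_distrib]
  simp only [Finset.prod_const, Finset.card_univ, Fintype.card_fin, smul_eq_mul]
  rw [← mul_assoc, ENNReal.inv_mul_cancel, one_mul]
  · simp [hl.ne']
  · simp

theorem map_stratumPoint_le {l : ℕ} (hl : 0 < l) (s : Fin q → Fin l) :
    (unifCube q).map (stratumPoint l s) ≤ ((l : ENNReal) ^ q) • unifCube q := by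
  conv_rhs => rw [unifCube_eq_mixture hl, smul_smul, ENNReal.mul_inv_cancel (by simp [hl.ne'])
    (by simp), one_smul]
  rw [Measure.le_iff]
  intro A hA
  rw [Measure.finsetSum_apply]
  exact Finset.single_le_sum (f := fun s => (unifCube q).map (stratumPoint l s) A)
    (fun _ _ => zero_le) (Finset.mem_univ s)

theorem memLp_comp_stratumPoint {l : ℕ} (hl : 0 < l) (s : Fin q → Fin l) {g : (Fin q → ℝ) → ℝ}
    {p : ENNReal} (hg : MemLp g p (unifCube q)) : MemLp (g ∘ stratumPoint l s) p (unifCube q) :=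
  (hg.of_measure_le_smul (by simp) (map_stratumPoint_le hl s)).comp_of_map
    (measurable_stratumPoint l s).aemeasurable

theorem integral_unifCube_eq {l : ℕ} (hl : 0 < l) {g : (Fin q → ℝ) → ℝ}
    (hg : Integrable g (unifCube q)) :
    ∫ u, g u ∂unifCube q =
      (∑ s : Fin q → Fin l, ∫ v, g (stratumPoint l s v) ∂unifCube q) / (l : ℝ) ^ q := by
  have hgs : ∀ s : Fin q → Fin l, Integrable g ((unifCube q).map (stratumPoint l s)) := fun s =>
    memLp_one_iff_integrable.1
      ((memLp_one_iff_integrable.2 hg).of_measure_le_smul (by simp) (map_stratumPoint_le hl s))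
  conv_lhs => rw [unifCube_eq_mixture hl, integral_smul_measure, integral_finsetSum_measure
    fun s _ => hgs s]
  rw [Finset.sum_congr rfl fun s _ =>
    integral_map (measurable_stratumPoint l s).aemeasurable (hgs s).1]
  simp [div_eq_inv_mul]

theorem ae_mem_Ioo : ∀ᵐ t ∂unifInterval, t ∈ Set.Ioo (0 : ℝ) 1 := by
  rw [unifInterval, ← restrict_Ioo_eq_restrict_Ioc]
  exact ae_restrict_mem measurableSet_Ioo

theorem ae_mem_openCube : ∀ᵐ v ∂unifCube q, v ∈ openCube q := by
  rw [unifCube_eq_pi]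
  have : ∀ᵐ v ∂(Measure.pi fun _ : Fin q => unifInterval),
      ∀ j, v j ∈ Set.Ioo (0 : ℝ) 1 := by
    rw [ae_all_iff]
    intro j
    exact (Measure.quasiMeasurePreserving_eval
      (fun _ : Fin q => unifInterval) j).ae ae_mem_Ioo
  filter_upwards [this] with v hv
  exact fun j _ => hv j

theorem stratumPoint_mem_openCube {l : ℕ} (s : Fin q → Fin l) {v : Fin q → ℝ}
    (hv : v ∈ openCube q) : stratumPoint l s v ∈ openCube q := by
  intro j _
  have h := hv j (Set.mem_univ j)
  have hl : 0 < l := (s j).pos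
  have hl' : (0 : ℝ) < l := by exact_mod_cast hl
  have h2 : ((s j : ℕ) : ℝ) + 1 ≤ l := by exact_mod_cast (s j).isLt
  simp only [Set.mem_Ioo] at h
  refine ⟨div_pos (by linarith [h.1, (Nat.cast_nonneg (s j : ℕ) : (0 : ℝ) ≤ _)]) hl', ?_⟩
  change _ / _ < _
  rw [div_lt_one hl']
  linarith [h.2]

/-- The response `u ↦ F(θ, μ_θ⁻¹(u))` as a function of the uniform vector. -/
def Problem.response (P : Problem d q) (θ : Dec d) (u : Fin q → ℝ) : ℝ := P.F θ (P.muInv θ u)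

/-- The average over the strata of the variance of the response within a stratum. -/
def Problem.withinVar (P : Problem d q) (θ : Dec d) (l : ℕ) : ℝ :=
  (∑ s : Fin q → Fin l, variance (P.response θ ∘ stratumPoint l s) (unifCube q)) / (l : ℝ) ^ q

theorem Problem.withinVar_nonneg (P : Problem d q) (θ : Dec d) (l : ℕ) : 0 ≤ P.withinVar θ l :=
  div_nonneg (Finset.sum_nonneg fun _ _ => variance_nonneg _ _) (by positivity)

theorem Problem.measurable_response {P : Problem d q} (hF : P.RegularNoise)
    (hmap : P.SamplingMap) :
    Measurable fun p : Dec d × (Fin q → ℝ) => P.response p.1 p.2 :=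
  hF.measurable.comp (measurable_fst.prodMk hmap.measurable_muInv)

theorem Problem.map_muInv_unifCube {P : Problem d q} (hmap : P.SamplingMap) (θ : Dec d) :
    (unifCube q).map (P.muInv θ) = P.law θ := by
  have hmu : AEMeasurable (P.mu θ) (P.law θ) := by
    refine AEMeasurable.of_map_ne_zero ?_
    rw [hmap.map_law]
    exact IsProbabilityMeasure.ne_zero _
  have hinv : Measurable (P.muInv θ) := hmap.measurable_muInv.comp measurable_prodMk_left
  rw [← hmap.map_law θ, AEMeasurable.map_map_of_aemeasurable hinv.aemeasurable hmu]
  have : P.muInv θ ∘ P.mu θ =ᵐ[P.law θ] id := by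
    have hs : ∀ᵐ x ∂P.law θ, x ∈ P.supp θ := hmap.law_compl_supp θ
    filter_upwards [hs] with x hx
    exact (hmap.invOn θ).1 hx
  rw [Measure.map_congr this, Measure.map_id]

theorem Problem.memLp_response {P : Problem d q} (hF : P.RegularNoise) (hmap : P.SamplingMap)
    (θ : Dec d) : MemLp (P.response θ) 2 (unifCube q) := by
  have hinv : Measurable (P.muInv θ) := hmap.measurable_muInv.comp measurable_prodMk_left
  have h := hF.memLp θ
  rw [← Problem.map_muInv_unifCube hmap θ] at h
  exact h.comp_of_map hinv.aemeasurable

theorem Problem.f_eq_integral_response {P : Problem d q} (hF : P.RegularNoise)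
    (hmap : P.SamplingMap) (θ : Dec d) : P.f θ = ∫ u, P.response θ u ∂unifCube q := by
  have hinv : Measurable (P.muInv θ) := hmap.measurable_muInv.comp measurable_prodMk_left
  have h := hF.memLp θ
  rw [Problem.f]
  rw [← Problem.map_muInv_unifCube hmap θ] at h ⊢
  exact integral_map hinv.aemeasurable h.1

/-! ### Measurability of the estimators -/

section Measurability

variable {Ω : Type*} [MeasurableSpace Ω] {P : Problem d q} {W : Ω → Draws q} {τ : Ω → Dec d}

theorem Problem.obs_eq_response (P : Problem d q) (v : Draws q) (θ : Dec d) (l : ℕ)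
    (s : Fin q → Fin l) (m : ℕ) :
    P.obs v θ l s m = P.response θ (stratumPoint l s (v l (fun i => (s i : ℕ)) m)) := rfl

theorem Problem.measurable_obs (hF : P.RegularNoise) (hmap : P.SamplingMap) (hτ : Measurable τ)
    {l : ℕ} (hW : ∀ s m, Measurable fun ω => W ω l s m) (s : Fin q → Fin l) (m : ℕ) :
    Measurable fun ω => P.obs (W ω) (τ ω) l s m := by
  simp only [Problem.obs_eq_response]
  exact (Problem.measurable_response hF hmap).comp
    (hτ.prodMk ((measurable_stratumPoint l s).comp (hW _ _)))

theorem Problem.measurable_stratumMean (hF : P.RegularNoise) (hmap : P.SamplingMap)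
    (hτ : Measurable τ) (nbar : ℕ) {l : ℕ} (hW : ∀ s m, Measurable fun ω => W ω l s m)
    (s : Fin q → Fin l) : Measurable fun ω => P.stratumMean nbar (W ω) (τ ω) l s :=
  (Finset.measurable_fun_sum _ fun m _ => Problem.measurable_obs hF hmap hτ hW s m).div_const _

theorem Problem.measurable_estimate (hF : P.RegularNoise) (hmap : P.SamplingMap)
    (hτ : Measurable τ) (nbar : ℕ) {l : ℕ} (hW : ∀ s m, Measurable fun ω => W ω l s m) :
    Measurable fun ω => P.estimate nbar (W ω) (τ ω) l :=
  (Finset.measurable_fun_sum _ fun s _ =>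
    Problem.measurable_stratumMean hF hmap hτ nbar hW s).div_const _

/-- The average over the strata of the sample variances. -/
def Problem.meanStratumVar (P : Problem d q) (nbar : ℕ) (v : Draws q) (θ : Dec d) (l : ℕ) : ℝ :=
  (∑ s : Fin q → Fin l, P.stratumVar nbar v θ l s) / (l : ℝ) ^ q

theorem Problem.measurable_meanStratumVar (hF : P.RegularNoise) (hmap : P.SamplingMap)
    (hτ : Measurable τ) (nbar : ℕ) {l : ℕ} (hW : ∀ s m, Measurable fun ω => W ω l s m) :
    Measurable fun ω => P.meanStratumVar nbar (W ω) (τ ω) l :=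
  (Finset.measurable_fun_sum _ fun s _ => (Finset.measurable_fun_sum _ fun m _ =>
    ((Problem.measurable_obs hF hmap hτ hW s m).sub
      (Problem.measurable_stratumMean hF hmap hτ nbar hW s)).pow_const 2).div_const _).div_const _

theorem Problem.varEstimate_eq (P : Problem d q) (nbar : ℕ) (σmin : ℝ) (v : Draws q) (θ : Dec d)
    (l : ℕ) : P.varEstimate nbar σmin v θ l =
      max (σmin ^ 2) (P.meanStratumVar nbar v θ l) / ((nbar : ℝ) * (l : ℝ) ^ q) := rfl

end Measurability

/-! ### Moments of the stratified estimator -/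

/-- Independent uniform points of the unit cube. -/
structure IsUniformSample {Ω ι : Type*} [MeasurableSpace Ω] (W : ι → Ω → Fin q → ℝ)
    (Pr : Measure Ω) : Prop where
  measurable : ∀ i, Measurable (W i)
  map_eq : ∀ i, Pr.map (W i) = unifCube q
  indep : iIndepFun W Pr

/-- The label, within one evaluation, of a uniform draw: number of splits per dimension, stratum,
replication. -/
abbrev EvalIndex (q : ℕ) := ℕ × (Fin q → ℕ) × ℕ

/-- The draws of one evaluation, read off a family of random points. -/
def toDraws {Ω : Type*} (W : EvalIndex q → Ω → Fin q → ℝ) (ω : Ω) : Draws q :=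
  fun l s m => W (l, s, m) ω

section Moments

variable {Ω : Type*} [MeasurableSpace Ω] {Pr : Measure Ω}
  {P : Problem d q} {W : EvalIndex q → Ω → Fin q → ℝ}

theorem Problem.memLp_obs (hF : P.RegularNoise) (hmap : P.SamplingMap)
    (hW : IsUniformSample W Pr) (θ : Dec d) {l : ℕ} (hl : 0 < l) (s : Fin q → Fin l) (m : ℕ) :
    MemLp (fun ω => P.obs (toDraws W ω) θ l s m) 2 Pr := by
  have h := memLp_comp_stratumPoint hl s (Problem.memLp_response hF hmap θ)
  rw [← hW.map_eq (l, fun i => (s i : ℕ), m)] at h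
  exact h.comp_of_map (hW.measurable _).aemeasurable

theorem Problem.integral_obs (hF : P.RegularNoise) (hmap : P.SamplingMap)
    (hW : IsUniformSample W Pr) (θ : Dec d) {l : ℕ} (hl : 0 < l) (s : Fin q → Fin l) (m : ℕ) :
    ∫ ω, P.obs (toDraws W ω) θ l s m ∂Pr = ∫ v, P.response θ (stratumPoint l s v) ∂unifCube q := by
  have h := memLp_comp_stratumPoint hl s (Problem.memLp_response hF hmap θ)
  rw [← hW.map_eq (l, fun i => (s i : ℕ), m)] at h ⊢
  exact (integral_map (hW.measurable _).aemeasurable h.1).symm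

theorem Problem.variance_obs (hF : P.RegularNoise) (hmap : P.SamplingMap)
    (hW : IsUniformSample W Pr) (θ : Dec d) {l : ℕ} (hl : 0 < l) (s : Fin q → Fin l) (m : ℕ) :
    variance (fun ω => P.obs (toDraws W ω) θ l s m) Pr =
      variance (P.response θ ∘ stratumPoint l s) (unifCube q) := by
  have h := memLp_comp_stratumPoint hl s (Problem.memLp_response hF hmap θ)
  rw [← hW.map_eq (l, fun i => (s i : ℕ), m)] at h ⊢
  exact (variance_map h.1.aemeasurable (hW.measurable _).aemeasurable).symm

theorem Problem.estimate_eq_sum (P : Problem d q) (nbar : ℕ) (v : Draws q) (θ : Dec d) (l : ℕ) :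
    P.estimate nbar v θ l = ((nbar : ℝ) * (l : ℝ) ^ q)⁻¹ *
      ∑ p ∈ (Finset.univ : Finset (Fin q → Fin l)) ×ˢ Finset.range nbar, P.obs v θ l p.1 p.2 := by
  rw [Finset.sum_product, Problem.estimate]
  simp only [Problem.stratumMean]
  rw [← Finset.sum_div]
  field_simp

theorem Problem.memLp_estimate (hF : P.RegularNoise) (hmap : P.SamplingMap)
    (hW : IsUniformSample W Pr) (θ : Dec d) (nbar : ℕ) {l : ℕ} (hl : 0 < l) :
    MemLp (fun ω => P.estimate nbar (toDraws W ω) θ l) 2 Pr := by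
  simp only [Problem.estimate_eq_sum]
  refine MemLp.const_mul ?_ _
  refine memLp_finsetSum _ fun p _ => ?_
  exact Problem.memLp_obs hF hmap hW θ hl p.1 p.2

theorem Problem.integral_estimate [IsProbabilityMeasure Pr] (hF : P.RegularNoise) (hmap : P.SamplingMap)
    (hW : IsUniformSample W Pr) (θ : Dec d) {nbar : ℕ} (hn : 0 < nbar) {l : ℕ} (hl : 0 < l) :
    ∫ ω, P.estimate nbar (toDraws W ω) θ l ∂Pr = P.f θ := by
  simp only [Problem.estimate_eq_sum]
  rw [integral_const_mul, integral_finsetSum _ fun p _ =>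
    (Problem.memLp_obs hF hmap hW θ hl p.1 p.2).integrable one_le_two, Finset.sum_product]
  simp only [Problem.integral_obs hF hmap hW θ hl]
  rw [Problem.f_eq_integral_response hF hmap θ,
    integral_unifCube_eq hl ((Problem.memLp_response hF hmap θ).integrable one_le_two)]
  have : (0 : ℝ) < nbar := by exact_mod_cast hn
  simp [← Finset.mul_sum]
  field_simp

/-- The variance of the stratified estimator comes from the variance within the strata only. -/
theorem Problem.variance_estimate [IsProbabilityMeasure Pr] (hF : P.RegularNoise) (hmap : P.SamplingMap)
    (hW : IsUniformSample W Pr) (θ : Dec d) {nbar : ℕ} (hn : 0 < nbar) {l : ℕ} (hl : 0 < l) :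
    variance (fun ω => P.estimate nbar (toDraws W ω) θ l) Pr =
      P.withinVar θ l / ((nbar : ℝ) * (l : ℝ) ^ q) := by
  simp only [Problem.estimate_eq_sum]
  rw [variance_const_mul]
  have h := IndepFun.variance_sum (μ := Pr)
    (X := fun (p : (Fin q → Fin l) × ℕ) ω => P.obs (toDraws W ω) θ l p.1 p.2)
    (s := (Finset.univ : Finset (Fin q → Fin l)) ×ˢ Finset.range nbar)
    (fun p _ => Problem.memLp_obs hF hmap hW θ hl p.1 p.2) (fun p _ p' _ hpp => ?_)
  · rw [show (fun ω => ∑ p ∈ (Finset.univ : Finset (Fin q → Fin l)) ×ˢ Finset.range nbar,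
        P.obs (toDraws W ω) θ l p.1 p.2) = ∑ p ∈ (Finset.univ : Finset (Fin q → Fin l)) ×ˢ
        Finset.range nbar, fun ω => P.obs (toDraws W ω) θ l p.1 p.2 from by ext ω; simp, h,
      Finset.sum_product]
    simp only [Problem.variance_obs hF hmap hW θ hl]
    have : (0 : ℝ) < nbar := by exact_mod_cast hn
    have : (0 : ℝ) < l := by exact_mod_cast hl
    simp [Problem.withinVar, ← Finset.mul_sum]
    field_simp
  · have hne : ((l, fun i => (p.1 i : ℕ), p.2) : EvalIndex q) ≠
        (l, fun i => (p'.1 i : ℕ), p'.2) := by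
      intro e
      simp only [Prod.mk.injEq, true_and] at e
      refine hpp (Prod.ext (funext fun i => Fin.ext (congrFun e.1 i)) e.2)
    have hm : ∀ s : Fin q → Fin l, Measurable (P.response θ ∘ stratumPoint l s) := fun s =>
      ((Problem.measurable_response hF hmap).comp measurable_prodMk_left).comp
        (measurable_stratumPoint l s)
    exact (hW.indep.indepFun hne).comp (hm p.1) (hm p'.1)

theorem Problem.measure_estimate_error_le [IsProbabilityMeasure Pr] (hF : P.RegularNoise) (hmap : P.SamplingMap)
    (hW : IsUniformSample W Pr) (θ : Dec d) {nbar : ℕ} (hn : 0 < nbar) {l : ℕ} (hl : 0 < l)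
    {ε : ℝ} (hε : 0 < ε) :
    Pr {ω | ε < |P.estimate nbar (toDraws W ω) θ l - P.f θ|} ≤
      ENNReal.ofReal (P.withinVar θ l / ((nbar : ℝ) * (l : ℝ) ^ q) / ε ^ 2) := by
  have h := meas_ge_le_variance_div_sq (Problem.memLp_estimate hF hmap hW θ nbar hl) hε
  rw [Problem.integral_estimate hF hmap hW θ hn hl,
    Problem.variance_estimate hF hmap hW θ hn hl] at h
  exact (measure_mono fun ω (hω : ε < |P.estimate nbar (toDraws W ω) θ l - P.f θ|) => hω.le).trans h

/-- The sum of the squared deviations from the mean is at most that from any other point. -/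
theorem sum_sub_mean_sq_le (n : ℕ) (x : ℕ → ℝ) (a : ℝ) :
    ∑ m ∈ Finset.range n, (x m - (∑ i ∈ Finset.range n, x i) / n) ^ 2 ≤
      ∑ m ∈ Finset.range n, (x m - a) ^ 2 := by
  rcases Nat.eq_zero_or_pos n with rfl | hn
  · simp
  have hn' : (0 : ℝ) < n := by exact_mod_cast hn
  set b := (∑ i ∈ Finset.range n, x i) / n with hb
  have hs : ∑ i ∈ Finset.range n, x i = n * b := by rw [hb]; field_simp
  have e : ∑ m ∈ Finset.range n, (x m - a) ^ 2 =
      ∑ m ∈ Finset.range n, (x m - b) ^ 2 + n * (b - a) ^ 2 := by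
    have : ∀ m, (x m - a) ^ 2 = (x m - b) ^ 2 + (2 * (b - a) * x m + (a ^ 2 - b ^ 2)) := by
      intro m; ring
    simp only [this, Finset.sum_add_distrib, ← Finset.mul_sum, hs]
    simp
    ring
  rw [e]
  have : 0 ≤ n * (b - a) ^ 2 := by positivity
  linarith

/-- A large sample variance is unlikely once the variance within the strata is small. -/
theorem Problem.measure_lt_meanStratumVar_le [IsProbabilityMeasure Pr] (hF : P.RegularNoise) (hmap : P.SamplingMap)
    (hW : IsUniformSample W Pr) (θ : Dec d) {nbar : ℕ} (hn : 2 ≤ nbar) {l : ℕ} (hl : 0 < l)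
    {a : ℝ} (ha : 0 < a) :
    Pr {ω | a < P.meanStratumVar nbar (toDraws W ω) θ l} ≤
      ENNReal.ofReal (2 * P.withinVar θ l / a) := by
  have hn2 : (2 : ℝ) ≤ nbar := by exact_mod_cast hn
  have hl' : (0 : ℝ) < l := by exact_mod_cast hl
  set c : (Fin q → Fin l) → ℝ := fun s => ∫ v, P.response θ (stratumPoint l s v) ∂unifCube q
  set Y : Ω → ℝ := fun ω => (∑ s : Fin q → Fin l, (∑ m ∈ Finset.range nbar,
    (P.obs (toDraws W ω) θ l s m - c s) ^ 2) / ((nbar : ℝ) - 1)) / (l : ℝ) ^ q with hY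
  have hint : ∀ s m, Integrable (fun ω => (P.obs (toDraws W ω) θ l s m - c s) ^ 2) Pr :=
    fun s m => ((Problem.memLp_obs hF hmap hW θ hl s m).sub (memLp_const (c s))).integrable_sq
  have hYint : Integrable Y Pr :=
    (integrable_finsetSum _ fun s _ => (integrable_finsetSum _ fun m _ =>
      hint s m).div_const _).div_const _
  have hY0 : ∀ ω, 0 ≤ Y ω := fun ω => div_nonneg (Finset.sum_nonneg fun s _ =>
    div_nonneg (Finset.sum_nonneg fun m _ => sq_nonneg _) (by linarith)) (by positivity)
  have hle : ∀ ω, P.meanStratumVar nbar (toDraws W ω) θ l ≤ Y ω := by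
    intro ω
    refine div_le_div_of_nonneg_right (Finset.sum_le_sum fun s _ => ?_) (by positivity)
    exact div_le_div_of_nonneg_right (sum_sub_mean_sq_le _ _ _) (by linarith)
  have hYE : ∫ ω, Y ω ∂Pr = nbar / ((nbar : ℝ) - 1) * P.withinVar θ l := by
    rw [hY, integral_div, integral_finsetSum _ fun s _ =>
      (integrable_finsetSum _ fun m _ => hint s m).div_const _]
    have h1 : ∀ s, ∫ ω, (∑ m ∈ Finset.range nbar, (P.obs (toDraws W ω) θ l s m - c s) ^ 2) /
        ((nbar : ℝ) - 1) ∂Pr = nbar / ((nbar : ℝ) - 1) *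
          variance (P.response θ ∘ stratumPoint l s) (unifCube q) := by
      intro s
      rw [integral_div, integral_finsetSum _ fun m _ => hint s m]
      have h2 : ∀ m, ∫ ω, (P.obs (toDraws W ω) θ l s m - c s) ^ 2 ∂Pr =
          variance (P.response θ ∘ stratumPoint l s) (unifCube q) := by
        intro m
        rw [← Problem.variance_obs hF hmap hW θ hl s m, variance_eq_integral
          (Problem.memLp_obs hF hmap hW θ hl s m).1.aemeasurable,
          Problem.integral_obs hF hmap hW θ hl]
      simp only [h2, Finset.sum_const, Finset.card_range, nsmul_eq_mul]
      ring
    simp only [h1, ← Finset.mul_sum, Problem.withinVar]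
    ring
  have hmk := mul_meas_ge_le_integral_of_nonneg (ae_of_all _ hY0) hYint a
  have hfac : nbar / ((nbar : ℝ) - 1) ≤ 2 := by
    rw [div_le_iff₀ (by linarith)]
    linarith
  refine (measure_mono (t := {ω | a ≤ Y ω}) fun ω hω => ?_).trans ?_
  · exact (show a < P.meanStratumVar nbar (toDraws W ω) θ l from hω).le.trans (hle ω)
  · rw [← ofReal_measureReal]
    refine ENNReal.ofReal_le_ofReal ?_
    rw [le_div_iff₀ ha, mul_comm]
    refine hmk.trans ?_
    rw [hYE]
    exact mul_le_mul_of_nonneg_right hfac (P.withinVar_nonneg θ l)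

end Moments

/-! ### The error at the adaptive sample size -/

/-- If each trial is rejected with conditional probability at most one half, and errs with
conditional probability at most `c`, given that the earlier ones were rejected, then the first
accepted trial errs, or does not exist, with probability at most `2 * c`. -/
theorem measure_first_accepted_le {Ω : Type*} [MeasurableSpace Ω] {Pr : Measure Ω}
    [IsProbabilityMeasure Pr] {R E : ℕ → Set Ω} {c : ENNReal}
    (hR : ∀ m, Pr ((⋂ i < m, R i) ∩ R m) ≤ Pr (⋂ i < m, R i) * 2⁻¹)
    (hE : ∀ m, Pr ((⋂ i < m, R i) ∩ E m) ≤ Pr (⋂ i < m, R i) * c) :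
    Pr ((⋂ m, R m) ∪ ⋃ m, (⋂ i < m, R i) ∩ E m) ≤ 2 * c := by
  have hA : ∀ m, Pr (⋂ i < m, R i) ≤ 2⁻¹ ^ m := by
    intro m
    induction m with
    | zero => simp
    | succ m ih =>
      have e : (⋂ i < m + 1, R i) = (⋂ i < m, R i) ∩ R m := Set.biInter_lt_succ R m
      rw [e, pow_succ]
      exact (hR m).trans (by gcongr)
  have h0 : Pr (⋂ m, R m) = 0 := by
    have hlim : Tendsto (fun m : ℕ => (2⁻¹ : ENNReal) ^ m) atTop (𝓝 0) :=
      ENNReal.tendsto_pow_atTop_nhds_zero_of_lt_one (by simp)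
    refine le_antisymm (ge_of_tendsto' hlim fun m => ?_) zero_le
    exact (measure_mono (Set.iInter_mono fun i => Set.subset_iInter fun _ => subset_rfl)).trans
      (hA m)
  refine (measure_union_le _ _).trans ?_
  rw [h0, zero_add]
  refine (measure_iUnion_le _).trans ?_
  calc ∑' m, Pr ((⋂ i < m, R i) ∩ E m) ≤ ∑' m : ℕ, 2⁻¹ ^ m * c :=
        ENNReal.tsum_le_tsum fun m => (hE m).trans (by gcongr; exact hA m)
    _ = 2 * c := by
        rw [ENNReal.tsum_mul_right, ENNReal.tsum_geometric, ENNReal.one_sub_inv_two, inv_inv]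

theorem measurableSet_rejected {Ω : Type*} [MeasurableSpace Ω] {P : Problem d q}
    (hF : P.RegularNoise) (hmap : P.SamplingMap) {W : EvalIndex q → Ω → Fin q → ℝ} {l : ℕ}
    (hW : ∀ s m, Measurable (W (l, s, m))) (nbar : ℕ) (θ : Dec d) (a : ℝ) :
    MeasurableSet {ω | a < P.meanStratumVar nbar (toDraws W ω) θ l} :=
  measurableSet_lt measurable_const
    (Problem.measurable_meanStratumVar hF hmap measurable_const nbar hW)

theorem measurableSet_estimate_error {Ω : Type*} [MeasurableSpace Ω] {P : Problem d q}
    (hF : P.RegularNoise) (hmap : P.SamplingMap) {W : EvalIndex q → Ω → Fin q → ℝ} {l : ℕ}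
    (hW : ∀ s m, Measurable (W (l, s, m))) (nbar : ℕ) (θ : Dec d) (ε : ℝ) :
    MeasurableSet {ω | ε < |P.estimate nbar (toDraws W ω) θ l - P.f θ|} :=
  measurableSet_lt measurable_const
    (((Problem.measurable_estimate hF hmap measurable_const nbar hW).sub_const _).abs)

/-- The sampling rule at a fixed point stops at or after the deterministic threshold `l₀`, and
beyond `l₀` it rejects only because of a large sample variance. As draws for different numbers of
splits are independent, the stopping costs only a factor two. -/
theorem Problem.measure_adaptiveEstimate_error_le {Ω : Type*} [MeasurableSpace Ω] {Pr : Measure Ω}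
    [IsProbabilityMeasure Pr] {P : Problem d q} (hF : P.RegularNoise) (hmap : P.SamplingMap)
    {W : EvalIndex q → Ω → Fin q → ℝ} (hW : IsUniformSample W Pr) (A : Params d) {e γ : ℝ} {k : ℕ}
    {Δ : ℝ} {θ : Dec d} {l₀ : ℕ} (hl₀ : 0 < l₀)
    (hacc : ∀ v l, P.Acceptable A e γ k Δ v θ l → l₀ ≤ l)
    (hacc' : ∀ v, ∀ l ≥ l₀, P.meanStratumVar A.nbar v θ l ≤ A.σmin ^ 2 →
      P.Acceptable A e γ k Δ v θ l)
    (hrej : ∀ l ≥ l₀, 2 * P.withinVar θ l / A.σmin ^ 2 ≤ 1 / 2) {ε c : ℝ} (hε : 0 < ε)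
    (herr : ∀ l ≥ l₀, P.withinVar θ l / ((A.nbar : ℝ) * (l : ℝ) ^ q) / ε ^ 2 ≤ c) :
    Pr {ω | ε < |P.adaptiveEstimate A e γ k Δ (toDraws W ω) θ - P.f θ|} ≤
      2 * ENNReal.ofReal c := by
  set R : ℕ → Set Ω := fun m =>
    {ω | A.σmin ^ 2 < P.meanStratumVar A.nbar (toDraws W ω) θ (l₀ + m)} with hRdef
  set E : ℕ → Set Ω := fun m =>
    {ω | ε < |P.estimate A.nbar (toDraws W ω) θ (l₀ + m) - P.f θ|} with hEdef
  have hind : ∀ (m : ℕ) (B : Set Ω), B = R m ∨ B = E m →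
      Pr ((⋂ i < m, R i) ∩ B) = Pr (⋂ i < m, R i) * Pr B := by
    intro m B hB
    let mi : EvalIndex q → MeasurableSpace Ω := fun i => MeasurableSpace.comap (W i) inferInstance
    have hi : Indep (⨆ i ∈ {i : EvalIndex q | i.1 < l₀ + m}, mi i)
        (⨆ i ∈ {i : EvalIndex q | i.1 = l₀ + m}, mi i) Pr := by
      refine indep_iSup_of_disjoint (fun i => (hW.measurable i).comap_le) hW.indep ?_
      exact Set.disjoint_left.2 fun i (h1 : i.1 < l₀ + m) (h2 : i.1 = l₀ + m) => by omega
    have hmeas : ∀ (S : Set (EvalIndex q)) (l : ℕ), (∀ s m, (l, s, m) ∈ S) → ∀ s m,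
        Measurable[⨆ i ∈ S, mi i] (W (l, s, m)) := fun S l h s m =>
      (comap_measurable (W (l, s, m))).mono
        (le_iSup₂ (f := fun (i : EvalIndex q) (_ : i ∈ S) => mi i) (l, s, m) (h s m)) le_rfl
    refine (Indep_iff _ _ _).1 hi _ _ ?_ ?_
    · refine MeasurableSet.iInter fun i => MeasurableSet.iInter fun hi => ?_
      exact @measurableSet_rejected d q Ω (⨆ i ∈ {i : EvalIndex q | i.1 < l₀ + m}, mi i) P hF hmap W _
        (hmeas _ _ fun _ _ => by simpa using hi) _ _ _
    · rcases hB with rfl | rfl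
      · exact @measurableSet_rejected d q Ω (⨆ i ∈ {i : EvalIndex q | i.1 = l₀ + m}, mi i) P hF hmap W _
          (hmeas _ _ fun _ _ => rfl) _ _ _
      · exact @measurableSet_estimate_error d q Ω (⨆ i ∈ {i : EvalIndex q | i.1 = l₀ + m}, mi i) P hF hmap W _
          (hmeas _ _ fun _ _ => rfl) _ _ _
  have hσ : 0 < A.σmin ^ 2 := pow_pos A.σmin_pos 2
  have hnbar := A.two_le_nbar
  refine (measure_mono ?_).trans (measure_first_accepted_le (R := R) (E := E)
    (fun m => ?_) fun m => ?_)
  · intro ω hω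
    by_cases hall : ∀ m, ω ∈ R m
    · exact Or.inl (Set.mem_iInter.2 hall)
    right
    push Not at hall
    obtain ⟨m, hm⟩ := hall
    have hne : {l | P.Acceptable A e γ k Δ (toDraws W ω) θ l}.Nonempty :=
      ⟨l₀ + m, hacc' _ _ (by omega) (not_lt.1 hm)⟩
    have hge : l₀ ≤ P.splits A e γ k Δ (toDraws W ω) θ := hacc _ _ (Nat.sInf_mem hne)
    obtain ⟨n, hn⟩ := Nat.exists_eq_add_of_le hge
    refine Set.mem_iUnion.2 ⟨n, Set.mem_iInter₂.2 fun i hi => ?_, ?_⟩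
    · by_contra hcon
      have h1 := Nat.sInf_le (s := {l | P.Acceptable A e γ k Δ (toDraws W ω) θ l})
        (hacc' (toDraws W ω) (l₀ + i) (by omega) (not_lt.1 hcon))
      have h2 : P.splits A e γ k Δ (toDraws W ω) θ ≤ l₀ + i := h1
      omega
    · change ε < |P.estimate A.nbar (toDraws W ω) θ (l₀ + n) - P.f θ|
      rw [← hn]
      exact hω
  · rw [hind m _ (Or.inl rfl)]
    gcongr
    refine (Problem.measure_lt_meanStratumVar_le hF hmap hW θ hnbar (by omega) hσ).trans ?_
    refine (ENNReal.ofReal_le_ofReal (hrej (l₀ + m) (by omega))).trans ?_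
    rw [one_div, ENNReal.ofReal_inv_of_pos two_pos]
    simp
  · rw [hind m _ (Or.inr rfl)]
    gcongr
    exact (Problem.measure_estimate_error_le hF hmap hW θ (by omega) (by omega) hε).trans
      (ENNReal.ofReal_le_ofReal (herr _ (by omega)))

/-- The threshold that the sampling rule imposes on `l ^ q` whatever the observations are. -/
def minStrata (A : Params d) (e γ : ℝ) (k : ℕ) (Δ : ℝ) : ℝ :=
  max ((k : ℝ) ^ e) ((k : ℝ) ^ e * A.σmin ^ 2 / (A.κas * Δ ^ γ) ^ 2) / A.nbar

theorem minStrata_le_iff {A : Params d} {e γ : ℝ} {k : ℕ} {Δ : ℝ} (hΔ : 0 < Δ) {x : ℝ}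
    (hx : 0 < x) : minStrata A e γ k Δ ≤ x ↔ (k : ℝ) ^ e ≤ A.nbar * x ∧
      √((k : ℝ) ^ e) * √(A.σmin ^ 2 / (A.nbar * x)) ≤ A.κas * Δ ^ γ := by
  have hn : (0 : ℝ) < A.nbar := by exact_mod_cast (by have := A.two_le_nbar; omega : 0 < A.nbar)
  have hr : 0 < A.κas * Δ ^ γ := mul_pos A.κas_pos (Real.rpow_pos_of_pos hΔ _)
  have hk : 0 ≤ (k : ℝ) ^ e := by positivity
  rw [minStrata, div_le_iff₀ hn, max_le_iff, mul_comm x, ← Real.sqrt_mul hk, Real.sqrt_le_left hr.le,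
    div_le_iff₀ (by positivity), mul_div_assoc', div_le_iff₀ (by positivity)]
  rw [mul_comm ((A.κas * Δ ^ γ) ^ 2)]

theorem Problem.le_of_acceptable {P : Problem d q} {A : Params d} {e γ : ℝ} {k : ℕ} {Δ : ℝ}
    (hΔ : 0 < Δ) {v : Draws q} {θ : Dec d} {l : ℕ} (h : P.Acceptable A e γ k Δ v θ l) :
    minStrata A e γ k Δ ≤ (l : ℝ) ^ q := by
  obtain ⟨h1, h2, h3⟩ := h
  have hl : (0 : ℝ) < l := by exact_mod_cast h1
  rw [minStrata_le_iff hΔ (by positivity)]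
  refine ⟨h2, le_trans ?_ h3⟩
  rw [Problem.varEstimate_eq]
  gcongr
  exact le_max_left _ _

theorem Problem.acceptable_of_le {P : Problem d q} {A : Params d} {e γ : ℝ} {k : ℕ} {Δ : ℝ}
    (hΔ : 0 < Δ) {v : Draws q} {θ : Dec d} {l : ℕ} (hl : 0 < l)
    (h : minStrata A e γ k Δ ≤ (l : ℝ) ^ q) (hv : P.meanStratumVar A.nbar v θ l ≤ A.σmin ^ 2) :
    P.Acceptable A e γ k Δ v θ l := by
  have hl' : (0 : ℝ) < l := by exact_mod_cast hl
  rw [minStrata_le_iff hΔ (by positivity)] at h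
  refine ⟨hl, h.1, ?_⟩
  rw [Problem.varEstimate_eq, max_eq_left hv]
  exact h.2

/-- A polynomial decay of the variance within the strata bounds the error of the adaptive
estimator, uniformly in the point of evaluation. -/
theorem Problem.exists_adaptiveEstimate_error_le (hq : 1 ≤ q) {P : Problem d q}
    (hF : P.RegularNoise) (hmap : P.SamplingMap) (A : Params d) {e γ α C : ℝ} (he : 0 < e)
    (hα : 0 < α) (hC : ∀ θ, ∀ l : ℕ, 0 < l → P.withinVar θ l ≤ C * (l : ℝ) ^ (-α)) :
    ∃ C' : ℝ, ∀ᶠ k : ℕ in atTop, ∀ {Ω : Type*} [MeasurableSpace Ω] {Pr : Measure Ω}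
      [IsProbabilityMeasure Pr] {W : EvalIndex q → Ω → Fin q → ℝ}, IsUniformSample W Pr →
      ∀ θ, ∀ Δ > 0, ∀ ε > 0,
      Pr {ω | ε < |P.adaptiveEstimate A e γ k Δ (toDraws W ω) θ - P.f θ|} ≤
        ENNReal.ofReal (C' * ((k : ℝ) ^ e * Δ ^ (-(2 * γ))) ^ (-((q + α) / q)) / ε ^ 2) := by
  have hn : (0 : ℝ) < A.nbar := by exact_mod_cast (by have := A.two_le_nbar; omega : 0 < A.nbar)
  have hσ := A.σmin_pos
  have hκ := A.κas_pos
  have hq0 : (0 : ℝ) < q := by exact_mod_cast hq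
  have hC0 : 0 ≤ C := by
    have := hC 0 1 one_pos
    simp only [Nat.cast_one, Real.one_rpow, mul_one] at this
    exact (P.withinVar_nonneg 0 1).trans this
  set p : ℝ := (q + α) / q with hp
  have hp0 : 0 < p := by positivity
  set b : ℝ := A.σmin ^ 2 / (A.κas ^ 2 * A.nbar) with hb
  have hb0 : 0 < b := by positivity
  have hlim : Tendsto (fun l : ℕ => C * (l : ℝ) ^ (-α)) atTop (𝓝 0) := by
    simpa using ((tendsto_rpow_neg_atTop hα).comp tendsto_natCast_atTop_atTop).const_mul C
  obtain ⟨L₀, hL₀⟩ := eventually_atTop.1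
    (hlim.eventually (ge_mem_nhds (by positivity : 0 < A.σmin ^ 2 / 4)))
  have hk1 : ∀ᶠ k : ℕ in atTop, A.nbar * ((L₀ : ℝ) ^ q) < (k : ℝ) ^ e :=
    ((tendsto_rpow_atTop he).comp tendsto_natCast_atTop_atTop).eventually_gt_atTop _
  refine ⟨2 * (C * b ^ (-p) / A.nbar), ?_⟩
  filter_upwards [hk1, eventually_ge_atTop 1] with k hk hk0 Ω _ Pr _ W hW θ Δ hΔ ε hε
  have hk0' : (0 : ℝ) < k := by exact_mod_cast hk0
  set T := minStrata A e γ k Δ with hT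
  have hTk : (k : ℝ) ^ e ≤ A.nbar * T := by
    rw [hT, minStrata, mul_div_cancel₀ _ hn.ne']
    exact le_max_left _ _
  have hTb : b * ((k : ℝ) ^ e * Δ ^ (-(2 * γ))) ≤ T := by
    rw [hT, minStrata, le_div_iff₀ hn]
    refine le_trans (le_of_eq ?_) (le_max_right _ _)
    rw [hb, Real.rpow_neg hΔ.le, mul_comm 2 γ, Real.rpow_mul hΔ.le, Real.rpow_two]
    field_simp
  have hx0 : 0 < (k : ℝ) ^ e * Δ ^ (-(2 * γ)) := by positivity
  have hT0 : 0 < T := lt_of_lt_of_le (by positivity) hTb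
  have hex : ∃ l : ℕ, 0 < l ∧ T ≤ (l : ℝ) ^ q := by
    obtain ⟨l, hl⟩ := exists_nat_ge (max T 1)
    have h1 : (1 : ℝ) ≤ l := (le_max_right _ _).trans hl
    refine ⟨l, by exact_mod_cast h1, (le_max_left _ _).trans (hl.trans ?_)⟩
    exact le_self_pow₀ h1 (by omega)
  classical
  set l₀ := Nat.find hex with hl₀
  obtain ⟨hl₀0, hl₀T⟩ := Nat.find_spec hex
  have hTl : ∀ l ≥ l₀, T ≤ (l : ℝ) ^ q := fun l hl => hl₀T.trans (by gcongr)
  have hL : L₀ ≤ l₀ := by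
    by_contra! hcon
    have h1 : (l₀ : ℝ) ^ q ≤ (L₀ : ℝ) ^ q := by gcongr
    have h2 := hTl l₀ le_rfl
    nlinarith
  refine (Problem.measure_adaptiveEstimate_error_le hF hmap hW A (e := e) (γ := γ) (k := k)
    (Δ := Δ) (θ := θ) hl₀0 (fun v l hl => Nat.find_min' hex ⟨hl.1, Problem.le_of_acceptable hΔ hl⟩)
    (fun v l hl hv => Problem.acceptable_of_le hΔ (by omega) (hTl l hl) hv) (fun l hl => ?_) hε
    (c := C * b ^ (-p) / A.nbar * ((k : ℝ) ^ e * Δ ^ (-(2 * γ))) ^ (-p) / ε ^ 2)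
    fun l hl => ?_).trans (le_of_eq ?_)
  · rw [div_le_iff₀ (by positivity)]
    have h1 := hC θ l (by omega)
    have h2 := hL₀ l (by omega)
    linarith
  · have hl0 : (0 : ℝ) < l := by exact_mod_cast (by omega : 0 < l)
    have h1 := hC θ l (by omega)
    have h3 : (l : ℝ) ^ (-α) / (l : ℝ) ^ q ≤ b ^ (-p) * ((k : ℝ) ^ e * Δ ^ (-(2 * γ))) ^ (-p) := by
      rw [← Real.mul_rpow hb0.le hx0.le]
      calc (l : ℝ) ^ (-α) / (l : ℝ) ^ q = ((l : ℝ) ^ q) ^ (-p) := by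
            rw [← Real.rpow_natCast, ← Real.rpow_sub hl0, ← Real.rpow_mul hl0.le, hp]
            congr 1
            field_simp
            ring
        _ ≤ _ := Real.rpow_le_rpow_of_nonpos (by positivity) (hTb.trans (hTl l hl)) (by linarith)
    calc P.withinVar θ l / (A.nbar * (l : ℝ) ^ q) / ε ^ 2
        ≤ C * (l : ℝ) ^ (-α) / (A.nbar * (l : ℝ) ^ q) / ε ^ 2 := by gcongr
      _ = C * ((l : ℝ) ^ (-α) / (l : ℝ) ^ q) / A.nbar / ε ^ 2 := by field_simp
      _ ≤ C * (b ^ (-p) * ((k : ℝ) ^ e * Δ ^ (-(2 * γ))) ^ (-p)) / A.nbar / ε ^ 2 := by gcongr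
      _ = _ := by ring
  · rw [← ENNReal.ofReal_ofNat 2, ← ENNReal.ofReal_mul zero_le_two]
    congr 1
    ring

/-! ### Stratification in dimension one -/

/-- The distance from `t` to the endpoints of the unit interval. -/
def edgeDist (t : ℝ) : ℝ := min t (1 - t)

theorem measurable_edgeDist : Measurable edgeDist :=
  measurable_id.min (measurable_const.sub measurable_id)

theorem edgeDist_pos {t : ℝ} (ht : t ∈ Set.Ioo (0 : ℝ) 1) : 0 < edgeDist t :=
  lt_min ht.1 (by linarith [ht.2])

theorem integrable_edgeDist_rpow {p : ℝ} (hp : p < 1) :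
    Integrable (fun t => edgeDist t ^ (-p)) unifInterval := by
  have h1 : Integrable (fun t : ℝ => t ^ (-p)) unifInterval :=
    (intervalIntegrable_iff_integrableOn_Ioc_of_le zero_le_one).1
      (intervalIntegral.intervalIntegrable_rpow' (by linarith))
  have h2 : Integrable (fun t : ℝ => (1 - t) ^ (-p)) unifInterval := by
    have := (intervalIntegral.intervalIntegrable_rpow' (a := 1) (b := 0) (r := -p)
      (by linarith)).comp_sub_left 1
    simp only [sub_self, sub_zero] at this
    exact (intervalIntegrable_iff_integrableOn_Ioc_of_le zero_le_one).1 this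
  refine (h1.add h2).mono' (measurable_edgeDist.pow_const _).aestronglyMeasurable ?_
  filter_upwards [ae_mem_Ioo] with t ht
  have hd := edgeDist_pos ht
  rw [Real.norm_of_nonneg (by positivity)]
  have h3 : 0 ≤ t ^ (-p) := Real.rpow_nonneg ht.1.le _
  have h4 : 0 ≤ (1 - t) ^ (-p) := Real.rpow_nonneg (by linarith [ht.2]) _
  simp only [Pi.add_apply]
  rcases min_choice t (1 - t) with h | h <;> rw [edgeDist, h] <;> linarith

theorem stratum_mem_Ioo {l r : ℕ} (hr : r < l) {t : ℝ} (ht : t ∈ Set.Ioo (0 : ℝ) 1) :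
    ((r : ℝ) + t) / l ∈ Set.Ioo (0 : ℝ) 1 := by
  have hl' : (0 : ℝ) < l := by exact_mod_cast (by omega : 0 < l)
  have h2 : (r : ℝ) + 1 ≤ l := by exact_mod_cast hr
  have h3 : (0 : ℝ) ≤ r := Nat.cast_nonneg r
  refine ⟨div_pos (by linarith [ht.1]) hl', ?_⟩
  rw [div_lt_one hl']
  linarith [ht.2]

theorem edgeDist_div_le {l r : ℕ} (hr : r < l) (t : ℝ) :
    edgeDist t / l ≤ edgeDist (((r : ℝ) + t) / l) := by
  have hl' : (0 : ℝ) < l := by exact_mod_cast (by omega : 0 < l)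
  have h2 : (r : ℝ) + 1 ≤ l := by exact_mod_cast hr
  have h3 : (0 : ℝ) ≤ r := Nat.cast_nonneg r
  refine le_min ?_ ?_
  · exact div_le_div_of_nonneg_right (by linarith [min_le_left t (1 - t), edgeDist.eq_1 t]) hl'.le
  · rw [div_le_iff₀ hl', sub_mul, div_mul_cancel₀ _ hl'.ne']
    linarith [min_le_right t (1 - t), edgeDist.eq_1 t]

theorem edgeDist_stratum_rpow_le {l r : ℕ} (hr : r < l) {p : ℝ} (hp0 : 0 ≤ p) {t : ℝ}
    (ht : t ∈ Set.Ioo (0 : ℝ) 1) :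
    edgeDist (((r : ℝ) + t) / l) ^ (-p) ≤ (l : ℝ) ^ p * edgeDist t ^ (-p) := by
  have hl' : (0 : ℝ) < l := by exact_mod_cast (by omega : 0 < l)
  have hd := edgeDist_pos ht
  calc edgeDist (((r : ℝ) + t) / l) ^ (-p) ≤ (edgeDist t / l) ^ (-p) :=
        Real.rpow_le_rpow_of_nonpos (by positivity) (edgeDist_div_le hr t) (by linarith)
    _ = _ := by
        rw [Real.div_rpow hd.le hl'.le, Real.rpow_neg hl'.le, div_inv_eq_mul, mul_comm]

theorem integrable_edgeDist_stratum {l r : ℕ} (hr : r < l) {p : ℝ} (hp0 : 0 ≤ p) (hp : p < 1) :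
    Integrable (fun t : ℝ => edgeDist (((r : ℝ) + t) / l) ^ (-p)) unifInterval := by
  refine ((integrable_edgeDist_rpow hp).const_mul ((l : ℝ) ^ p)).mono'
    ((measurable_edgeDist.comp (by fun_prop)).pow_const _).aestronglyMeasurable ?_
  filter_upwards [ae_mem_Ioo] with t ht
  have := edgeDist_pos (stratum_mem_Ioo hr ht)
  rw [Real.norm_of_nonneg (by positivity)]
  exact edgeDist_stratum_rpow_le hr hp0 ht

/-- The uniform law on the interval is the equal mixture of the uniform laws on the strata. -/
theorem integral_unifInterval_eq {l : ℕ} (hl : 0 < l) {g : ℝ → ℝ} (hg : Measurable g)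
    (hi : ∀ r < l, Integrable (fun t : ℝ => g (((r : ℝ) + t) / l)) unifInterval) :
    ∑ r ∈ Finset.range l, ∫ t, g (((r : ℝ) + t) / l) ∂unifInterval =
      l * ∫ t, g t ∂unifInterval := by
  have hm : ∀ r : ℕ, Measurable fun t : ℝ => ((r : ℝ) + t) / l := fun r => by fun_prop
  have hmix : ((l : ENNReal)) • unifInterval =
      ∑ r : Fin l, unifInterval.map fun t : ℝ => ((r : ℝ) + t) / l := by
    ext A hA
    rw [Measure.finsetSum_apply, Measure.smul_apply, smul_eq_mul, ← sum_volume_stratum hl hA]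
    exact Finset.sum_congr rfl fun r _ => (Measure.map_apply (hm r) hA).symm
  have h := congrArg (fun ν => ∫ t, g t ∂ν) hmix
  rw [integral_smul_measure, integral_finsetSum_measure fun (r : Fin l) _ =>
    (integrable_map_measure hg.aestronglyMeasurable (hm r).aemeasurable).2 (hi r r.isLt)] at h
  rw [← Fin.sum_univ_eq_sum_range fun r : ℕ => ∫ t, g (((r : ℝ) + t) / l) ∂unifInterval]
  simp only [ENNReal.toReal_natCast, smul_eq_mul] at h
  rw [h]
  exact Finset.sum_congr rfl fun (r : Fin l) _ =>
    (integral_map (hm r).aemeasurable hg.aestronglyMeasurable).symm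

/-- The point of the `r`-th stratum closest to the centre of the interval. -/
def refPoint (l r : ℕ) : ℝ := max ((r : ℝ) / l) (min (((r : ℝ) + 1) / l) (1 / 2))

theorem refPoint_mem_Icc (l r : ℕ) :
    refPoint l r ∈ Set.Icc ((r : ℝ) / l) (((r : ℝ) + 1) / l) := by
  refine ⟨le_max_left _ _, max_le ?_ (min_le_left _ _)⟩
  gcongr
  linarith

theorem refPoint_mem_Ioo {l r : ℕ} (hr : r < l) : refPoint l r ∈ Set.Ioo (0 : ℝ) 1 := by
  have hl' : (0 : ℝ) < l := by exact_mod_cast (by omega : 0 < l)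
  have h2 : (r : ℝ) + 1 ≤ l := by exact_mod_cast hr
  refine ⟨lt_max_of_lt_right (lt_min (by positivity) (by norm_num)), max_lt ?_ ?_⟩
  · rw [div_lt_one hl']; linarith
  · exact lt_of_le_of_lt (min_le_right _ _) (by norm_num)

theorem edgeDist_le_refPoint {l r : ℕ} (hr : r < l) {t : ℝ} (ht : t ∈ Set.Ioo (0 : ℝ) 1) :
    edgeDist (((r : ℝ) + t) / l) ≤ edgeDist (refPoint l r) := by
  have hl' : (0 : ℝ) < l := by exact_mod_cast (by omega : 0 < l)
  have h1 : (r : ℝ) / l ≤ ((r : ℝ) + t) / l := by gcongr; linarith [ht.1]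
  have h2 : ((r : ℝ) + t) / l ≤ ((r : ℝ) + 1) / l := by gcongr; exact ht.2.le
  set u := ((r : ℝ) + t) / l
  simp only [edgeDist, refPoint]
  rcases le_total (((r : ℝ) + 1) / l) (1 / 2) with h | h
  · rw [min_eq_left h, max_eq_right (by linarith)]
    refine le_min ((min_le_left _ _).trans h2) ((min_le_left _ _).trans (by linarith))
  · rw [min_eq_right h]
    rcases le_total ((r : ℝ) / l) (1 / 2) with h' | h'
    · rw [max_eq_right h']
      refine le_min ?_ ?_ <;>
        linarith [min_le_left u (1 - u), min_le_right u (1 - u)]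
    · rw [max_eq_left h']
      refine le_min ?_ ?_ <;>
        linarith [min_le_left u (1 - u), min_le_right u (1 - u)]

theorem refPoint_rpow_le {l r : ℕ} (hr : r < l) {p : ℝ} (hp0 : 0 ≤ p) {t : ℝ}
    (ht : t ∈ Set.Ioo (0 : ℝ) 1) :
    edgeDist (refPoint l r) ^ (-p) ≤ edgeDist (((r : ℝ) + t) / l) ^ (-p) :=
  Real.rpow_le_rpow_of_nonpos (edgeDist_pos (stratum_mem_Ioo hr ht)) (edgeDist_le_refPoint hr ht)
    (by linarith)

theorem sub_sq_le_of_sq_le {x y a : ℝ} (hx : x ^ 2 ≤ a) (hy : y ^ 2 ≤ a) : (x - y) ^ 2 ≤ 4 * a := by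
  nlinarith [sq_nonneg (x + y)]

/-- A monotone function on the unit interval that grows at most like the power `-p / 2` of the
distance to the endpoints varies little within the strata. The two extreme strata contribute
through the size of the function, and the squared oscillations over the other strata add up to at
most the square of their total. -/
theorem sum_integral_sub_refPoint_sq_le {p K : ℝ} (hp0 : 0 ≤ p) (hp : p < 1) {h : ℝ → ℝ}
    (hmeas : Measurable h) (hmono : MonotoneOn h (Set.Ioo 0 1))
    (hK : ∀ t ∈ Set.Ioo (0 : ℝ) 1, h t ^ 2 ≤ K * edgeDist t ^ (-p)) {l : ℕ} (hl : 0 < l) :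
    ∑ r ∈ Finset.range l, ∫ t, (h (((r : ℝ) + t) / l) - h (refPoint l r)) ^ 2 ∂unifInterval ≤
      (8 * (∫ t, edgeDist t ^ (-p) ∂unifInterval) + 4) * K * (l : ℝ) ^ p := by
  have hl' : (0 : ℝ) < l := by exact_mod_cast hl
  set J := ∫ t, edgeDist t ^ (-p) ∂unifInterval with hJ
  have hK0 : 0 ≤ K := by
    have h1 := hK (1 / 2) ⟨by norm_num, by norm_num⟩
    have h2 : 0 < edgeDist (1 / 2 : ℝ) ^ (-p) :=
      Real.rpow_pos_of_pos (edgeDist_pos ⟨by norm_num, by norm_num⟩) _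
    by_contra! hc
    nlinarith [sq_nonneg (h (1 / 2))]
  -- the value of `h` at a point of the open interval that agrees with `r / l` for `0 < r < l`
  set H : ℕ → ℝ := fun r => h (((max 1 (min r (l - 1)) : ℕ) : ℝ) / l) with hH
  have hmem : ∀ r, 2 ≤ l → ((max 1 (min r (l - 1)) : ℕ) : ℝ) / l ∈ Set.Ioo (0 : ℝ) 1 := by
    intro r hl2
    have h1 : 0 < max 1 (min r (l - 1)) := by omega
    have h2 : max 1 (min r (l - 1)) < l := by omega
    refine ⟨div_pos (by exact_mod_cast h1) hl', ?_⟩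
    rw [div_lt_one hl']
    exact_mod_cast h2
  have hX : ∀ r < l, ∀ t ∈ Set.Ioo (0 : ℝ) 1,
      (h (((r : ℝ) + t) / l) - h (refPoint l r)) ^ 2 ≤ 4 * K * (l : ℝ) ^ p * edgeDist t ^ (-p) := by
    intro r hr t ht
    have h1 := hK _ (stratum_mem_Ioo hr ht)
    have h2 := (hK _ (refPoint_mem_Ioo hr)).trans
      (mul_le_mul_of_nonneg_left (refPoint_rpow_le hr hp0 ht) hK0)
    have h3 := mul_le_mul_of_nonneg_left (edgeDist_stratum_rpow_le hr hp0 ht) hK0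
    have h4 := sub_sq_le_of_sq_le h1 h2
    linarith
  have hint : ∀ r < l, Integrable (fun t => (h (((r : ℝ) + t) / l) - h (refPoint l r)) ^ 2)
      unifInterval := by
    intro r hr
    refine ((integrable_edgeDist_rpow hp).const_mul (4 * K * (l : ℝ) ^ p)).mono'
      (((hmeas.comp (by fun_prop)).sub_const _).pow_const 2).aestronglyMeasurable ?_
    filter_upwards [ae_mem_Ioo] with t ht
    rw [Real.norm_of_nonneg (sq_nonneg _)]
    exact hX r hr t ht
  have hXi : ∀ r < l, ∫ t, (h (((r : ℝ) + t) / l) - h (refPoint l r)) ^ 2 ∂unifInterval ≤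
      4 * K * (l : ℝ) ^ p * J := by
    intro r hr
    rw [hJ, ← integral_const_mul]
    refine integral_mono_ae (hint r hr) ((integrable_edgeDist_rpow hp).const_mul _) ?_
    filter_upwards [ae_mem_Ioo] with t ht
    exact hX r hr t ht
  have hJ0 : 0 ≤ J := integral_nonneg_of_ae (by
    filter_upwards [ae_mem_Ioo] with t ht
    have := edgeDist_pos ht
    positivity)
  set X := 4 * K * (l : ℝ) ^ p * J with hXdef
  have hX0 : 0 ≤ X := by positivity
  have hHmono : ∀ r, 0 ≤ H (r + 1) - H r := by
    intro r
    rcases Nat.lt_or_ge l 2 with h2 | h2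
    · have e1 : max 1 (min r (l - 1)) = 1 := by omega
      have e2 : max 1 (min (r + 1) (l - 1)) = 1 := by omega
      simp only [hH, e1, e2, sub_self, le_refl]
    · refine sub_nonneg.2 (hmono (hmem r h2) (hmem (r + 1) h2) ?_)
      gcongr
      omega
  have hr : ∀ r ∈ Finset.range l,
      ∫ t, (h (((r : ℝ) + t) / l) - h (refPoint l r)) ^ 2 ∂unifInterval ≤
      (if r = 0 then X else 0) + (if r = l - 1 then X else 0) + (H (r + 1) - H r) ^ 2 := by
    intro r hr
    rw [Finset.mem_range] at hr
    have hsq := sq_nonneg (H (r + 1) - H r)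
    by_cases h0 : r = 0
    · rw [if_pos h0]
      have : 0 ≤ if r = l - 1 then X else 0 := by split_ifs <;> simp [hX0]
      linarith [hXi r hr]
    by_cases h1 : r = l - 1
    · rw [if_neg h0, if_pos h1]
      linarith [hXi r hr]
    rw [if_neg h0, if_neg h1, zero_add, zero_add]
    have e1 : H r = h ((r : ℝ) / l) := by
      have : max 1 (min r (l - 1)) = r := by omega
      simp only [hH, this]
    have e2 : H (r + 1) = h (((r : ℝ) + 1) / l) := by
      have : max 1 (min (r + 1) (l - 1)) = r + 1 := by omega
      simp only [hH, this]
      push_cast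
      rfl
    have m1 := hmem r (by omega)
    have m2 := hmem (r + 1) (by omega)
    rw [show max 1 (min r (l - 1)) = r by omega] at m1
    rw [show max 1 (min (r + 1) (l - 1)) = r + 1 by omega] at m2
    push_cast at m2
    have hc := refPoint_mem_Icc l r
    have h3 := hmono m1 (refPoint_mem_Ioo hr) hc.1
    have h4 := hmono (refPoint_mem_Ioo hr) m2 hc.2
    have : ∀ᵐ t ∂unifInterval, (h (((r : ℝ) + t) / l) - h (refPoint l r)) ^ 2 ≤
        (H (r + 1) - H r) ^ 2 := by
      filter_upwards [ae_mem_Ioo] with t ht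
      have h5 := hmono m1 (stratum_mem_Ioo hr ht) (by gcongr; linarith [ht.1])
      have h6 := hmono (stratum_mem_Ioo hr ht) m2 (by gcongr; exact ht.2.le)
      rw [e1, e2]
      exact sq_le_sq' (by linarith) (by linarith)
    have h7 := integral_mono_ae (hint r hr) (integrable_const _) this
    simpa using h7
  refine (Finset.sum_le_sum hr).trans ?_
  rw [Finset.sum_add_distrib, Finset.sum_add_distrib, Finset.sum_ite_eq' , Finset.sum_ite_eq',
    if_pos (by simpa using hl), if_pos (by simp; omega)]
  have h1 : ∑ r ∈ Finset.range l, (H (r + 1) - H r) ^ 2 ≤ (H l - H 0) ^ 2 := by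
    rw [← Finset.sum_range_sub]
    exact Finset.sum_sq_le_sq_sum_of_nonneg fun r _ => hHmono r
  have h2 : (H l - H 0) ^ 2 ≤ 4 * (K * (l : ℝ) ^ p) := by
    rcases Nat.lt_or_ge l 2 with h2 | h2
    · have e1 : max 1 (min l (l - 1)) = 1 := by omega
      simp only [hH, e1]
      simp
      positivity
    · have hb : ∀ n : ℕ, 0 < n → n < l → h ((n : ℝ) / l) ^ 2 ≤ K * (l : ℝ) ^ p := by
        intro n hn0 hn
        have hn1 : (1 : ℝ) ≤ n := by exact_mod_cast hn0
        have hn2 : (n : ℝ) + 1 ≤ l := by exact_mod_cast hn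
        have hm : (n : ℝ) / l ∈ Set.Ioo (0 : ℝ) 1 :=
          ⟨by positivity, by rw [div_lt_one hl']; linarith⟩
        refine (hK _ hm).trans (mul_le_mul_of_nonneg_left ?_ hK0)
        have hle : (1 : ℝ) / l ≤ edgeDist ((n : ℝ) / l) := by
          refine le_min (by gcongr) ?_
          rw [div_le_iff₀ hl', sub_mul, div_mul_cancel₀ _ hl'.ne']
          linarith
        calc edgeDist ((n : ℝ) / l) ^ (-p) ≤ ((1 : ℝ) / l) ^ (-p) :=
              Real.rpow_le_rpow_of_nonpos (by positivity) hle (by linarith)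
          _ = (l : ℝ) ^ p := by
              rw [one_div, Real.inv_rpow hl'.le, Real.rpow_neg hl'.le, inv_inv]
      exact sub_sq_le_of_sq_le (hb _ (by omega) (by omega)) (hb _ (by omega) (by omega))
  rw [hXdef]
  linarith

/-! ### The mean value inequality under exponential growth -/

/-- A function on `ℝ^q` whose derivative is bounded by a multiple of the product of the
`cosh (b z_i)` varies in each coordinate like `sinh (b z_j)`. -/
theorem abs_sub_le_of_fderiv_le_cosh {F : (Fin q → ℝ) → ℝ} {x x' : Fin q → ℝ} {C b : ℝ}
    (hC : 0 ≤ C) (hb : 0 < b)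
    (hF : ∀ z : Fin q → ℝ, (∀ j, z j ∈ Set.uIcc (x' j) (x j)) →
      DifferentiableAt ℝ F z ∧ ‖fderiv ℝ F z‖ ≤ C * ∏ j, Real.cosh (b * z j)) :
    |F x - F x'| ≤ C / b * ∑ j, |Real.sinh (b * x j) - Real.sinh (b * x' j)| *
      ∏ i ∈ Finset.univ.erase j, (Real.cosh (b * x i) + Real.cosh (b * x' i)) := by
  set Q : Fin q → ℝ := fun j =>
    ∏ i ∈ Finset.univ.erase j, (Real.cosh (b * x i) + Real.cosh (b * x' i)) with hQ
  have hQ0 : ∀ j, 0 ≤ Q j := fun j => Finset.prod_nonneg fun i _ =>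
    add_nonneg (Real.cosh_pos _).le (Real.cosh_pos _).le
  set z : ℝ → Fin q → ℝ := fun t j => x' j + t * (x j - x' j) with hz
  have hzd : ∀ t, HasDerivAt z (x - x') t := by
    intro t
    rw [hasDerivAt_pi]
    intro j
    simpa [hz] using ((hasDerivAt_id t).mul_const (x j - x' j)).const_add (x' j)
  have hzmem : ∀ t ∈ Set.Icc (0 : ℝ) 1, ∀ j, z t j ∈ Set.uIcc (x' j) (x j) := by
    intro t ht j
    rw [← segment_eq_uIcc]
    refine ⟨1 - t, t, by linarith [ht.2], ht.1, by ring, ?_⟩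
    simp [hz]
    ring
  have hfd : ∀ t ∈ Set.Icc (0 : ℝ) 1,
      HasDerivAt (fun t => F (z t) - F x') (fderiv ℝ F (z t) (x - x')) t := fun t ht =>
    (((hF (z t) (hzmem t ht)).1.hasFDerivAt).comp_hasDerivAt t (hzd t)).sub_const _
  set σ : Fin q → ℝ := fun j => SignType.sign (x j - x' j) with hσ
  have hσx : ∀ j, σ j * (x j - x' j) = |x j - x' j| := fun j => by
    rw [hσ]; exact sign_mul_self _
  set B : ℝ → ℝ := fun t => C / b * ∑ j, σ j * (Real.sinh (b * z t j) - Real.sinh (b * x' j)) * Q j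
    with hB
  have hBd : ∀ t, HasDerivAt B
      (C / b * ∑ j, σ j * (Real.cosh (b * z t j) * (b * (x j - x' j))) * Q j) t := by
    intro t
    refine HasDerivAt.const_mul _ (HasDerivAt.fun_sum fun j _ => ?_)
    have h1 : HasDerivAt (fun t => z t j) (x j - x' j) t := (hasDerivAt_pi.1 (hzd t)) j
    exact (((h1.const_mul b).sinh.sub_const _).const_mul (σ j)).mul_const _
  have key := image_norm_le_of_norm_deriv_right_le_deriv_boundary (a := (0 : ℝ)) (b := 1)
    (f := fun t => F (z t) - F x') (f' := fun t => fderiv ℝ F (z t) (x - x'))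
    (fun t ht => (hfd t ht).continuousAt.continuousWithinAt)
    (fun t ht => (hfd t ⟨ht.1, ht.2.le⟩).hasDerivWithinAt) (B := B)
    (by simp [hz, hB]) hBd (fun t ht => ?_) (x := 1) (by simp)
  · have hz1 : z 1 = x := by ext j; simp [hz]
    rw [hz1, Real.norm_eq_abs] at key
    refine key.trans ?_
    simp only [hB, hz1]
    refine mul_le_mul_of_nonneg_left (Finset.sum_le_sum fun j _ =>
      mul_le_mul_of_nonneg_right ?_ (hQ0 j)) (by positivity)
    refine (le_abs_self _).trans ?_
    rw [abs_mul]
    refine mul_le_of_le_one_left (abs_nonneg _) ?_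
    rw [hσ]
    rcases lt_trichotomy (x j - x' j) 0 with h | h | h <;> simp [h]
  · have hm := hzmem t ⟨ht.1, ht.2.le⟩
    have h1 : ‖fderiv ℝ F (z t) (x - x')‖ ≤ (C * ∏ i, Real.cosh (b * z t i)) * ∑ j, |x j - x' j| := by
      refine ((fderiv ℝ F (z t)).le_opNorm _).trans ?_
      refine mul_le_mul (hF (z t) hm).2 ?_ (norm_nonneg _) ?_
      · rw [pi_norm_le_iff_of_nonneg (Finset.sum_nonneg fun _ _ => abs_nonneg _)]
        intro j
        exact Finset.single_le_sum (f := fun j => |x j - x' j|) (fun _ _ => abs_nonneg _)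
          (Finset.mem_univ j)
      · exact mul_nonneg hC (Finset.prod_nonneg fun i _ => (Real.cosh_pos _).le)
    refine h1.trans ?_
    rw [mul_assoc, Finset.mul_sum, div_mul_eq_mul_div, le_div_iff₀ hb, mul_assoc, Finset.sum_mul]
    refine mul_le_mul_of_nonneg_left (Finset.sum_le_sum fun j _ => ?_) hC
    have e : σ j * (Real.cosh (b * z t j) * (b * (x j - x' j))) * Q j =
        Real.cosh (b * z t j) * b * |x j - x' j| * Q j := by rw [← hσx]; ring
    rw [e, ← Finset.mul_prod_erase _ _ (Finset.mem_univ j)]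
    have h2 : ∏ i ∈ Finset.univ.erase j, Real.cosh (b * z t i) ≤ Q j := by
      refine Finset.prod_le_prod (fun i _ => (Real.cosh_pos _).le) fun i _ => ?_
      have h3 : |b * z t i| ≤ max |b * x' i| |b * x i| := by
        rw [abs_mul, abs_mul, abs_mul, ← mul_max_of_nonneg _ _ (abs_nonneg b)]
        refine mul_le_mul_of_nonneg_left ?_ (abs_nonneg b)
        rcases Set.mem_uIcc.1 (hm i) with h | h
        · exact abs_le_max_abs_abs h.1 h.2
        · exact (abs_le_max_abs_abs h.1 h.2).trans (max_comm _ _).le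
      rcases le_max_iff.1 h3 with h | h
      · linarith [Real.cosh_le_cosh.2 h, Real.cosh_pos (b * x i)]
      · linarith [Real.cosh_le_cosh.2 h, Real.cosh_pos (b * x' i)]
    have h4 : 0 ≤ Real.cosh (b * z t j) * b * |x j - x' j| :=
      mul_nonneg (mul_nonneg (Real.cosh_pos _).le hb.le) (abs_nonneg _)
    nlinarith [mul_le_mul_of_nonneg_left h2 h4]

/-! ### Decay of the variance within the strata -/

section WithinVar

variable {P : Problem d q}

theorem isOpen_openCube : IsOpen (openCube q) :=
  isOpen_set_pi Set.finite_univ fun _ _ => isOpen_Ioo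

theorem convex_openCube : Convex ℝ (openCube q) :=
  convex_pi fun _ _ => convex_Ioo 0 1

theorem Problem.muInv_mem_supp (hmap : P.SamplingMap) (θ : Dec d) {u : Fin q → ℝ}
    (hu : u ∈ openCube q) : P.muInv θ u ∈ P.supp θ := by
  obtain ⟨x, hx, rfl⟩ := (hmap.bijOn θ).surjOn (hmap.openCube_subset hu)
  rwa [(hmap.invOn θ).1 hx]

theorem Problem.mu_muInv (hmap : P.SamplingMap) (θ : Dec d) {u : Fin q → ℝ}
    (hu : u ∈ openCube q) : P.mu θ (P.muInv θ u) = u :=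
  (hmap.invOn θ).2 (hmap.openCube_subset hu)

theorem Problem.continuousAt_muInv (hmap : P.SamplingMap) (θ : Dec d) {u : Fin q → ℝ}
    (hu : u ∈ openCube q) : ContinuousAt (P.muInv θ) u :=
  ((hmap.continuousOn_muInv θ).mono hmap.openCube_subset).continuousAt
    (isOpen_openCube.mem_nhds hu)

theorem variance_le_integral_sub_sq {Ω : Type*} [MeasurableSpace Ω] {μ : Measure Ω}
    [IsProbabilityMeasure μ] {X : Ω → ℝ} (hX : MemLp X 2 μ) (c : ℝ) :
    variance X μ ≤ ∫ ω, (X ω - c) ^ 2 ∂μ := by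
  rw [← variance_sub_const hX.1 c]
  exact variance_le_expectation_sq (hX.1.sub aestronglyMeasurable_const)

/-- If the response at the random point of each stratum is compared with its value at a fixed
point of the cube, the expected squared differences bound the variance within the strata. -/
theorem Problem.withinVar_le (hF : P.RegularNoise) (hmap : P.SamplingMap) (θ : Dec d) {l : ℕ}
    (hl : 0 < l) (c : (Fin q → Fin l) → Fin q → ℝ) {ψ : (Fin q → Fin l) → (Fin q → ℝ) → ℝ}
    (hψ : ∀ s, Integrable (ψ s) (unifCube q))
    (h : ∀ s, ∀ v ∈ openCube q,
      (P.response θ (stratumPoint l s v) - P.response θ (c s)) ^ 2 ≤ ψ s v) :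
    P.withinVar θ l ≤ (∑ s, ∫ v, ψ s v ∂unifCube q) / (l : ℝ) ^ q := by
  refine div_le_div_of_nonneg_right (Finset.sum_le_sum fun s _ => ?_) (by positivity)
  have hm := memLp_comp_stratumPoint hl s (Problem.memLp_response hF hmap θ)
  refine (variance_le_integral_sub_sq hm (P.response θ (c s))).trans
    (integral_mono_ae (hm.sub (memLp_const _)).integrable_sq (hψ s) ?_)
  filter_upwards [ae_mem_openCube] with v hv
  exact h s v hv

/-- A response that is Lipschitz continuous in the uniform vector has variance `O(l ^ (-2))` within
the strata. -/
theorem Problem.exists_withinVar_le_of_bounded (hF : P.RegularNoise) (hmap : P.SamplingMap)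
    (hmu : P.BoundedInverseGradient) (hgrad : P.BoundedNoiseGradient) :
    ∃ C : ℝ, ∀ θ, ∀ l : ℕ, 0 < l → P.withinVar θ l ≤ C * (l : ℝ) ^ (-(2 : ℝ)) := by
  obtain ⟨C₁, h₁⟩ := hmu
  obtain ⟨C₂, h₂⟩ := hgrad
  refine ⟨(|C₂| * |C₁|) ^ 2, fun θ l hl => ?_⟩
  have hl' : (0 : ℝ) < l := by exact_mod_cast hl
  have hdiff : ∀ u ∈ openCube q, HasFDerivAt (P.response θ)
      ((fderiv ℝ (P.F θ) (P.muInv θ u)).comp (fderiv ℝ (P.muInv θ) u)) u := by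
    intro u hu
    have h3 := (hF.contDiffAt θ _ (Problem.muInv_mem_supp hmap θ hu)).differentiableAt one_ne_zero
    exact h3.hasFDerivAt.comp u (h₁ θ u hu).1.hasFDerivAt
  have hlip : ∀ u ∈ openCube q, ∀ u' ∈ openCube q,
      ‖P.response θ u - P.response θ u'‖ ≤ |C₂| * |C₁| * ‖u - u'‖ := by
    intro u hu u' hu'
    refine convex_openCube.norm_image_sub_le_of_norm_hasFDerivWithin_le
      (fun z hz => (hdiff z hz).hasFDerivWithinAt) (fun z hz => ?_) hu' hu
    refine (ContinuousLinearMap.opNorm_comp_le _ _).trans (mul_le_mul ?_ ?_ (norm_nonneg _)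
      (abs_nonneg _))
    · exact (h₂ θ _ (Problem.muInv_mem_supp hmap θ hz)).trans (le_abs_self _)
    · exact (h₁ θ z hz).2.trans (le_abs_self _)
  have hhalf : (fun _ => 1 / 2 : Fin q → ℝ) ∈ openCube q := fun j _ => ⟨by norm_num, by norm_num⟩
  refine (Problem.withinVar_le hF hmap θ hl (fun s => stratumPoint l s fun _ => 1 / 2)
    (ψ := fun _ _ => (|C₂| * |C₁|) ^ 2 * (l : ℝ) ^ (-(2 : ℝ)))
    (fun s => integrable_const _) fun s v hv => ?_).trans (le_of_eq ?_)
  · have h3 := hlip _ (stratumPoint_mem_openCube s hv) _ (stratumPoint_mem_openCube s hhalf)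
    have h4 : ‖stratumPoint l s v - stratumPoint l s fun _ => 1 / 2‖ ≤ (l : ℝ)⁻¹ := by
      rw [pi_norm_le_iff_of_nonneg (by positivity)]
      intro j
      have h5 := hv j (Set.mem_univ j)
      simp only [Set.mem_Ioo] at h5
      simp only [stratumPoint, Pi.sub_apply]
      rw [← sub_div, Real.norm_eq_abs, abs_div, abs_of_pos hl', div_eq_mul_inv]
      refine mul_le_of_le_one_left (by positivity) ?_
      rw [abs_le]
      constructor <;> linarith [h5.1, h5.2]
    have h6 : ‖P.response θ (stratumPoint l s v) -
        P.response θ (stratumPoint l s fun _ => 1 / 2)‖ ≤ |C₂| * |C₁| * (l : ℝ)⁻¹ :=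
      h3.trans (by gcongr)
    rw [Real.norm_eq_abs] at h6
    rw [← sq_abs]
    refine (pow_le_pow_left₀ (abs_nonneg _) h6 2).trans (le_of_eq ?_)
    rw [Real.rpow_neg hl'.le, Real.rpow_two]
    ring
  · simp
    field_simp

/-- When `μ_θ` consists of the marginal distribution functions, `μ_θ⁻¹` acts on each coordinate
separately and monotonically. A flat piece of a distribution function inside its range would
contradict the continuity of `μ_θ⁻¹`. -/
theorem Problem.muInv_apply_le (hmap : P.SamplingMap) {θ : Dec d}
    (hcdf : ∀ x ∈ P.supp θ, ∀ j, P.mu θ x j = (P.law θ).real {y | y j ≤ x j}) {u u' : Fin q → ℝ}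
    (hu : u ∈ openCube q) (hu' : u' ∈ openCube q) {j : Fin q} (hj : u' j ≤ u j) :
    P.muInv θ u' j ≤ P.muInv θ u j := by
  have := hmap.isProbability θ
  have hlim : Tendsto (fun ε : ℝ => P.muInv θ (fun i => u i + ε) j) (𝓝[>] 0)
      (𝓝 (P.muInv θ u j)) := by
    have h1 : ContinuousAt (fun ε : ℝ => fun i => u i + ε) 0 := by fun_prop
    have h2 : ContinuousAt (P.muInv θ) ((fun ε : ℝ => fun i => u i + ε) 0) := by
      simpa using Problem.continuousAt_muInv hmap θ hu
    have h3 := (continuous_apply j).continuousAt.comp (h2.comp h1)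
    have h4 := h3.tendsto.mono_left (nhdsWithin_le_nhds (s := Set.Ioi 0))
    simpa [Function.comp_def] using h4
  refine ge_of_tendsto hlim ?_
  have hmem : ∀ᶠ ε : ℝ in 𝓝[>] 0, (fun i => u i + ε) ∈ openCube q := by
    have h1 : ContinuousAt (fun ε : ℝ => fun i => u i + ε) 0 := by fun_prop
    refine nhdsWithin_le_nhds (h1.eventually_mem (isOpen_openCube.mem_nhds ?_))
    simpa using hu
  filter_upwards [hmem, self_mem_nhdsWithin] with ε hε hε0
  by_contra! hcon
  have e1 := congrFun (Problem.mu_muInv hmap θ hε) j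
  have e2 := congrFun (Problem.mu_muInv hmap θ hu') j
  rw [hcdf _ (Problem.muInv_mem_supp hmap θ hε)] at e1
  rw [hcdf _ (Problem.muInv_mem_supp hmap θ hu')] at e2
  have h5 : (P.law θ).real {y | y j ≤ P.muInv θ (fun i => u i + ε) j} ≤
      (P.law θ).real {y | y j ≤ P.muInv θ u' j} :=
    measureReal_mono fun y (hy : y j ≤ _) => hy.trans hcon.le
  rw [e1, e2] at h5
  have : (0 : ℝ) < ε := hε0
  linarith

/-- The `j`-th quantile function. -/
def Problem.quantile (P : Problem d q) (θ : Dec d) (j : Fin q) (t : ℝ) : ℝ :=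
  P.muInv θ (fun _ => t) j

theorem const_mem_openCube {t : ℝ} (ht : t ∈ Set.Ioo (0 : ℝ) 1) :
    (fun _ => t : Fin q → ℝ) ∈ openCube q := fun _ _ => ht

theorem Problem.muInv_apply_eq_quantile (hmap : P.SamplingMap) {θ : Dec d}
    (hcdf : ∀ x ∈ P.supp θ, ∀ j, P.mu θ x j = (P.law θ).real {y | y j ≤ x j}) {u : Fin q → ℝ}
    (hu : u ∈ openCube q) (j : Fin q) : P.muInv θ u j = P.quantile θ j (u j) :=
  le_antisymm
    (Problem.muInv_apply_le hmap hcdf (const_mem_openCube (hu j (Set.mem_univ j))) hu le_rfl)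
    (Problem.muInv_apply_le hmap hcdf hu (const_mem_openCube (hu j (Set.mem_univ j))) le_rfl)

theorem Problem.monotoneOn_quantile (hmap : P.SamplingMap) {θ : Dec d}
    (hcdf : ∀ x ∈ P.supp θ, ∀ j, P.mu θ x j = (P.law θ).real {y | y j ≤ x j}) (j : Fin q) :
    MonotoneOn (P.quantile θ j) (Set.Ioo 0 1) := fun _ ht _ ht' h =>
  Problem.muInv_apply_le hmap hcdf (const_mem_openCube ht') (const_mem_openCube ht) h

theorem Problem.measurable_quantile (hmap : P.SamplingMap) (θ : Dec d) (j : Fin q) :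
    Measurable (P.quantile θ j) :=
  (measurable_pi_apply j).comp ((hmap.measurable_muInv.comp measurable_prodMk_left).comp
    (measurable_pi_lambda _ fun _ => measurable_id))

/-- The image of the open cube under `μ_θ⁻¹` contains with two points the box that they span. -/
theorem Problem.mem_supp_of_mem_uIcc (hmap : P.SamplingMap) {θ : Dec d}
    (hcdf : ∀ x ∈ P.supp θ, ∀ j, P.mu θ x j = (P.law θ).real {y | y j ≤ x j}) {u u' : Fin q → ℝ}
    (hu : u ∈ openCube q) (hu' : u' ∈ openCube q) {z : Fin q → ℝ}
    (hz : ∀ j, z j ∈ Set.uIcc (P.muInv θ u' j) (P.muInv θ u j)) : z ∈ P.supp θ := by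
  have h1 : ∀ j, ∃ t ∈ Set.Ioo (0 : ℝ) 1, P.quantile θ j t = z j := by
    intro j
    have hsub : Set.uIcc (u' j) (u j) ⊆ Set.Ioo 0 1 :=
      Set.OrdConnected.uIcc_subset Set.ordConnected_Ioo (hu' j (Set.mem_univ j))
        (hu j (Set.mem_univ j))
    have hcont : ContinuousOn (P.quantile θ j) (Set.uIcc (u' j) (u j)) := by
      intro t ht
      have h2 : ContinuousAt (fun t : ℝ => (fun _ => t : Fin q → ℝ)) t := by fun_prop
      have h3 := Problem.continuousAt_muInv hmap θ (const_mem_openCube (q := q) (hsub ht))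
      exact ((continuous_apply j).continuousAt.comp
        (ContinuousAt.comp (f := fun t : ℝ => (fun _ => t : Fin q → ℝ)) h3 h2)).continuousWithinAt
    have h4 := hz j
    rw [Problem.muInv_apply_eq_quantile hmap hcdf hu, Problem.muInv_apply_eq_quantile hmap hcdf hu']
      at h4
    obtain ⟨t, ht, e⟩ := intermediate_value_uIcc hcont h4
    exact ⟨t, hsub ht, e⟩
  choose t ht e using h1
  have htc : t ∈ openCube q := fun j _ => ht j
  have : P.muInv θ t = z := by
    ext j
    rw [Problem.muInv_apply_eq_quantile hmap hcdf htc, e]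
  rw [← this]
  exact Problem.muInv_mem_supp hmap θ htc

/-- The exponential tails of the components, written for the quantile functions. -/
theorem Problem.exp_quantile_le (hmap : P.SamplingMap) {θ : Dec d}
    (hcdf : ∀ x ∈ P.supp θ, ∀ j, P.mu θ x j = (P.law θ).real {y | y j ≤ x j}) {D κ b : ℝ}
    (hb : 0 < b) (hbκ : 2 * b < κ) {j : Fin q}
    (htail : ∀ y : ℝ, 0 ≤ y → (P.law θ).real {x | y ≤ |x j|} ≤ D * Real.exp (-(κ * y)))
    {t : ℝ} (ht : t ∈ Set.Ioo (0 : ℝ) 1) :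
    Real.exp (2 * b * |P.quantile θ j t|) ≤
      D ^ (2 * b / κ) * edgeDist t ^ (-(2 * b / κ)) := by
  have := hmap.isProbability θ
  have hc := const_mem_openCube (q := q) ht
  have h1 := congrFun (Problem.mu_muInv hmap θ hc) j
  rw [hcdf _ (Problem.muInv_mem_supp hmap θ hc)] at h1
  change (P.law θ).real {y | y j ≤ P.quantile θ j t} = t at h1
  set x := P.quantile θ j t
  have hd := edgeDist_pos ht
  have hm : MeasurableSet {y : Fin q → ℝ | y j ≤ x} :=
    measurableSet_le (measurable_pi_apply j) measurable_const
  have h2 : edgeDist t ≤ (P.law θ).real {y | |x| ≤ |y j|} := by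
    rcases le_total x 0 with hx | hx
    · refine (min_le_left _ _).trans ?_
      conv_lhs => rw [← h1]
      refine measureReal_mono fun y (hy : y j ≤ x) => ?_
      change |x| ≤ |y j|
      rw [abs_of_nonpos hx, abs_of_nonpos (hy.trans hx)]
      linarith
    · refine (min_le_right _ _).trans ?_
      conv_lhs => rw [← h1]
      rw [← probReal_compl_eq_one_sub hm]
      refine measureReal_mono fun y hy => ?_
      have hy' : x < y j := not_le.1 hy
      change |x| ≤ |y j|
      rw [abs_of_nonneg hx, abs_of_nonneg (hx.trans hy'.le)]
      exact hy'.le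
  have h3 := h2.trans (htail _ (abs_nonneg x))
  have hκ : 0 < κ := by linarith
  have hD : 0 < D := by
    by_contra! hcon
    nlinarith [Real.exp_pos (-(κ * |x|))]
  have h4 : Real.exp (κ * |x|) ≤ D / edgeDist t := by
    rw [le_div_iff₀ hd]
    calc Real.exp (κ * |x|) * edgeDist t ≤ Real.exp (κ * |x|) * (D * Real.exp (-(κ * |x|))) := by
          gcongr
      _ = D := by rw [mul_left_comm, ← Real.exp_add]; simp
  calc Real.exp (2 * b * |x|) = Real.exp (κ * |x|) ^ (2 * b / κ) := by
        rw [← Real.exp_mul]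
        congr 1
        field_simp
    _ ≤ (D / edgeDist t) ^ (2 * b / κ) := by gcongr
    _ = _ := by
        rw [Real.div_rpow hD.le hd.le, Real.rpow_neg hd.le, div_eq_mul_inv]

theorem cosh_sq_le_exp (b x : ℝ) (hb : 0 < b) :
    Real.cosh (b * x) ^ 2 ≤ Real.exp (2 * b * |x|) := by
  have h : Real.cosh (b * x) ≤ Real.exp (b * |x|) := by
    rw [← Real.cosh_abs, abs_mul, abs_of_pos hb, Real.cosh_eq]
    have : Real.exp (-(b * |x|)) ≤ Real.exp (b * |x|) :=
      Real.exp_le_exp.2 (by have : 0 ≤ b * |x| := by positivity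
                            linarith)
    linarith
  calc Real.cosh (b * x) ^ 2 ≤ Real.exp (b * |x|) ^ 2 := by
        gcongr
    _ = _ := by rw [← Real.exp_nat_mul]; push_cast; ring_nf

/-- Exponential growth of `F` against exponential tails: the variance within the strata is
`O(l ^ (-(1 - 2 b / κ)))`. The increments of `F` within a stratum are controlled coordinate by
coordinate; the coordinate that moves contributes the one-dimensional rate, the other ones
contribute bounded factors. -/
theorem Problem.exists_withinVar_le_of_exponential (hF : P.RegularNoise) (hmap : P.SamplingMap)
    (hcdf : ∀ θ, ∀ x ∈ P.supp θ, ∀ j, P.mu θ x j = (P.law θ).real {y | y j ≤ x j}) {C D κ b : ℝ}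
    (hC : 0 ≤ C) (hb : 0 < b) (hbκ : 2 * b < κ)
    (htail : ∀ j θ, ∀ y : ℝ, 0 ≤ y →
      (P.law θ).real {x | y ≤ |x j|} ≤ D * Real.exp (-(κ * y)))
    (hgrad : ∀ θ, ∀ x ∈ P.supp θ, ‖fderiv ℝ (P.F θ) x‖ ≤ C * ∏ j, Real.cosh (b * x j)) :
    ∃ C' : ℝ, ∀ θ, ∀ l : ℕ, 0 < l →
      P.withinVar θ l ≤ C' * (l : ℝ) ^ (-(1 - 2 * b / κ)) := by
  have hκ : 0 < κ := by linarith
  set p := 2 * b / κ with hp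
  have hp0 : 0 ≤ p := by positivity
  have hp1 : p < 1 := by rw [hp, div_lt_one hκ]; exact hbκ
  set K := D ^ p with hK
  set J := ∫ t, edgeDist t ^ (-p) ∂unifInterval with hJ
  refine ⟨(C / b) ^ 2 * q * (q * ((8 * J + 4) * K * (4 * K * J) ^ (q - 1))), fun θ l hl => ?_⟩
  have hl' : (0 : ℝ) < l := by exact_mod_cast hl
  set x := P.quantile θ
  set h : Fin q → ℝ → ℝ := fun j t => Real.sinh (b * x j t) with hh
  have hxm : ∀ j, Measurable (x j) := fun j => Problem.measurable_quantile hmap θ j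
  have hexp : ∀ j, ∀ t ∈ Set.Ioo (0 : ℝ) 1,
      Real.cosh (b * x j t) ^ 2 ≤ K * edgeDist t ^ (-p) := fun j t ht =>
    (cosh_sq_le_exp b _ hb).trans
      (Problem.exp_quantile_le hmap (hcdf θ) hb hbκ (htail j θ) ht)
  have hhK : ∀ j, ∀ t ∈ Set.Ioo (0 : ℝ) 1, h j t ^ 2 ≤ K * edgeDist t ^ (-p) := fun j t ht => by
    have := hexp j t ht
    rw [Real.cosh_sq] at this
    simp only [hh]
    linarith
  have hhm : ∀ j, Measurable (h j) := fun j => Real.measurable_sinh.comp ((hxm j).const_mul b)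
  have hmono : ∀ j, MonotoneOn (h j) (Set.Ioo 0 1) := fun j t ht t' ht' htt =>
    Real.sinh_le_sinh.2 (mul_le_mul_of_nonneg_left
      (Problem.monotoneOn_quantile hmap (hcdf θ) j ht ht' htt) hb.le)
  -- the factor of coordinate `i` when coordinate `j` moves
  set ψ : Fin q → Fin q → ℕ → ℝ → ℝ := fun j i r t =>
    if i = j then (h j (((r : ℝ) + t) / l) - h j (refPoint l r)) ^ 2
    else 4 * K * edgeDist (((r : ℝ) + t) / l) ^ (-p) with hψ
  have hψint : ∀ j i, ∀ r < l, Integrable (ψ j i r) unifInterval := by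
    intro j i r hr
    by_cases hij : i = j
    · simp only [hψ, if_pos hij]
      refine ((integrable_edgeDist_stratum hr hp0 hp1).const_mul (4 * K)).mono'
        ((((hhm j).comp (by fun_prop)).sub_const _).pow_const 2).aestronglyMeasurable ?_
      filter_upwards [ae_mem_Ioo] with t ht
      rw [Real.norm_of_nonneg (sq_nonneg _), mul_assoc]
      have hK0 : 0 ≤ K := by
        have h1 := hhK j t ht
        have h2 := Real.rpow_pos_of_pos (edgeDist_pos ht) (-p)
        by_contra! hc
        nlinarith [sq_nonneg (h j t)]
      exact sub_sq_le_of_sq_le (hhK j _ (stratum_mem_Ioo hr ht))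
        ((hhK j _ (refPoint_mem_Ioo hr)).trans
          (mul_le_mul_of_nonneg_left (refPoint_rpow_le hr hp0 ht) hK0))
    · simp only [hψ, if_neg hij]
      exact (integrable_edgeDist_stratum hr hp0 hp1).const_mul _
  have hpoint : ∀ (s : Fin q → Fin l), ∀ v ∈ openCube q,
      (P.response θ (stratumPoint l s v) - P.response θ fun j => refPoint l (s j)) ^ 2 ≤
        (C / b) ^ 2 * q * ∑ j, ∏ i, ψ j i (s i) (v i) := by
    intro s v hv
    set u := stratumPoint l s v
    set u' : Fin q → ℝ := fun j => refPoint l (s j)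
    have hu : u ∈ openCube q := stratumPoint_mem_openCube s hv
    have hu' : u' ∈ openCube q := fun j _ => refPoint_mem_Ioo (s j).isLt
    have h1 := abs_sub_le_of_fderiv_le_cosh (F := P.F θ) (x := P.muInv θ u) (x' := P.muInv θ u')
      hC hb fun z hz => by
        have hzs := Problem.mem_supp_of_mem_uIcc hmap (hcdf θ) hu hu' hz
        exact ⟨(hF.contDiffAt θ z hzs).differentiableAt one_ne_zero, hgrad θ z hzs⟩
    simp only [Problem.muInv_apply_eq_quantile hmap (hcdf θ) hu,
      Problem.muInv_apply_eq_quantile hmap (hcdf θ) hu'] at h1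
    have h2 := pow_le_pow_left₀ (abs_nonneg _) h1 2
    rw [sq_abs, mul_pow] at h2
    refine h2.trans ?_
    rw [mul_assoc ((C / b) ^ 2)]
    refine mul_le_mul_of_nonneg_left ?_ (sq_nonneg _)
    refine sq_sum_le_card_mul_sum_sq.trans ?_
    rw [Finset.card_univ, Fintype.card_fin]
    refine mul_le_mul_of_nonneg_left (Finset.sum_le_sum fun j _ => ?_) (Nat.cast_nonneg q)
    rw [mul_pow, sq_abs, ← Finset.mul_prod_erase _ _ (Finset.mem_univ j), ← Finset.prod_pow]
    have e : ψ j j (s j) (v j) = (h j (u j) - h j (u' j)) ^ 2 := by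
      simp only [hψ, if_true]
      rfl
    rw [e]
    refine mul_le_mul_of_nonneg_left (Finset.prod_le_prod (fun i _ => sq_nonneg _) fun i hi => ?_)
      (sq_nonneg _)
    simp only [hψ, if_neg (Finset.ne_of_mem_erase hi)]
    have hvi := hv i (Set.mem_univ i)
    have h3 := hexp i (u i) (hu i (Set.mem_univ i))
    have hK0 : 0 ≤ K := by
      have h4 := Real.rpow_pos_of_pos (edgeDist_pos (hu i (Set.mem_univ i))) (-p)
      have h5 := pow_pos (Real.cosh_pos (b * x i (u i))) 2
      by_contra! hc
      nlinarith
    have h4 := (hexp i (u' i) (hu' i (Set.mem_univ i))).trans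
      (mul_le_mul_of_nonneg_left (refPoint_rpow_le (s i).isLt hp0 hvi) hK0)
    have h5 : K * edgeDist (u i) ^ (-p) = K * edgeDist (((s i : ℕ) + v i) / l) ^ (-p) := rfl
    nlinarith [sq_nonneg (Real.cosh (b * x i (u i)) - Real.cosh (b * x i (u' i)))]
  have hprodint : ∀ (s : Fin q → Fin l) j,
      Integrable (fun v : Fin q → ℝ => ∏ i, ψ j i (s i) (v i)) (unifCube q) := by
    intro s j
    rw [unifCube_eq_pi]
    exact Integrable.fintype_prod (f := fun i t => ψ j i (s i) t)
      fun i => hψint j i (s i) (s i).isLt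
  refine (Problem.withinVar_le hF hmap θ hl (fun s j => refPoint l (s j))
    (fun s => (integrable_finsetSum _ fun j _ => hprodint s j).const_mul _) hpoint).trans ?_
  have hsum : ∀ j, ∑ s : Fin q → Fin l, ∫ v : Fin q → ℝ, ∏ i, ψ j i (s i) (v i) ∂unifCube q ≤
      (8 * J + 4) * K * (l : ℝ) ^ p * (4 * K * J * l) ^ (q - 1) := by
    intro j
    have h1 : ∀ s : Fin q → Fin l, ∫ v : Fin q → ℝ, ∏ i, ψ j i (s i) (v i) ∂unifCube q =
        ∏ i, ∫ t, ψ j i (s i) t ∂unifInterval := by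
      intro s
      rw [unifCube_eq_pi]
      exact integral_fintype_prod_eq_prod fun i t => ψ j i (s i) t
    have h2 := Finset.prod_univ_sum (fun _ : Fin q => (Finset.univ : Finset (Fin l)))
      fun i r => ∫ t, ψ j i (r : ℕ) t ∂unifInterval
    rw [Fintype.piFinset_univ] at h2
    rw [Finset.sum_congr rfl fun s _ => h1 s, ← h2, ← Finset.mul_prod_erase _ _ (Finset.mem_univ j)]
    have h3 : ∀ i ∈ Finset.univ.erase j,
        ∑ r : Fin l, ∫ t, ψ j i (r : ℕ) t ∂unifInterval = 4 * K * J * l := by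
      intro i hi
      rw [Fin.sum_univ_eq_sum_range fun r : ℕ => ∫ t, ψ j i r t ∂unifInterval]
      simp only [hψ, if_neg (Finset.ne_of_mem_erase hi), integral_const_mul]
      rw [← Finset.mul_sum, integral_unifInterval_eq hl (g := fun t => edgeDist t ^ (-p))
        (measurable_edgeDist.pow_const _) fun r hr => integrable_edgeDist_stratum hr hp0 hp1]
      ring
    rw [Finset.prod_congr rfl h3, Finset.prod_const, Finset.card_erase_of_mem (Finset.mem_univ j),
      Finset.card_univ, Fintype.card_fin]
    have hK0 : 0 ≤ K := by
      have h4 : (1 / 2 : ℝ) ∈ Set.Ioo (0 : ℝ) 1 := ⟨by norm_num, by norm_num⟩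
      have h5 := hhK j _ h4
      have h6 := Real.rpow_pos_of_pos (edgeDist_pos h4) (-p)
      by_contra! hc
      nlinarith [sq_nonneg (h j (1 / 2))]
    have hJ0 : 0 ≤ J := integral_nonneg_of_ae (by
      filter_upwards [ae_mem_Ioo] with t ht
      have := edgeDist_pos ht
      positivity)
    refine mul_le_mul_of_nonneg_right ?_ (by positivity)
    rw [Fin.sum_univ_eq_sum_range fun r : ℕ => ∫ t, ψ j j r t ∂unifInterval]
    simp only [hψ, if_true]
    exact sum_integral_sub_refPoint_sq_le hp0 hp1 (hhm j) (hmono j) (hhK j) hl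
  rw [div_le_iff₀ (by positivity)]
  simp only [integral_const_mul]
  rw [← Finset.mul_sum]
  have h1 : ∑ s : Fin q → Fin l, ∫ v, ∑ j, ∏ i, ψ j i (s i) (v i) ∂unifCube q ≤
      q * ((8 * J + 4) * K * (l : ℝ) ^ p * (4 * K * J * l) ^ (q - 1)) := by
    simp only [integral_finsetSum _ fun j _ => hprodint _ j]
    rw [Finset.sum_comm]
    refine (Finset.sum_le_sum fun j _ => hsum j).trans (le_of_eq ?_)
    simp
  refine (mul_le_mul_of_nonneg_left h1 (by positivity)).trans (le_of_eq ?_)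
  rcases Nat.eq_zero_or_pos q with hq | hq
  · subst hq; simp
  have e1 : (l : ℝ) ^ q = (l : ℝ) ^ (q - 1) * l := by rw [← pow_succ]; congr 1; omega
  have e2 : (l : ℝ) ^ (-(1 - p)) * l = (l : ℝ) ^ p := by
    rw [← Real.rpow_add_one hl'.ne']
    congr 1
    ring
  rw [e1, mul_pow, ← e2]
  ring

end WithinVar

/-! ### The five specifications -/

section Regimes

variable {P : Problem d q}

theorem Problem.SubExponential.exists_tail {κ : Fin q → ℝ} (h : P.SubExponential κ) {κ' : ℝ}
    (hκ : ∀ j, κ' ≤ κ j) : ∃ D : ℝ, ∀ j θ, ∀ y : ℝ, 0 ≤ y →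
      (P.law θ).real {x | y ≤ |x j|} ≤ D * Real.exp (-(κ' * y)) := by
  choose _ C hC using h
  refine ⟨∑ j, |C j|, fun j θ y hy => (hC j θ y hy).trans ?_⟩
  have h1 : C j ≤ ∑ j, |C j| := (le_abs_self _).trans
    (Finset.single_le_sum (f := fun j => |C j|) (fun _ _ => abs_nonneg _) (Finset.mem_univ j))
  have h2 : Real.exp (-(κ j * y)) ≤ Real.exp (-(κ' * y)) :=
    Real.exp_le_exp.2 (neg_le_neg (mul_le_mul_of_nonneg_right (hκ j) hy))
  exact mul_le_mul h1 h2 (Real.exp_pos _).le (Finset.sum_nonneg fun _ _ => abs_nonneg _)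

/-- A Gaussian tail is lighter than every exponential tail. -/
theorem Problem.SubGaussian.exists_tail {ξ : Fin q → ℝ} (h : P.SubGaussian ξ) (κ' : ℝ) :
    ∃ D : ℝ, ∀ j θ, ∀ y : ℝ, 0 ≤ y →
      (P.law θ).real {x | y ≤ |x j|} ≤ D * Real.exp (-(κ' * y)) := by
  choose hξ C hC using h
  refine ⟨∑ j, |C j| * Real.exp (κ' ^ 2 * ξ j ^ 2 / 4), fun j θ y hy => (hC j θ y hy).trans ?_⟩
  have h1 : |C j| * Real.exp (κ' ^ 2 * ξ j ^ 2 / 4) ≤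
      ∑ j, |C j| * Real.exp (κ' ^ 2 * ξ j ^ 2 / 4) :=
    Finset.single_le_sum (f := fun j => |C j| * Real.exp (κ' ^ 2 * ξ j ^ 2 / 4))
      (fun _ _ => mul_nonneg (abs_nonneg _) (Real.exp_pos _).le) (Finset.mem_univ j)
  refine le_trans ?_ (mul_le_mul_of_nonneg_right h1 (Real.exp_pos _).le)
  rw [mul_assoc, ← Real.exp_add]
  refine mul_le_mul (le_abs_self _) (Real.exp_le_exp.2 ?_) (Real.exp_pos _).le (abs_nonneg _)
  -- completing the square
  have h2 : y = y / ξ j * ξ j := by rw [div_mul_cancel₀ _ (hξ j).ne']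
  have h3 : κ' * y = κ' * ξ j * (y / ξ j) := by
    conv_lhs => rw [h2]
    ring
  rw [h3]
  nlinarith [sq_nonneg (y / ξ j - κ' * ξ j / 2)]

theorem exp_le_two_mul_cosh {b : ℝ} (hb : 0 ≤ b) (x : ℝ) :
    Real.exp (b * |x|) ≤ 2 * Real.cosh (b * x) := by
  rw [← Real.cosh_abs (b * x), abs_mul, abs_of_nonneg hb, Real.cosh_eq]
  linarith [Real.exp_pos (-(b * |x|))]

theorem cosh_le_prod_cosh (b : ℝ) (x : Fin q → ℝ) (j : Fin q) :
    Real.cosh (b * x j) ≤ ∏ i, Real.cosh (b * x i) := by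
  rw [← Finset.mul_prod_erase _ _ (Finset.mem_univ j)]
  refine le_mul_of_one_le_right (Real.cosh_pos _).le ?_
  calc (1 : ℝ) = ∏ _i ∈ Finset.univ.erase j, (1 : ℝ) := by simp
    _ ≤ _ := Finset.prod_le_prod (fun _ _ => zero_le_one) fun i _ => Real.one_le_cosh _

theorem one_le_prod_cosh (b : ℝ) (x : Fin q → ℝ) : 1 ≤ ∏ i, Real.cosh (b * x i) := by
  calc (1 : ℝ) = ∏ _i : Fin q, (1 : ℝ) := by simp
    _ ≤ _ := Finset.prod_le_prod (fun _ _ => zero_le_one) fun i _ => Real.one_le_cosh _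

/-- A polynomial grows more slowly than every exponential. -/
theorem Problem.PolynomialGrowth.exists_cosh_bound {a : Fin q → ℕ} (h : P.PolynomialGrowth a)
    {b : ℝ} (hb : 0 < b) : ∃ C : ℝ, 0 ≤ C ∧ ∀ θ, ∀ x ∈ P.supp θ,
      ‖fderiv ℝ (P.F θ) x‖ ≤ C * ∏ j, Real.cosh (b * x j) := by
  obtain ⟨C, hC⟩ := h.2
  set E : ℝ := ∑ j, 2 * ((a j).factorial : ℝ) / b ^ a j with hE
  have hE0 : 0 ≤ E := Finset.sum_nonneg fun j _ => by positivity
  refine ⟨|C| * (1 + E), by positivity, fun θ x hx => (hC θ x hx).trans ?_⟩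
  have hprod := one_le_prod_cosh b x
  have h1 : ∑ j, |x j| ^ a j ≤ E * ∏ i, Real.cosh (b * x i) := by
    rw [hE, Finset.sum_mul]
    refine Finset.sum_le_sum fun j _ => ?_
    have h2 := Real.pow_div_factorial_le_exp (b * |x j|) (by positivity) (a j)
    have h3 := (h2.trans (exp_le_two_mul_cosh hb.le (x j))).trans
      (mul_le_mul_of_nonneg_left (cosh_le_prod_cosh b x j) zero_le_two)
    rw [mul_pow, div_le_iff₀ (by positivity)] at h3
    rw [div_mul_eq_mul_div, le_div_iff₀ (by positivity)]
    linarith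
  rw [mul_assoc]
  have h4 : 1 + ∑ j, |x j| ^ a j ≤ (1 + E) * ∏ i, Real.cosh (b * x i) := by linarith
  have h5 : 0 ≤ 1 + ∑ j, |x j| ^ a j := by positivity
  exact mul_le_mul (le_abs_self C) h4 h5 (abs_nonneg C)

theorem Problem.ExponentialGrowth.exists_cosh_bound {b' : Fin q → ℝ} (h : P.ExponentialGrowth b')
    {b : ℝ} (hb : 0 < b) (hbb : ∀ j, b' j ≤ b) : ∃ C : ℝ, 0 ≤ C ∧ ∀ θ, ∀ x ∈ P.supp θ,
      ‖fderiv ℝ (P.F θ) x‖ ≤ C * ∏ j, Real.cosh (b * x j) := by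
  obtain ⟨C, hC⟩ := h.2.2
  refine ⟨|C| * 2 ^ q, by positivity, fun θ x hx => (hC θ x hx).trans ?_⟩
  rw [mul_assoc]
  refine mul_le_mul (le_abs_self C) ?_ (Real.exp_pos _).le (abs_nonneg C)
  calc Real.exp (∑ j, b' j * |x j|) ≤ Real.exp (∑ j, b * |x j|) :=
        Real.exp_le_exp.2 (Finset.sum_le_sum fun j _ =>
          mul_le_mul_of_nonneg_right (hbb j) (abs_nonneg _))
    _ = ∏ j, Real.exp (b * |x j|) := Real.exp_sum _ _
    _ ≤ ∏ j, 2 * Real.cosh (b * x j) := Finset.prod_le_prod (fun _ _ => (Real.exp_pos _).le)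
        fun j _ => exp_le_two_mul_cosh hb.le _
    _ = 2 ^ q * ∏ j, Real.cosh (b * x j) := by rw [Finset.prod_mul_distrib]; simp

/-- The margins `δ` and `ϱ` absorb a small loss `τ` in the decay rate. -/
theorem exists_small_loss (hq : 1 ≤ q) {δ ϱ : ℝ} (hδ : 0 < δ) (hϱ : 0 < ϱ) :
    ∃ τ : ℝ, 0 < τ ∧ τ < 1 ∧ 1 < (1 + δ) * q / (q + 1) * ((q + (1 - τ)) / q) ∧
      4 ≤ 2 * ((4 + ϱ) * q / (2 * (q + 1))) * ((q + (1 - τ)) / q) := by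
  have hq' : (1 : ℝ) ≤ q := by exact_mod_cast hq
  have hq0 : (0 : ℝ) < q := by linarith
  set τ := min (1 / 2) (min (δ / (1 + δ)) (ϱ / (4 + ϱ))) with hτ
  have h1 : τ ≤ 1 / 2 := min_le_left _ _
  have h2 : τ ≤ δ / (1 + δ) := (min_le_right _ _).trans (min_le_left _ _)
  have h3 : τ ≤ ϱ / (4 + ϱ) := (min_le_right _ _).trans (min_le_right _ _)
  have h0 : 0 < τ := by positivity
  rw [le_div_iff₀ (by positivity)] at h2 h3
  refine ⟨τ, h0, by linarith, ?_, ?_⟩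
  · have e : (1 + δ) * q / (q + 1) * ((q + (1 - τ)) / q) = (1 + δ) * (q + 1 - τ) / (q + 1) := by
      field_simp
      ring
    rw [e, lt_div_iff₀ (by positivity)]
    nlinarith
  · have e : 2 * ((4 + ϱ) * q / (2 * (q + 1))) * ((q + (1 - τ)) / q) =
        (4 + ϱ) * (q + 1 - τ) / (q + 1) := by
      field_simp
      ring
    rw [e, le_div_iff₀ (by positivity)]
    nlinarith

/-- In each specification the variance within the strata decays polynomially, at a rate `α` for
which the deflation sequence makes the error probabilities summable over the iterations and the
radius exponent compensates the fourth power of the radius. -/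
theorem Problem.Regime.exists_withinVar_le (hq : 1 ≤ q) (hF : P.RegularNoise)
    (hmap : P.SamplingMap) {e γ : ℝ} (h : P.Regime e γ) :
    ∃ α C : ℝ, 0 < α ∧ 0 < e ∧
      (∀ θ, ∀ l : ℕ, 0 < l → P.withinVar θ l ≤ C * (l : ℝ) ^ (-α)) ∧
      1 < e * ((q + α) / q) ∧ 4 ≤ 2 * γ * ((q + α) / q) := by
  have hq0 : (0 : ℝ) < q := by exact_mod_cast hq
  have : Nonempty (Fin q) := ⟨⟨0, hq⟩⟩
  -- sub-exponential tails against exponential growth with an arbitrarily small ratio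
  have slow : ∀ (δ ϱ : ℝ), 0 < δ → 0 < ϱ → P.IndependentComponents →
      (∀ τ, 0 < τ → τ < 1 → ∃ b κ C D : ℝ, 0 < b ∧ 0 < κ ∧ 2 * b / κ = τ ∧ 0 ≤ C ∧
        (∀ j θ, ∀ y : ℝ, 0 ≤ y → (P.law θ).real {x | y ≤ |x j|} ≤ D * Real.exp (-(κ * y))) ∧
        ∀ θ, ∀ x ∈ P.supp θ, ‖fderiv ℝ (P.F θ) x‖ ≤ C * ∏ j, Real.cosh (b * x j)) →
      ∃ α C : ℝ, 0 < α ∧ 0 < (1 + δ) * q / (q + 1) ∧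
      (∀ θ, ∀ l : ℕ, 0 < l → P.withinVar θ l ≤ C * (l : ℝ) ^ (-α)) ∧
      1 < (1 + δ) * q / (q + 1) * ((q + α) / q) ∧
      4 ≤ 2 * ((4 + ϱ) * q / (2 * (q + 1))) * ((q + α) / q) := by
    intro δ ϱ hδ hϱ hind hcon
    obtain ⟨τ, hτ0, hτ1, h1, h2⟩ := exists_small_loss hq hδ hϱ
    obtain ⟨b, κ, C, D, hb, hκ, hbκ, hC, htail, hgrad⟩ := hcon τ hτ0 hτ1
    obtain ⟨C', hC'⟩ := Problem.exists_withinVar_le_of_exponential hF hmap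
      (fun θ => (hind θ).2) hC hb (by rwa [← hbκ, div_lt_one hκ] at hτ1) htail hgrad
    rw [hbκ] at hC'
    exact ⟨1 - τ, C', by linarith, by positivity, hC', h1, h2⟩
  cases h with
  | bounded δ hδ hmu hgrad =>
    obtain ⟨C, hC⟩ := Problem.exists_withinVar_le_of_bounded hF hmap hmu hgrad
    refine ⟨2, C, two_pos, by positivity, hC, ?_, ?_⟩
    · have : (1 + δ) * q / (q + 2) * ((q + 2) / q) = 1 + δ := by field_simp
      rw [this]; linarith
    · have : 2 * (2 * q / (q + 2)) * ((q + 2) / q) = (4 : ℝ) := by field_simp; norm_num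
      rw [this]
  | subExpPoly δ ϱ hδ hϱ κ a hind hmu hgrad =>
    refine slow δ ϱ hδ hϱ hind fun τ hτ0 hτ1 => ?_
    obtain ⟨j₀, hj₀⟩ := Finite.exists_min κ
    have hκ : 0 < κ j₀ := (hmu j₀).1
    obtain ⟨D, hD⟩ := hmu.exists_tail hj₀
    obtain ⟨C, hC, hCg⟩ := hgrad.exists_cosh_bound (b := τ * κ j₀ / 2) (by positivity)
    exact ⟨τ * κ j₀ / 2, κ j₀, C, D, by positivity, hκ, by field_simp, hC, hD, hCg⟩
  | subExpExp δ hδ κ b hind hmu hgrad hb hκb =>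
    have hκ0 : 0 < ⨅ j, κ j := by linarith
    obtain ⟨D, hD⟩ := hmu.exists_tail (κ' := ⨅ j, κ j) fun j => ciInf_le (Set.finite_range κ).bddBelow j
    obtain ⟨C, hC, hCg⟩ := hgrad.exists_cosh_bound (b := ⨆ j, b j) hb fun j =>
      le_ciSup (Set.finite_range b).bddAbove j
    obtain ⟨C', hC'⟩ := Problem.exists_withinVar_le_of_exponential hF hmap
      (fun θ => (hind θ).2) hC hb hκb hD hCg
    set K := ⨅ j, κ j
    set B := ⨆ j, b j
    have hden : 0 < (q + 1) * K - 2 * B := by nlinarith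
    have e1 : ((q : ℝ) + (1 - 2 * B / K)) / q = ((q + 1) * K - 2 * B) / (q * K) := by
      field_simp
      ring
    generalize ((q : ℝ) + 1) * K - 2 * B = E at hden e1 ⊢
    refine ⟨1 - 2 * B / K, C', ?_, by positivity, hC', ?_, ?_⟩
    · rw [sub_pos, div_lt_one hκ0]; exact hκb
    · rw [e1]
      have : (1 + δ) * q * K / E * (E / (q * K)) =
          1 + δ := by field_simp
      rw [this]; linarith
    · rw [e1]
      have : 2 * (2 * q * K / E) * (E / (q * K)) = 4 := by
        field_simp; norm_num
      rw [this]
  | subGaussPoly δ ϱ hδ hϱ ξ a hind hmu hgrad =>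
    refine slow δ ϱ hδ hϱ hind fun τ hτ0 hτ1 => ?_
    obtain ⟨D, hD⟩ := hmu.exists_tail 1
    obtain ⟨C, hC, hCg⟩ := hgrad.exists_cosh_bound (b := τ / 2) (by positivity)
    exact ⟨τ / 2, 1, C, D, by positivity, one_pos, by ring, hC, hD, hCg⟩
  | subGaussExp δ ϱ hδ hϱ ξ b hind hmu hgrad =>
    refine slow δ ϱ hδ hϱ hind fun τ hτ0 hτ1 => ?_
    obtain ⟨B, hB0, hB⟩ : ∃ B : ℝ, 0 < B ∧ ∀ j, b j ≤ B := by
      obtain ⟨j₀, hj₀⟩ := Finite.exists_max b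
      exact ⟨max 1 (b j₀), by positivity, fun j => (hj₀ j).trans (le_max_right _ _)⟩
    obtain ⟨D, hD⟩ := hmu.exists_tail (2 * B / τ)
    obtain ⟨C, hC, hCg⟩ := hgrad.exists_cosh_bound hB0 hB
    exact ⟨B, 2 * B / τ, C, D, hB0, by positivity, by field_simp, hC, hD, hCg⟩

end Regimes

/-! ### Measurability of the algorithm -/

section AlgorithmMeasurability

variable {Ω : Type*} [MeasurableSpace Ω] {P : Problem d q}

theorem measurableSet_setOf_and {p r : Ω → Prop} (hp : MeasurableSet {ω | p ω})
    (hr : MeasurableSet {ω | r ω}) : MeasurableSet {ω | p ω ∧ r ω} :=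
  hp.inter hr

theorem Problem.measurableSet_acceptable (hF : P.RegularNoise) (hmap : P.SamplingMap) (A : Params d)
    (e γ : ℝ) (k : ℕ) {W : Ω → Draws q} (hW : ∀ l s m, Measurable fun ω => W ω l s m)
    {τ : Ω → Dec d} (hτ : Measurable τ) {Δ : Ω → ℝ} (hΔ : Measurable Δ) (l : ℕ) :
    MeasurableSet {ω | P.Acceptable A e γ k (Δ ω) (W ω) (τ ω) l} := by
  refine measurableSet_setOf_and (MeasurableSet.const _)
    (measurableSet_setOf_and (MeasurableSet.const _) (measurableSet_le ?_ ?_))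
  · simp only [Problem.varEstimate_eq]
    exact ((measurable_const.max (Problem.measurable_meanStratumVar hF hmap hτ _ (hW l))).div_const
      _).sqrt.const_mul _
  · exact (hΔ.pow_const _).const_mul _

theorem Problem.measurable_splits (hF : P.RegularNoise) (hmap : P.SamplingMap) (A : Params d)
    (e γ : ℝ) (k : ℕ) {W : Ω → Draws q} (hW : ∀ l s m, Measurable fun ω => W ω l s m)
    {τ : Ω → Dec d} (hτ : Measurable τ) {Δ : Ω → ℝ} (hΔ : Measurable Δ) :
    Measurable fun ω => P.splits A e γ k (Δ ω) (W ω) (τ ω) := by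
  classical
  have hm := Problem.measurableSet_acceptable hF hmap A e γ k hW hτ hΔ
  -- when no size is accepted, the infimum of the empty set and the search below are both `0`
  have hex : ∀ ω, ∃ n, P.Acceptable A e γ k (Δ ω) (W ω) (τ ω) n ∨
      ∀ m, ¬ P.Acceptable A e γ k (Δ ω) (W ω) (τ ω) m := by
    intro ω
    by_cases h : ∃ n, P.Acceptable A e γ k (Δ ω) (W ω) (τ ω) n
    · exact h.imp fun _ => Or.inl
    · exact ⟨0, Or.inr (not_exists.1 h)⟩
  have hnone : MeasurableSet {ω | ∀ m, ¬ P.Acceptable A e γ k (Δ ω) (W ω) (τ ω) m} := by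
    rw [Set.ofPred_forall]
    exact MeasurableSet.iInter fun m => (hm m).compl
  have h := measurable_find hex fun n => (hm n).union hnone
  convert h using 2 with ω
  by_cases hω : ∃ n, P.Acceptable A e γ k (Δ ω) (W ω) (τ ω) n
  · have hs : (Nat.find hω) = Nat.find (hex ω) := by
      refine Nat.find_congr' fun {n} => ?_
      exact ⟨Or.inl, fun h => h.elim id fun h => absurd hω (not_exists.2 h)⟩
    rw [Problem.splits, Nat.sInf_def (s := {l | P.Acceptable A e γ k (Δ ω) (W ω) (τ ω) l}) hω]
    exact hs
  · have h0 : {l | P.Acceptable A e γ k (Δ ω) (W ω) (τ ω) l} = ∅ :=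
      Set.eq_empty_iff_forall_notMem.2 (not_exists.1 hω)
    rw [Problem.splits, h0, Nat.sInf_empty, eq_comm, Nat.find_eq_zero]
    exact Or.inr (not_exists.1 hω)

theorem measurable_apply_nat {g : ℕ → Ω → ℝ} {N : Ω → ℕ} (hg : ∀ l, Measurable (g l))
    (hN : Measurable N) : Measurable fun ω => g (N ω) ω := by
  have h : Measurable fun p : Ω × ℕ => g p.2 p.1 := measurable_from_prod_countable_left hg
  exact h.comp (measurable_id.prodMk hN)

theorem Problem.measurable_adaptiveEstimate (hF : P.RegularNoise) (hmap : P.SamplingMap)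
    (A : Params d) (e γ : ℝ) (k : ℕ) {W : Ω → Draws q}
    (hW : ∀ l s m, Measurable fun ω => W ω l s m)
    {τ : Ω → Dec d} (hτ : Measurable τ) {Δ : Ω → ℝ} (hΔ : Measurable Δ) :
    Measurable fun ω => P.adaptiveEstimate A e γ k (Δ ω) (W ω) (τ ω) := by
  have h := measurable_apply_nat
    (fun l => Problem.measurable_estimate hF hmap hτ A.nbar (hW l))
    (Problem.measurable_splits hF hmap A e γ k hW hτ hΔ)
  exact h

theorem measurable_design {τ : Ω → Dec d} (hτ : Measurable τ) {Δ : Ω → ℝ} (hΔ : Measurable Δ)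
    (i : DQIndex d) : Measurable fun ω => design (τ ω) (Δ ω) i := by
  match i with
  | .inl _ => exact hτ
  | .inr (.inl j) => exact hτ.add (hΔ.smul_const _)
  | .inr (.inr j) => exact hτ.sub (hΔ.smul_const _)

theorem measurable_coord {τ : Ω → Dec d} (hτ : Measurable τ) (j : Fin d) :
    Measurable fun ω => τ ω j :=
  (EuclideanSpace.proj j : Dec d →L[ℝ] ℝ).continuous.measurable.comp hτ

theorem measurable_dqBasis {τ x : Ω → Dec d} (hτ : Measurable τ) (hx : Measurable x)
    (i : DQIndex d) : Measurable fun ω => dqBasis (τ ω) i (x ω) := by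
  match i with
  | .inl _ => exact measurable_const
  | .inr (.inl j) => exact (measurable_coord hx j).sub (measurable_coord hτ j)
  | .inr (.inr j) =>
    exact (((measurable_coord hx j).sub (measurable_coord hτ j)).pow_const 2).div_const 2

theorem measurable_dqModel {τ x : Ω → Dec d} (hτ : Measurable τ) (hx : Measurable x)
    {β : Ω → DQIndex d → ℝ} (hβ : Measurable β) :
    Measurable fun ω => dqModel (τ ω) (β ω) (x ω) :=
  Finset.measurable_fun_sum _ fun i _ =>
    ((measurable_pi_apply i).comp hβ).mul (measurable_dqBasis hτ hx i)

theorem measurable_det {ι : Type*} [Fintype ι] [DecidableEq ι] {M : Ω → Matrix ι ι ℝ}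
    (hM : ∀ i j, Measurable fun ω => M ω i j) : Measurable fun ω => (M ω).det := by
  simp only [Matrix.det_apply]
  exact Finset.measurable_fun_sum _ fun σ _ =>
    (Finset.measurable_fun_prod _ fun i _ => hM _ _).const_smul _

theorem measurable_inv_apply {ι : Type*} [Fintype ι] [DecidableEq ι] {M : Ω → Matrix ι ι ℝ}
    (hM : ∀ i j, Measurable fun ω => M ω i j) (i j : ι) : Measurable fun ω => (M ω)⁻¹ i j := by
  simp only [Matrix.inv_def, Matrix.smul_apply, Ring.inverse_eq_inv', smul_eq_mul,
    Matrix.adjugate_apply]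
  refine (measurable_det hM).inv.mul (measurable_det fun a b => ?_)
  simp only [Matrix.updateRow_apply]
  split_ifs
  · exact measurable_const
  · exact hM a b

theorem measurable_dqCoeff {τ : Ω → Dec d} (hτ : Measurable τ) {Δ : Ω → ℝ} (hΔ : Measurable Δ)
    {y : Ω → DQIndex d → ℝ} (hy : ∀ i, Measurable fun ω => y ω i) :
    Measurable fun ω => dqCoeff (τ ω) (Δ ω) (y ω) := by
  refine measurable_pi_lambda _ fun i => ?_
  simp only [dqCoeff, Matrix.mulVec, dotProduct]
  refine Finset.measurable_fun_sum _ fun r _ => (measurable_inv_apply (fun a b => ?_) i r).mul (hy r)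
  exact measurable_dqBasis hτ (measurable_design hτ hΔ a) b

theorem measurable_norm_gradient_dqModel {τ : Ω → Dec d} {β : Ω → DQIndex d → ℝ}
    (hβ : Measurable β) : Measurable fun ω => ‖gradient (dqModel (τ ω) (β ω)) (τ ω)‖ := by
  simp only [gradient_dqModel, EuclideanSpace.norm_eq, sub_self, mul_zero, add_zero]
  refine (Finset.measurable_fun_sum _ fun j _ => ?_).sqrt
  exact (((measurable_pi_apply _).comp hβ).norm).pow_const 2

namespace Algorithm

variable {R : Algorithm d q} {v : Ω → DrawIndex d q → Fin q → ℝ} {k : ℕ} {τ : Ω → Dec d} {Δ : Ω → ℝ}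

theorem measurable_coeffAt (hF : R.P.RegularNoise) (hmap : R.P.SamplingMap)
    (hτ : Measurable τ) (hΔ : Measurable Δ)
    (hv : ∀ i, i.iter = k → i.point ≠ none → Measurable fun ω => v ω i) :
    Measurable fun ω => R.coeffAt (v ω) k (τ ω) (Δ ω) :=
  measurable_dqCoeff hτ hΔ fun i => Problem.measurable_adaptiveEstimate hF hmap R.A R.e R.γ k
    (W := fun ω l s m => v ω ⟨k, some i, l, s, m⟩) (fun _ _ _ => hv _ rfl (by simp))
    (measurable_design hτ hΔ i) hΔ

theorem measurable_candidateAt (hF : R.P.RegularNoise) (hmap : R.P.SamplingMap)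
    (hτ : Measurable τ) (hΔ : Measurable Δ)
    (hv : ∀ i, i.iter = k → i.point ≠ none → Measurable fun ω => v ω i) :
    Measurable fun ω => R.candidateAt (v ω) k (τ ω) (Δ ω) :=
  (R.S.measurable k).comp (hτ.prodMk (hΔ.prodMk (measurable_coeffAt hF hmap hτ hΔ hv)))

theorem measurableSet_successAt (hF : R.P.RegularNoise) (hmap : R.P.SamplingMap)
    (hτ : Measurable τ) (hΔ : Measurable Δ) (hv : ∀ i, i.iter = k → Measurable fun ω => v ω i) :
    MeasurableSet {ω | R.SuccessAt (v ω) k (τ ω) (Δ ω)} := by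
  have hβ := measurable_coeffAt (k := k) hF hmap hτ hΔ fun i hi _ => hv i hi
  have hc := measurable_candidateAt (k := k) hF hmap hτ hΔ fun i hi _ => hv i hi
  refine measurableSet_setOf_and (measurableSet_le measurable_const ?_)
    (measurableSet_le hΔ ((measurable_norm_gradient_dqModel hβ).const_mul _))
  refine ((Problem.measurable_adaptiveEstimate hF hmap R.A R.e R.γ k
    (W := fun ω l s m => v ω ⟨k, some (.inl ()), l, s, m⟩) (fun _ _ _ => hv _ rfl) hτ hΔ).sub
    (Problem.measurable_adaptiveEstimate hF hmap R.A R.e R.γ k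
    (W := fun ω l s m => v ω ⟨k, none, l, s, m⟩) (fun _ _ _ => hv _ rfl) hc hΔ)).div
    ((measurable_dqModel hτ hτ hβ).sub (measurable_dqModel hτ hc hβ))

/-- The state at iteration `k` depends measurably on the draws of the earlier iterations, and on no
other draws. -/
theorem measurable_state (hF : R.P.RegularNoise) (hmap : R.P.SamplingMap) (k : ℕ)
    (hv : ∀ i, i.iter < k → Measurable fun ω => v ω i) :
    Measurable fun ω => R.state (v ω) k := by
  classical
  induction k with
  | zero => exact measurable_const
  | succ k ih =>
    have h := ih fun i hi => hv i (by omega)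
    have hv' : ∀ i : DrawIndex d q, i.iter = k → Measurable fun ω => v ω i :=
      fun i hi => hv i (by omega)
    have hc := measurable_candidateAt (k := k) hF hmap h.fst h.snd fun i hi _ => hv' i hi
    have hs := measurableSet_successAt (k := k) hF hmap h.fst h.snd hv'
    refine Measurable.ite hs (hc.prodMk ((h.snd.const_mul _).min measurable_const))
      (h.fst.prodMk (h.snd.const_mul _))

end Algorithm

end AlgorithmMeasurability

/-! ### Errors along the random iterates -/

namespace Algorithm

variable (R : Algorithm d q) (v : DrawIndex d q → Fin q → ℝ)

/-- The points at which iteration `k` evaluates the objective: the design points, and the candidate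
(labelled `none`). -/
def evalPoint (k : ℕ) : Option (DQIndex d) → Dec d
  | some i => design (R.iterate v k) (R.radius v k) i
  | none => R.candidateAt v k (R.iterate v k) (R.radius v k)

/-- The error of the estimate at an evaluation point of iteration `k`. -/
def evalError (k : ℕ) (i : Option (DQIndex d)) : ℝ :=
  R.P.adaptiveEstimate R.A R.e R.γ k (R.radius v k) (fun l s m => v ⟨k, i, l, s, m⟩)
    (R.evalPoint v k i) - R.P.f (R.evalPoint v k i)

theorem radius_pos (k : ℕ) : 0 < R.radius v k := by
  induction k with
  | zero => exact R.A.Δ₀_pos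
  | succ k ih =>
    have h1 := R.A.one_lt_γup
    have h2 := R.A.γdown_pos
    have h3 := R.A.Δmax_pos
    change 0 < (R.state v (k + 1)).2
    change 0 < (R.state v k).2 at ih
    rw [state]
    split_ifs
    · exact lt_min (by positivity) h3
    · exact mul_pos h2 ih

theorem radius_le (k : ℕ) : R.radius v k ≤ max R.A.Δ₀ R.A.Δmax := by
  induction k with
  | zero => exact le_max_left _ _
  | succ k ih =>
    have h0 := R.radius_pos v k
    change (R.state v (k + 1)).2 ≤ _
    change (R.state v k).2 ≤ _ at ih
    change 0 < (R.state v k).2 at h0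
    rw [state]
    split_ifs
    · exact (min_le_right _ _).trans (le_max_right _ _)
    · refine le_trans ?_ ih
      exact mul_le_of_le_one_left h0.le R.A.γdown_lt_one.le

variable {R}
variable {Ω : Type*} [MeasurableSpace Ω] {Pr : Measure Ω} [IsProbabilityMeasure Pr]
  {V : DrawIndex d q → Ω → Fin q → ℝ}

theorem measurable_evalPoint_radius (hF : R.P.RegularNoise) (hmap : R.P.SamplingMap)
    {Ω : Type*} [MeasurableSpace Ω] {v : Ω → DrawIndex d q → Fin q → ℝ} (k : ℕ)
    (i : Option (DQIndex d))
    (hv : ∀ a : DrawIndex d q, a.iter < k ∨ (i = none ∧ a.iter = k ∧ a.point ≠ none) →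
      Measurable fun ω => v ω a) :
    Measurable fun ω => (R.evalPoint (v ω) k i, R.radius (v ω) k) := by
  have hs := measurable_state (R := R) (v := v) hF hmap k fun a ha => hv a (Or.inl ha)
  refine Measurable.prodMk ?_ hs.snd
  cases i with
  | some i => exact measurable_design hs.fst hs.snd i
  | none =>
    exact measurable_candidateAt hF hmap hs.fst hs.snd fun a h1 h2 => hv a (Or.inr ⟨rfl, h1, h2⟩)

/-- The evaluation point is independent of the draws used to evaluate the objective at it, so a
bound on the error that is uniform over deterministic points carries over to the random one. -/
theorem measure_evalError_le (hf : Continuous R.P.f) (hF : R.P.RegularNoise)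
    (hmap : R.P.SamplingMap) (hV : IsUniformSample V Pr) {k : ℕ} {i : Option (DQIndex d)}
    {c : ℝ} {b : ENNReal}
    (hb : ∀ W : EvalIndex q → Ω → Fin q → ℝ, IsUniformSample W Pr → ∀ θ, ∀ Δ > 0,
      Δ ≤ max R.A.Δ₀ R.A.Δmax →
      Pr {ω | c * Δ ^ 2 <
        |R.P.adaptiveEstimate R.A R.e R.γ k Δ (toDraws W ω) θ - R.P.f θ|} ≤ b) :
    Pr {ω | c * R.radius (fun a => V a ω) k ^ 2 < |R.evalError (fun a => V a ω) k i|} ≤ b := by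
  set W : EvalIndex q → Ω → Fin q → ℝ := fun p => V ⟨k, i, p.1, p.2.1, p.2.2⟩ with hWdef
  have hW : IsUniformSample W Pr :=
    ⟨fun p => hV.measurable _, fun p => hV.map_eq _, hV.indep.precomp (by
      rintro ⟨l, s, m⟩ ⟨l', s', m'⟩ h
      simpa using h)⟩
  set Y : Ω → Dec d × ℝ := fun ω =>
    (R.evalPoint (fun a => V a ω) k i, R.radius (fun a => V a ω) k) with hY
  set Z : Ω → EvalIndex q → Fin q → ℝ := fun ω p => W p ω with hZ
  have hYm : Measurable Y :=
    measurable_evalPoint_radius hF hmap k i fun a _ => hV.measurable a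
  have hZm : Measurable Z := measurable_pi_lambda _ fun p => hW.measurable p
  let mi : DrawIndex d q → MeasurableSpace Ω := fun a => MeasurableSpace.comap (V a) inferInstance
  let S : Set (DrawIndex d q) := {a | a.iter < k ∨ (i = none ∧ a.iter = k ∧ a.point ≠ none)}
  let T : Set (DrawIndex d q) := {a | a.iter = k ∧ a.point = i}
  have hmi : ∀ (U : Set (DrawIndex d q)), ∀ a ∈ U, Measurable[⨆ a ∈ U, mi a] (V a) := fun U a ha =>
    (comap_measurable (V a)).mono
      (le_iSup₂ (f := fun (a : DrawIndex d q) (_ : a ∈ U) => mi a) a ha) le_rfl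
  have hind : IndepFun Y Z Pr := by
    have hST : Disjoint S T := by
      refine Set.disjoint_left.2 fun a hS hT => ?_
      rcases hS with h | ⟨h1, _, h3⟩
      · exact absurd hT.1 h.ne
      · exact h3 (hT.2.trans h1)
    have h := indep_iSup_of_disjoint (fun a => (hV.measurable a).comap_le) hV.indep hST
    refine indep_of_indep_of_le_left (indep_of_indep_of_le_right h ?_) ?_
    · refine Measurable.comap_le ?_
      exact @measurable_pi_lambda Ω _ _ (⨆ a ∈ T, mi a) _ _ fun p => hmi T _ ⟨rfl, rfl⟩
    · refine Measurable.comap_le ?_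
      exact @measurable_evalPoint_radius d q R hF hmap Ω (⨆ a ∈ S, mi a) (fun ω a => V a ω) k i
        fun a ha => hmi S a ha
  set B : Set ((Dec d × ℝ) × (EvalIndex q → Fin q → ℝ)) := {p | 0 < p.1.2 ∧
    p.1.2 ≤ max R.A.Δ₀ R.A.Δmax ∧ c * p.1.2 ^ 2 < |R.P.adaptiveEstimate R.A R.e R.γ k p.1.2
      (fun l s m => p.2 (l, s, m)) p.1.1 - R.P.f p.1.1|} with hB
  have hBm : MeasurableSet B := by
    have h1 : Measurable fun p : (Dec d × ℝ) × (EvalIndex q → Fin q → ℝ) => p.1.2 :=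
      measurable_fst.snd
    refine measurableSet_setOf_and (measurableSet_lt measurable_const h1)
      (measurableSet_setOf_and (measurableSet_le h1 measurable_const) (measurableSet_lt ?_ ?_))
    · exact (h1.pow_const 2).const_mul c
    · exact ((Problem.measurable_adaptiveEstimate hF hmap R.A R.e R.γ k
        (W := fun (p : (Dec d × ℝ) × (EvalIndex q → Fin q → ℝ)) l s m => p.2 (l, s, m))
        (fun l s m => (measurable_pi_apply _).comp measurable_snd) measurable_fst.fst h1).sub
        (hf.measurable.comp measurable_fst.fst)).abs
  have hpre : {ω | c * R.radius (fun a => V a ω) k ^ 2 < |R.evalError (fun a => V a ω) k i|} ⊆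
      (fun ω => (Y ω, Z ω)) ⁻¹' B := fun ω hω =>
    ⟨R.radius_pos _ k, R.radius_le _ k, hω⟩
  calc _ ≤ Pr ((fun ω => (Y ω, Z ω)) ⁻¹' B) := measure_mono hpre
    _ = ((Pr.map Y).prod (Pr.map Z)) B := by
        rw [← Measure.map_apply (hYm.prodMk hZm) hBm,
          (indepFun_iff_map_prod_eq_prod_map_map hYm.aemeasurable hZm.aemeasurable).1 hind]
    _ = ∫⁻ y, Pr.map Z (Prod.mk y ⁻¹' B) ∂(Pr.map Y) := Measure.prod_apply hBm
    _ ≤ ∫⁻ _, b ∂(Pr.map Y) := by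
        refine lintegral_mono fun y => ?_
        rw [Measure.map_apply hZm (measurable_prodMk_left hBm)]
        by_cases hy : 0 < y.2 ∧ y.2 ≤ max R.A.Δ₀ R.A.Δmax
        · exact (measure_mono fun ω hω => hω.2.2).trans (hb W hW y.1 y.2 hy.1 hy.2)
        · have : Z ⁻¹' (Prod.mk y ⁻¹' B) = ∅ :=
            Set.eq_empty_iff_forall_notMem.2 fun ω hω => hy ⟨hω.1, hω.2.1⟩
          rw [this, measure_empty]
          exact zero_le
    _ = b := by
        have : IsProbabilityMeasure (Pr.map Y) := Measure.isProbabilityMeasure_map hYm.aemeasurable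
        simp

/-- Almost surely all estimation errors are eventually at most any given multiple of the squared
trust-region radius. -/
theorem ae_eventually_abs_evalError_le (hq : 1 ≤ q) (hf : Continuous R.P.f)
    (hF : R.P.RegularNoise) (hmap : R.P.SamplingMap) (hreg : R.P.Regime R.e R.γ)
    (hV : IsUniformSample V Pr) {c : ℝ} (hc : 0 < c) :
    ∀ᵐ ω ∂Pr, ∀ᶠ k in atTop, ∀ i,
      |R.evalError (fun a => V a ω) k i| ≤ c * R.radius (fun a => V a ω) k ^ 2 := by
  obtain ⟨α, C, hα, he, hC, hp1, hp4⟩ := hreg.exists_withinVar_le hq hF hmap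
  obtain ⟨C', hC'⟩ := Problem.exists_adaptiveEstimate_error_le hq hF hmap R.A (γ := R.γ) he hα hC
  obtain ⟨K, hK⟩ := eventually_atTop.1 hC'
  set p : ℝ := (q + α) / q with hp
  set Δb := max R.A.Δ₀ R.A.Δmax with hΔb
  have hΔb0 : 0 < Δb := lt_max_of_lt_left R.A.Δ₀_pos
  set M : ℝ := |C'| * Δb ^ (2 * R.γ * p - 4) / c ^ 2 with hM
  have hM0 : 0 ≤ M := by positivity
  have hbound : ∀ k ≥ K, ∀ i, Pr {ω | c * R.radius (fun a => V a ω) k ^ 2 <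
      |R.evalError (fun a => V a ω) k i|} ≤ ENNReal.ofReal (M * (k : ℝ) ^ (-(R.e * p))) := by
    intro k hk i
    refine measure_evalError_le hf hF hmap hV fun W hW θ Δ hΔ hΔ' => ?_
    refine (hK k hk hW θ Δ hΔ (c * Δ ^ 2) (by positivity)).trans (ENNReal.ofReal_le_ofReal ?_)
    have hk0 : (0 : ℝ) ≤ k := Nat.cast_nonneg k
    have e1 : ((k : ℝ) ^ R.e * Δ ^ (-(2 * R.γ))) ^ (-p) =
        (k : ℝ) ^ (-(R.e * p)) * (Δ ^ (2 * R.γ * p - 4) * Δ ^ 4) := by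
      rw [Real.mul_rpow (by positivity) (by positivity), ← Real.rpow_mul hk0,
        ← Real.rpow_mul hΔ.le, ← Real.rpow_natCast Δ 4, ← Real.rpow_add hΔ]
      congr 2
      · ring
      · push_cast; ring
    have h2 : Δ ^ (2 * R.γ * p - 4) ≤ Δb ^ (2 * R.γ * p - 4) :=
      Real.rpow_le_rpow hΔ.le hΔ' (by linarith)
    rw [e1, div_le_iff₀ (by positivity)]
    calc C' * ((k : ℝ) ^ (-(R.e * p)) * (Δ ^ (2 * R.γ * p - 4) * Δ ^ 4))
        ≤ |C'| * ((k : ℝ) ^ (-(R.e * p)) * (Δb ^ (2 * R.γ * p - 4) * Δ ^ 4)) := by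
          gcongr
          exact le_abs_self C'
      _ = _ := by
          rw [hM]
          field_simp
  have hsum : Summable fun k : ℕ => M * (k : ℝ) ^ (-(R.e * p)) :=
    (Real.summable_nat_rpow.2 (by linarith)).mul_left M
  have hi : ∀ i, ∀ᵐ ω ∂Pr, ∀ᶠ k in atTop,
      |R.evalError (fun a => V a ω) k i| ≤ c * R.radius (fun a => V a ω) k ^ 2 := by
    intro i
    have h := ae_eventually_notMem (μ := Pr) (s := fun k => {ω | K ≤ k ∧
      c * R.radius (fun a => V a ω) k ^ 2 < |R.evalError (fun a => V a ω) k i|}) (by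
        refine ne_top_of_le_ne_top hsum.tsum_ofReal_ne_top (ENNReal.tsum_le_tsum fun k => ?_)
        rcases le_or_gt K k with hk | hk
        · exact (measure_mono fun ω hω => hω.2).trans (hbound k hk i)
        · simp [not_le.2 hk])
    filter_upwards [h] with ω hω
    filter_upwards [hω, eventually_ge_atTop K] with k hk hkK
    by_contra! hcon
    exact hk ⟨hkK, hcon⟩
  filter_upwards [ae_all_iff.2 hi] with ω hω
  exact eventually_all.2 hω

end Algorithm

/-! ### Convergence along a sample path -/

namespace Algorithm

variable {R : Algorithm d q} {v : DrawIndex d q → Fin q → ℝ}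

theorem iterate_succ_of_mem {k : ℕ} (hk : k ∈ R.successful v) :
    R.iterate v (k + 1) = R.evalPoint v k none ∧
      R.radius v (k + 1) = min (R.A.γup * R.radius v k) R.A.Δmax := by
  have hk' : R.SuccessAt v k (R.state v k).1 (R.state v k).2 := hk
  have h : R.state v (k + 1) = (R.evalPoint v k none, min (R.A.γup * R.radius v k) R.A.Δmax) :=
    if_pos hk'
  exact ⟨(congrArg Prod.fst h :), (congrArg Prod.snd h :)⟩

theorem iterate_succ_of_notMem {k : ℕ} (hk : k ∉ R.successful v) :
    R.iterate v (k + 1) = R.iterate v k ∧ R.radius v (k + 1) = R.A.γdown * R.radius v k := by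
  have hk' : ¬ R.SuccessAt v k (R.state v k).1 (R.state v k).2 := hk
  have h : R.state v (k + 1) = (R.iterate v k, R.A.γdown * R.radius v k) := if_neg hk'
  exact ⟨(congrArg Prod.fst h :), (congrArg Prod.snd h :)⟩

/-- The decrease of the objective estimates in iteration `k`, the numerator of the acceptance
ratio. -/
def estimatedDecrease (R : Algorithm d q) (v : DrawIndex d q → Fin q → ℝ) (k : ℕ) : ℝ :=
  (R.evalError v k (some (.inl ())) + R.P.f (R.iterate v k)) -
    (R.evalError v k none + R.P.f (R.evalPoint v k none))

/-- The decrease of the model in iteration `k`, the denominator of the acceptance ratio. -/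
def modelDecrease (R : Algorithm d q) (v : DrawIndex d q → Fin q → ℝ) (k : ℕ) : ℝ :=
  R.model v k (R.iterate v k) - R.model v k (R.evalPoint v k none)

theorem mem_successful_iff {k : ℕ} : k ∈ R.successful v ↔
    R.A.η ≤ R.estimatedDecrease v k / R.modelDecrease v k ∧
      R.radius v k ≤ R.A.ηtilde * ‖gradient (R.model v k) (R.iterate v k)‖ := by
  have h : R.estimatedDecrease v k / R.modelDecrease v k =
      R.ratioAt v k (R.iterate v k) (R.radius v k) := by
    simp only [estimatedDecrease, evalError]
    have e : R.evalPoint v k (some (.inl ())) = R.iterate v k := rfl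
    rw [e, sub_add_cancel, sub_add_cancel]
    rfl
  rw [h]
  rfl

/-- Deterministic part of the convergence proof: bounded model Hessians and estimation errors of
smaller order than the squared radius. -/
theorem convergence_of_evalError (hf : R.P.SmoothObjective) {κH : ℝ}
    (hB : ∀ k, ‖R.modelHessian v k‖ ≤ κH)
    (herr : ∀ c > 0, ∀ᶠ k in atTop, ∀ i, |R.evalError v k i| ≤ c * R.radius v k ^ 2) :
    Tendsto (fun k => ‖gradient R.P.f (R.iterate v k)‖) atTop (𝓝 0) ∧
      Summable ((R.successful v).indicator fun k => R.radius v k ^ 2) ∧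
      Tendsto (R.radius v) atTop (𝓝 0) := by
  obtain ⟨L, hL⟩ := hf.lipschitz
  set κ := max κH 1 with hκdef
  have hκ : 0 < κ := lt_max_of_lt_right one_pos
  have hη := R.A.η_pos
  have hη1 := R.A.η_lt_one
  have hηt := R.A.ηtilde_pos
  have hΔ := R.radius_pos v
  have hcoeff : ∀ k j, |R.coeffAt v k (R.iterate v k) (R.radius v k) (.inr (.inr j))| ≤ κ :=
    fun k j => (abs_coeff_le_norm_hessian _ _ j).trans ((hB k).trans (le_max_left _ _))
  have hball : ∀ k, R.evalPoint v k none ∈ Metric.closedBall (R.iterate v k) (R.radius v k) :=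
    fun k => R.S.mem k _ _ _ (hΔ k)
  have hcauchy : ∀ k, ‖gradient (R.model v k) (R.iterate v k)‖ / 2 *
      min (‖gradient (R.model v k) (R.iterate v k)‖ / κ) (R.radius v k) ≤ R.modelDecrease v k :=
    fun k => cauchy_decrease (hΔ k) hκ (hcoeff k) (R.S.isMinOn k _ _ _ (hΔ k))
  have hcenter : ∀ k, R.model v k (R.iterate v k) =
      R.evalError v k (some (.inl ())) + R.P.f (R.iterate v k) := by
    intro k
    have e : R.evalPoint v k (some (.inl ())) = R.iterate v k := rfl
    rw [model, dqModel_self, coeffAt, dqCoeff_eq _ (hΔ k).ne', evalError, e, sub_add_cancel]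
    rfl
  -- the model decrease in a successful iteration is at least `a` times the squared radius
  set a := min (1 / (R.A.ηtilde * κ)) 1 / (2 * R.A.ηtilde) with ha
  have ha0 : 0 < a := by positivity
  refine trustRegion_convergence (c := fun k => R.evalPoint v k none) (γd := R.A.γdown)
    (γu := R.A.γup) (Δmax := R.A.Δmax) (c₁ := R.A.η * a / 2) hL hf.bddBelow R.A.γdown_pos
    R.A.γdown_lt_one R.A.one_lt_γup R.A.Δmax_pos hΔ
    (fun k => by simpa [dist_eq_norm] using hball k)
    (fun k hk => (iterate_succ_of_mem hk).1) (fun k hk => (iterate_succ_of_notMem hk).1)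
    (fun k hk => (iterate_succ_of_mem hk).2) (fun k hk => (iterate_succ_of_notMem hk).2)
    (by positivity) ?_ ?_
  · filter_upwards [herr (R.A.η * a / 4) (by positivity)] with k hk hS
    obtain ⟨h1, h2⟩ := mem_successful_iff.1 hS
    set g := ‖gradient (R.model v k) (R.iterate v k)‖
    set Δ := R.radius v k
    have hΔk : 0 < Δ := hΔ k
    have hg : Δ / R.A.ηtilde ≤ g := by rwa [div_le_iff₀' hηt]
    have h3 : a * Δ ^ 2 ≤ R.modelDecrease v k := by
      refine le_trans ?_ (hcauchy k)
      calc a * Δ ^ 2 = Δ / R.A.ηtilde / 2 * (min (1 / (R.A.ηtilde * κ)) 1 * Δ) := by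
            rw [ha]; field_simp
        _ = Δ / R.A.ηtilde / 2 * min (Δ / R.A.ηtilde / κ) Δ := by
            rw [min_mul_of_nonneg _ _ hΔk.le, one_mul]
            congr 2
            field_simp
        _ ≤ g / 2 * min (g / κ) Δ := by gcongr
    have h4 : 0 < R.modelDecrease v k := lt_of_lt_of_le (by positivity) h3
    rw [le_div_iff₀ h4] at h1
    have h5 : R.A.η * (a * Δ ^ 2) ≤ R.estimatedDecrease v k :=
      (mul_le_mul_of_nonneg_left h3 hη.le).trans h1
    have h6 := abs_le.1 (hk (some (.inl ())))
    have h7 := abs_le.1 (hk none)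
    simp only [estimatedDecrease] at h5
    linarith [h6.2, h7.1]
  · intro ε hε
    -- `D` bounds the error of the model gradient, `E` that of the predicted decrease
    set D : ℝ := d * (L + 1) with hD
    have hD0 : 0 ≤ D := by positivity
    set E : ℝ := 1 + D + κ / 2 + L + 1 with hE
    have hE0 : 0 < E := by positivity
    have hη1' : 0 < 1 - R.A.η := by linarith
    refine ⟨min (min (ε / (2 * κ)) (ε / (2 * (D + 1))))
      (min (R.A.ηtilde * ε / 2) ((1 - R.A.η) * ε / (4 * E))), by positivity, ?_⟩
    filter_upwards [herr 1 one_pos] with k hk hgrad hr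
    have r1 := hr.trans ((min_le_left _ _).trans (min_le_left _ _))
    have r2 := hr.trans ((min_le_left _ _).trans (min_le_right _ _))
    have r3 := hr.trans ((min_le_right _ _).trans (min_le_left _ _))
    have r4 := hr.trans ((min_le_right _ _).trans (min_le_right _ _))
    have hg := norm_modelGradient_sub_le hf.differentiable hL (R.iterate v k) (hΔ k)
      fun i => hk (some i)
    have hm := abs_model_sub_le hf.differentiable hL (R.iterate v k) (hΔ k)
      (fun i => hk (some i)) (hcoeff k) hκ.le (hball k)
    change ‖gradient (R.model v k) (R.iterate v k) - _‖ ≤ _ at hg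
    change |R.model v k (R.evalPoint v k none) - _| ≤ _ at hm
    have hdec := hcauchy k
    have hnone := abs_le.1 (hk none)
    have hgn : ‖gradient R.P.f (R.iterate v k)‖ ≤ ‖gradient (R.model v k) (R.iterate v k)‖ +
        ‖gradient (R.model v k) (R.iterate v k) - gradient R.P.f (R.iterate v k)‖ := by
      rw [norm_sub_rev]
      linarith [norm_sub_norm_le (gradient R.P.f (R.iterate v k))
        (gradient (R.model v k) (R.iterate v k))]
    have hΔk : 0 < R.radius v k := hΔ k
    rw [mem_successful_iff]
    set g := ‖gradient (R.model v k) (R.iterate v k)‖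
    set Δ := R.radius v k
    rw [le_div_iff₀ (by positivity)] at r1 r2 r4
    have hg2 : ε / 2 ≤ g := by
      have : D * Δ ≤ ε / 2 := by nlinarith
      rw [← hD] at hg
      linarith
    have hden : ε / 4 * Δ ≤ R.modelDecrease v k := by
      refine le_trans ?_ hdec
      have h1 : Δ ≤ g / κ := by
        rw [le_div_iff₀ hκ]
        linarith
      rw [min_eq_right h1]
      exact mul_le_mul_of_nonneg_right (by linarith) hΔk.le
    have hden0 : 0 < R.modelDecrease v k := lt_of_lt_of_le (by positivity) hden
    refine ⟨?_, ?_⟩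
    · rw [le_div_iff₀ hden0]
      have hnum : R.modelDecrease v k - E * Δ ^ 2 ≤ R.estimatedDecrease v k := by
        simp only [estimatedDecrease, modelDecrease, hcenter]
        have h1 := (abs_le.1 hm).1
        have h2 : E * Δ ^ 2 = (1 + d * (L + 1) + κ / 2 + L) * Δ ^ 2 + 1 * Δ ^ 2 := by
          rw [hE, hD]; ring
        linarith [hnone.2]
      have h3 : E * Δ ^ 2 ≤ (1 - R.A.η) * (ε / 4 * Δ) := by nlinarith
      have h4 : (1 - R.A.η) * (ε / 4 * Δ) ≤ (1 - R.A.η) * R.modelDecrease v k :=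
        mul_le_mul_of_nonneg_left hden hη1'.le
      linarith
    · have : R.A.ηtilde * (ε / 2) ≤ R.A.ηtilde * g := mul_le_mul_of_nonneg_left hg2 hηt.le
      linarith

end Algorithm

end Sastro

end

theorem mainTheorem4 {d q : ℕ} (hq : 1 ≤ q)
    (R : Sastro.Algorithm d q)
    (hf : R.P.SmoothObjective) (hF : R.P.RegularNoise) (hmap : R.P.SamplingMap)
    (hreg : R.P.Regime R.e R.γ)
    {Ω : Type*} [MeasurableSpace Ω] (Pr : Measure Ω) [IsProbabilityMeasure Pr]
    (V : Sastro.DrawIndex d q → Ω → (Fin q → ℝ))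
    (hVmeas : ∀ i, Measurable (V i))
    (hVunif : ∀ i, Pr.map (V i) = Sastro.unifCube q)
    (hVindep : iIndepFun V Pr)
    (hB : ∀ᵐ ω ∂Pr, ∃ κH : ℝ, ∀ k, ‖R.modelHessian (fun i => V i ω) k‖ ≤ κH) :
    ∀ᵐ ω ∂Pr,
      Tendsto (fun k => ‖gradient R.P.f (R.iterate (fun i => V i ω) k)‖) atTop (𝓝 0) ∧
      Summable ((R.successful fun i => V i ω).indicator
        fun k => R.radius (fun i => V i ω) k ^ 2) ∧
      Tendsto (R.radius fun i => V i ω) atTop (𝓝 0) := by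
  have herr := ae_all_iff.2 fun n : ℕ =>
    Sastro.Algorithm.ae_eventually_abs_evalError_le hq hf.differentiable.continuous hF hmap hreg
      ⟨hVmeas, hVunif, hVindep⟩ (c := 1 / ((n : ℝ) + 1)) (by positivity)
  filter_upwards [hB, herr] with ω ⟨κH, hκH⟩ hω
  refine Sastro.Algorithm.convergence_of_evalError hf hκH fun c hc => ?_
  obtain ⟨n, hn⟩ := exists_nat_one_div_lt hc
  filter_upwards [hω n] with k hk i
  exact (hk i).trans (by gcongr)
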